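/- **Setting.** Let $(Y_i,V_i,W_i)_{i\ge 1}$ be i.i.d. with values in $\{0,1\}\times\mathbb R\times\mathbb R^{d}$ and $Y_i=1\{V_i+g_0(W_i)-\varepsilon_i>0\}$ almost surely, where $\varepsilon_i$ is independent of $X_i=(V_i,W_i)$ and has distribution function $F_0$. Let $\mathcal W$ and $\mathcal X$ be the (topological) supports of $W_1$ and $X_1$. For $\theta=(g,F)$ put $p_\theta(x)=F(v+g(w))$ for $x=(v,w)$, and let $p_0=p_{(g_0,F_0)}$ be the true conditional choice probability. **Assumption 1.** There is a point $w_*\in\mathcal W$ such that all functions of the class $\mathcal G$ below vanish at $w_*$, and the conditional distribution of $V$ given $W=w_*$ (the weak limit of the conditional distributions of $V$ given $\|W-w_*\|\le r$ as $r\downarrow 0$) exists and has support $\mathbb R$. $F_0$ is strictly increasing, $g_0\in\mathcal G$ and $F_0\in\mathcal F$. **Assumption 2.** (a) $\mathcal W$ is compact. (b) $\mathcal G$ is the set of functions $g:\mathcal W\to\mathbb R$ with $g(w_*)=0$ that extend to a fixed open set $O\supseteq\mathcal W$ as an $m_w$ times differentiable function all of whose partial derivatives of orders $0,\dots,m_w$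 are bounded by $M_g$ on $O$; here $m_w\ge 1$ and $M_g>0$. (c) $\mathbb G_k$ is the reproducing kernel Hilbert space of a kernel $k$ on $\mathbb R^d$; $\mathcal G_n$ is the set of $g\in\mathcal G$ of the form $g=\tilde g-\tilde g(w_*)$ on $\mathcal W$ with $\tilde g\in\mathbb G_k$, $\|\tilde g\|_{\mathbb G_k}<B_n$; $B_n\to\infty$; and there are $g_n\in\mathcal G_n$ (for all large $n$) with $\sup_{\mathcal W}|g_n-g_0|\to0$. (d) $\mathcal F$ is the set of distribution functions on $\mathbb R$ with a Lebesgue density $f^2$, where $f$ is $(m_0+m_e)$ times differentiable and $\big(\sum_{0\le\lambda\le m_0+m_e}\int|f^{(\lambda)}(u)|^2(1+u^2)^{\eta_0}du\big)^{1/2}<M_F$, with positive integers $m_0,m_e$, $\eta_0>1/2$ and $M_F>0$. (e) $\mathcal F_n$ is the set of $F\in\mathcal F$ with a density $\big(\sum_{j=0}^{J_n}\tau_ju^je^{-u^2/4}\big)^2$, $\tau\in\mathbb R^{J_n+1}$, where $J_n\to\infty$. **Estimators.** Let $r_n$ be random tolerances with $r_n\to_p0$ (for instance $r_n=0$). *KNP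 least squares sieve estimator.* $(\hat g,\hat F)\in\mathcal G_n\times\mathcal F_n$ minimises $\hat Q(g,F)=\frac1n\sum_{i=1}^n\big(Y_i-F(V_i+g(W_i))\big)^2$ over $\mathcal G_n\times\mathcal F_n$, up to $r_n$ (exactly if $r_n=0$). *PC-regularised estimator.* Put $W_0=w_*$ and $K=(k(W_i,W_j))_{0\le i,j\le n}$, with eigenvalues $\hat\lambda_0\ge\dots\ge\hat\lambda_n$ and associated orthonormal eigenvectors $\hat u_0,\dots,\hat u_n$. For a possibly data-dependent $m$ let $\hat U_m$ and $\hat\Lambda_m$ collect the first $m$ eigenvectors and eigenvalues, so that $\hat\lambda_m$ is the largest omitted eigenvalue (with $\hat\lambda_m:=0$ if none is omitted). A vector $\zeta\in\mathbb R^m$ is admissible if $\zeta'\hat\Lambda_m^{-1}\zeta<B_n^2$ (coordinates of $\zeta$ belonging to zero eigenvalues being zero); it defines $\delta=\hat U_m\hat\Lambda_m^{-1}\zeta$ and $g_\zeta(w)=\sum_{j=0}^n\delta_j\big(k(W_j,w)-k(W_j,w_*)\big)$. The criterion is $\frac1n\sum_{i=1}^n\big(Y_i-F(V_i+[\hat U_m\zeta]_{i+1}-[\hat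 U_m\zeta]_1)\big)^2$. The estimator is $(\hat g_{pc},\hat F_{pc})=(g_{\hat\zeta},\hat F_{pc})\in\mathcal G\times\mathcal F_n$ with $\hat\zeta$ admissible, where $(\hat\zeta,\hat F_{pc})$ minimises the criterion up to $r_n$, either 1. over all pairs of an admissible $\zeta$ and $F\in\mathcal F_n$; or 2. over all pairs of an admissible $\zeta$ with $g_\zeta\in\mathcal G$ and $F\in\mathcal F_n$. In this case it is also assumed that the functions of $\mathbb G_k$ are $m_w$ times differentiable with bounded derivatives in the sense of (b), with bounds at most $C\|\tilde g\|_{\mathbb G_k}$ for some constant $C$ and all $\tilde g\in\mathbb G_k$, as for smooth kernels such as the Gaussian one. (The minimisation properties are required for all large $n$, almost surely.) **Theorem 3.** Under Assumptions 1–2, as $n\to\infty$, the KNP estimator satisfies $$\sup_{w\in\mathcal W}|\hat g(w)-g_0(w)|+\sup_{u\in\mathbb R}|\hat F(u)-F_0(u)|\to_p0\quad\text{and}\quad\sup_{x\in\mathcal X}|\hat p(x)-p_0(x)|\to_p0,$$ where $\hat p(x)=\hat F(v+\hat g(w))$. If $m$ is chosen such that $\hat\lambda_m^{1/2}B_n=o_p(1)$,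 the same two statements hold for the PC-regularised estimator $(\hat g_{pc},\hat F_{pc})$ and $\hat p_{pc}(x)=\hat F_{pc}(v+\hat g_{pc}(w))$. -/

import Mathlib

open MeasureTheory ProbabilityTheory Filter Set
open scoped Topology ENNReal BoundedContinuousFunction Matrix

noncomputable section

namespace KNP

/-- The covariate space `ℝ^d` of `W`, with its Euclidean norm. -/
abbrev E (d : ℕ) := EuclideanSpace ℝ (Fin d)

/-! ### The binary choice model -/

/-- The observations `(Y i, V i, W i)` are i.i.d. and follow the binary choice model
`Y = 1{V + g₀(W) - ε > 0}` with `ε` independent of `X = (V, W)` and with distribution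
function `F₀`. -/
structure BinaryChoiceModel {Ω : Type*} [MeasurableSpace Ω] (μ : Measure Ω) {d : ℕ}
    (Y V : ℕ → Ω → ℝ) (W : ℕ → Ω → E d) (ε : ℕ → Ω → ℝ)
    (g₀ : E d → ℝ) (F₀ : ℝ → ℝ) : Prop where
  measurable_Y : ∀ i, Measurable (Y i)
  measurable_V : ∀ i, Measurable (V i)
  measurable_W : ∀ i, Measurable (W i)
  measurable_error : ∀ i, Measurable (ε i)
  independent_obs : iIndepFun (fun i ω => (Y i ω, V i ω, W i ω)) μ
  identical_obs : ∀ i, IdentDistrib (fun ω => (Y i ω, V i ω, W i ω))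
    (fun ω => (Y 0 ω, V 0 ω, W 0 ω)) μ μ
  choice : ∀ i, ∀ᵐ ω ∂μ, Y i ω = if 0 < V i ω + g₀ (W i ω) - ε i ω then 1 else 0
  error_indep : ∀ i, IndepFun (ε i) (fun ω => (V i ω, W i ω)) μ
  error_cdf : ∀ i u, cdf (μ.map (ε i)) u = F₀ u

/-- `ν` is the conditional distribution of `V` given `W = w`: the weak limit, as `r ↓ 0`, of the
conditional distributions of `V` given that `W` lies in the closed ball of radius `r` about `w`.
(It is unique; at an atom `w` of `W` it is the elementary conditional distribution, and if a
regular conditional distribution has a version that is weakly continuous at `w`, it is the value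
of that version at `w`.) -/
def IsCondLawAt {Ω : Type*} [MeasurableSpace Ω] (μ : Measure Ω) {d : ℕ}
    (V : Ω → ℝ) (W : Ω → E d) (w : E d) (ν : Measure ℝ) : Prop :=
  ∀ f : ℝ →ᵇ ℝ,
    Tendsto (fun r : ℝ => ∫ ω, f (V ω) ∂(ProbabilityTheory.cond μ (W ⁻¹' Metric.closedBall w r)))
      (𝓝[>] 0) (𝓝 (∫ v, f v ∂ν))

/-! ### The parameter spaces -/

/-- `h` is `m` times differentiable on the open set `O`, and all its partial derivatives of the
orders `0, …, m` are bounded by `M` on `O`. -/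
def BoundedDerivs {d : ℕ} (O : Set (E d)) (m : ℕ) (M : ℝ) (h : E d → ℝ) : Prop :=
  (∀ j < m, ∀ x ∈ O, DifferentiableAt ℝ (iteratedFDeriv ℝ j h) x) ∧
  ∀ j ≤ m, ∀ x ∈ O, ∀ c : Fin j → Fin d,
    |iteratedFDeriv ℝ j h x (fun i => EuclideanSpace.single (c i) (1 : ℝ))| ≤ M

/-- Functions which agree on `𝒲` with a function on `O ⊇ 𝒲` whose derivatives up to order `m`
are bounded by `M`. Only the values on `𝒲` matter. -/
def smoothClass {d : ℕ} (𝒲 O : Set (E d)) (m : ℕ) (M : ℝ) : Set (E d → ℝ) :=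
  {g | ∃ h : E d → ℝ, EqOn g h 𝒲 ∧ BoundedDerivs O m M h}

/-- The parameter space `𝒢` of `g₀`. -/
def gSpace {d : ℕ} (𝒲 O : Set (E d)) (m : ℕ) (M : ℝ) (wstar : E d) : Set (E d → ℝ) :=
  {g | g ∈ smoothClass 𝒲 O m M ∧ g wstar = 0}

/-- The weighted Sobolev norm
`(∑_{λ ≤ s} ∫ |f^(λ)(u)|² (1 + u²)^η du)^(1/2)`, with values in `[0, ∞]`. -/
def weightedSobolevNorm (s : ℕ) (η : ℝ) (f : ℝ → ℝ) : ℝ≥0∞ :=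
  (∑ j ∈ Finset.range (s + 1),
    ∫⁻ u : ℝ, ENNReal.ofReal (|iteratedDeriv j f u| ^ 2 * (1 + u ^ 2) ^ η)) ^ (1 / 2 : ℝ)

/-- `F` is a distribution function with Lebesgue density `f²`. -/
def HasSqDensity (F f : ℝ → ℝ) : Prop :=
  Integrable (fun t => f t ^ 2) ∧ ∫ t, f t ^ 2 = 1 ∧ ∀ u, F u = ∫ t in Iic u, f t ^ 2

/-- The parameter space `ℱ` of `F₀`: distribution functions with a Lebesgue density `f²`, where
`f` is `s` times differentiable with weighted Sobolev norm less than `M`. -/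
def distSpace (s : ℕ) (η M : ℝ) : Set (ℝ → ℝ) :=
  {F | ∃ f : ℝ → ℝ, (∀ j < s, Differentiable ℝ (iteratedDeriv j f)) ∧
    weightedSobolevNorm s η f < ENNReal.ofReal M ∧ HasSqDensity F f}

/-! ### The sieves -/

/-- The square root density `∑_{j ≤ J} τ_j u^j e^{-u²/4}`. -/
def sieveRoot (J : ℕ) (τ : Fin (J + 1) → ℝ) (u : ℝ) : ℝ :=
  ∑ j : Fin (J + 1), τ j * u ^ (j : ℕ) * Real.exp (-u ^ 2 / 4)

/-- The sieve `ℱ_n` of polynomial order `J`, inside the parameter space. -/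
def distSieve (s : ℕ) (η M : ℝ) (J : ℕ) : Set (ℝ → ℝ) :=
  {F | F ∈ distSpace s η M ∧ ∃ τ : Fin (J + 1) → ℝ, HasSqDensity F (sieveRoot J τ)}

/-- The sieve inside `𝒢` formed by the functions `f - f(w_*)`, where `f` is in the open ball of
radius `B` of the reproducing kernel Hilbert space `H`. -/
def gSieve {d : ℕ} (H : Type*) [NormedAddCommGroup H] [InnerProductSpace ℝ H] [RKHS ℝ H (E d) ℝ]
    (𝒲 O : Set (E d)) (m : ℕ) (M : ℝ) (wstar : E d) (B : ℝ) : Set (E d → ℝ) :=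
  {g | g ∈ gSpace 𝒲 O m M wstar ∧ ∃ f : H, ‖f‖ < B ∧ ∀ w ∈ 𝒲, g w = f w - f wstar}

/-- The real-valued reproducing kernel `k` of `H`. -/
def scalarKernel {d : ℕ} (H : Type*) [NormedAddCommGroup H] [InnerProductSpace ℝ H] [CompleteSpace H]
    [RKHS ℝ H (E d) ℝ] (u v : E d) : ℝ := RKHS.kernel H u v 1

/-- On `𝒲`, the functions of the Hilbert space `H` have bounded derivatives up to order `m`, with
bounds proportional to their norms, i.e. `H` is continuously embedded into the space of such
functions. -/
def SmoothlyEmbedded {d : ℕ} (H : Type*) [NormedAddCommGroup H] [InnerProductSpace ℝ H]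
    [RKHS ℝ H (E d) ℝ] (𝒲 O : Set (E d)) (m : ℕ) : Prop :=
  ∃ C : ℝ, ∀ f : H, (f : E d → ℝ) ∈ smoothClass 𝒲 O m (C * ‖f‖)

/-! ### The least squares estimator -/

/-- The least squares criterion `Q̂(g, F)` for the first `n` observations. -/
def Qhat {Ω : Type*} {d : ℕ} (Y V : ℕ → Ω → ℝ) (W : ℕ → Ω → E d) (n : ℕ) (ω : Ω)
    (g : E d → ℝ) (F : ℝ → ℝ) : ℝ :=
  (1 / (n : ℝ)) * ∑ i : Fin n, (Y i ω - F (V i ω + g (W i ω))) ^ 2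

/-- `(g, F)` minimises `Q` over `𝒜 × ℬ` up to the tolerance `r` (exactly, if `r = 0`). -/
def IsNearMin {d : ℕ} (Q : (E d → ℝ) → (ℝ → ℝ) → ℝ) (𝒜 : Set (E d → ℝ)) (ℬ : Set (ℝ → ℝ))
    (r : ℝ) (g : E d → ℝ) (F : ℝ → ℝ) : Prop :=
  g ∈ 𝒜 ∧ F ∈ ℬ ∧ ∀ g' ∈ 𝒜, ∀ F' ∈ ℬ, Q g F ≤ Q g' F' + r

/-! ### The estimator regularised by principal components -/

/-- The points `W_0 := w_*, W_1, …, W_n`. -/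
def points {Ω : Type*} {d : ℕ} (W : ℕ → Ω → E d) (wstar : E d) (n : ℕ) (ω : Ω) :
    Fin (n + 1) → E d :=
  Fin.cons wstar (fun i : Fin n => W i ω)

/-- The Gram matrix of the kernel at the given points. -/
def gram {d : ℕ} (H : Type*) [NormedAddCommGroup H] [InnerProductSpace ℝ H] [CompleteSpace H]
    [RKHS ℝ H (E d) ℝ] {n : ℕ} (x : Fin (n + 1) → E d) :
    Matrix (Fin (n + 1)) (Fin (n + 1)) ℝ :=
  Matrix.of fun i j => scalarKernel H (x i) (x j)

/-- `lam` lists the eigenvalues of `K` in descending order and `u` is an associated orthonormal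
family of eigenvectors (`u l` is the `l`-th eigenvector). -/
structure IsEigensystem {n : ℕ} (K : Matrix (Fin (n + 1)) (Fin (n + 1)) ℝ)
    (lam : Fin (n + 1) → ℝ) (u : Fin (n + 1) → Fin (n + 1) → ℝ) : Prop where
  antitone : Antitone lam
  orthonormal : ∀ l l', u l ⬝ᵥ u l' = if l = l' then 1 else 0
  eigen : ∀ l, K *ᵥ u l = lam l • u l

/-- The largest eigenvalue that is omitted when the first `m` ones (with indices `0, …, m - 1`)
are retained, i.e. the eigenvalue with index `m`; it is `0` if none is omitted. -/
def omittedEigenvalue {n : ℕ} (lam : Fin (n + 1) → ℝ) (m : ℕ) : ℝ :=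
  if h : m < n + 1 then lam ⟨m, h⟩ else 0

/-- The admissible `ζ ∈ ℝ^m`, written as vectors in `ℝ^{n+1}` whose coordinates from the index `m`
on vanish: `ζ' Λ_m⁻¹ ζ < B²`. A coordinate that belongs to a vanishing eigenvalue has to be zero
(as for `ζ = Λ_m U_m' δ`); this is void if `Λ_m` is invertible. -/
def pcAdmissible {n : ℕ} (lam : Fin (n + 1) → ℝ) (m : ℕ) (B : ℝ) : Set (Fin (n + 1) → ℝ) :=
  {ζ | (∀ l : Fin (n + 1), m ≤ (l : ℕ) → ζ l = 0) ∧ (∀ l, lam l = 0 → ζ l = 0) ∧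
    ∑ l, ζ l ^ 2 / lam l < B ^ 2}

/-- `U_m ζ`. -/
def pcFitted {n : ℕ} (u : Fin (n + 1) → Fin (n + 1) → ℝ) (ζ : Fin (n + 1) → ℝ) :
    Fin (n + 1) → ℝ := fun i => ∑ l, ζ l * u l i

/-- `δ = U_m Λ_m⁻¹ ζ`. -/
def pcCoef {n : ℕ} (lam : Fin (n + 1) → ℝ) (u : Fin (n + 1) → Fin (n + 1) → ℝ)
    (ζ : Fin (n + 1) → ℝ) : Fin (n + 1) → ℝ := fun i => ∑ l, ζ l / lam l * u l i

/-- The function `w ↦ ∑_j δ_j (k(W_j, w) - k(W_j, w_*))` with `δ = U_m Λ_m⁻¹ ζ`. -/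
def pcFun {d : ℕ} (H : Type*) [NormedAddCommGroup H] [InnerProductSpace ℝ H] [CompleteSpace H]
    [RKHS ℝ H (E d) ℝ] {n : ℕ} (x : Fin (n + 1) → E d) (wstar : E d)
    (lam : Fin (n + 1) → ℝ) (u : Fin (n + 1) → Fin (n + 1) → ℝ) (ζ : Fin (n + 1) → ℝ) :
    E d → ℝ :=
  fun w => ∑ j, pcCoef lam u ζ j * (scalarKernel H (x j) w - scalarKernel H (x j) wstar)

/-- The criterion `(1/n) ∑_i (Y_i - F(V_i + [U_m ζ]_i - [U_m ζ]_0))²`, where the coordinate `0`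
belongs to `W_0 = w_*` and the coordinate `i = 1, …, n` to `W_i`. -/
def pcQhat {Ω : Type*} (Y V : ℕ → Ω → ℝ) (n : ℕ) (ω : Ω)
    (u : Fin (n + 1) → Fin (n + 1) → ℝ) (ζ : Fin (n + 1) → ℝ) (F : ℝ → ℝ) : ℝ :=
  (1 / (n : ℝ)) * ∑ i : Fin n, (Y i ω - F (V i ω + pcFitted u ζ i.succ - pcFitted u ζ 0)) ^ 2

/-- `(ζ, F)` minimises `Q` up to the tolerance `r` (exactly, if `r = 0`) over the pairs of a
`ζ' ∈ Z` for which the function `G ζ'` lies in `𝒜`, and an `F' ∈ ℬ`; moreover `ζ ∈ Z`,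
`G ζ ∈ 𝒢` and `F ∈ ℬ`. -/
def IsPCNearMin {d N : ℕ} (Q : (Fin N → ℝ) → (ℝ → ℝ) → ℝ) (G : (Fin N → ℝ) → E d → ℝ)
    (Z : Set (Fin N → ℝ)) (𝒢 𝒜 : Set (E d → ℝ)) (ℬ : Set (ℝ → ℝ)) (r : ℝ)
    (ζ : Fin N → ℝ) (F : ℝ → ℝ) : Prop :=
  ζ ∈ Z ∧ G ζ ∈ 𝒢 ∧ F ∈ ℬ ∧ ∀ ζ' ∈ Z, G ζ' ∈ 𝒜 → ∀ F' ∈ ℬ, Q ζ F ≤ Q ζ' F' + r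

/-! ### Consistency -/

/-- `d_Θ((g, F), (g₀, F₀)) = sup_{w ∈ 𝒲} |g(w) - g₀(w)| + sup_u |F(u) - F₀(u)|`. -/
def dTheta {d : ℕ} (𝒲 : Set (E d)) (g g₀ : E d → ℝ) (F F₀ : ℝ → ℝ) : ℝ≥0∞ :=
  (⨆ w ∈ 𝒲, ENNReal.ofReal |g w - g₀ w|) + ⨆ u : ℝ, ENNReal.ofReal |F u - F₀ u|

/-- The choice probability `p_θ(x) = F(v + g(w))` at `x = (v, w)`. -/
def ccp {d : ℕ} (g : E d → ℝ) (F : ℝ → ℝ) (x : ℝ × E d) : ℝ := F (x.1 + g x.2)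

/-- `sup_{x ∈ 𝒳} |p(x) - p₀(x)|`. -/
def dPi {d : ℕ} (𝒳 : Set (ℝ × E d)) (p p₀ : ℝ × E d → ℝ) : ℝ≥0∞ :=
  ⨆ x ∈ 𝒳, ENNReal.ofReal |p x - p₀ x|

/-- Convergence to zero in probability of `[0, ∞]`-valued quantities (in outer probability, if
they are not measurable). -/
def ToZeroInProb {Ω : Type*} [MeasurableSpace Ω] (μ : Measure Ω) (D : ℕ → Ω → ℝ≥0∞) : Prop :=
  ∀ e : ℝ≥0∞, 0 < e → Tendsto (fun n => μ {ω | e ≤ D n ω}) atTop (𝓝 0)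

end KNP

end

/-! Both estimators are treated as approximate minimisers of the least squares criterion. The
argument has an analytic half, which never mentions the sieves, and an approximation half, which
supplies one good competitor in each sieve.

Analytic half (`consistency_of_nearMin`). In the sup norm, the parameter space lies in a compact set
of pairs of bounded continuous functions. Index functions are bounded and locally Lipschitz on a
compact set. Distribution functions are uniformly Lipschitz by a Sobolev inequality, and their tails
are uniformly small by the weight `(1 + u²)^η`; this replaces compactness of the line. The squared
loss is Lipschitz in the parameter, so the law of large numbers is uniform over the compact set.
Since `F₀(V + g₀(W))` is the conditional mean of `Y`, the population criterion exceeds its value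
`Q₀` at the truth by the mean squared distance of the choice probabilities. This distance vanishes
only at the truth: at `w_*` all index functions vanish and the conditional law of `V` has full
support, so `F` is determined everywhere; then injectivity of `F₀` determines `g`. By compactness
the minimum is well separated. Hence any random parameter whose empirical criterion is at most `Q₀ +
e` with probability tending to one, for every `e > 0`, is consistent. No sieve, rate or entropy
bound enters.

Approximation half. For `F₀`, polynomials times `exp(-u²/4)` are dense in the weighted Sobolev space
(`exists_polynomial_gaussian_approx`), and the strict norm bound leaves room to renormalise the
approximation to a density (`exists_mem_distSieve`). For `g₀`, density of the sieves is assumed. A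
single fixed RKHS function close to `g₀` suffices, because the radii `B n` diverge.

For the principal component estimator the competitor has to be a combination of the leading
components. If all admissible `ζ` compete, only fitted values at the sample points matter.
Projecting an RKHS function onto the kernel sections at these points preserves its values there, and
dropping the trailing components changes them by at most `√λ_m B`
(`IsEigensystem.exists_pcFitted_close`). If competitors must also lie in `𝒢`, the whole function has
to be controlled, with its derivatives. The target is shrunk by a factor `1 - τ` to gain slack in
the derivative bounds, then approximated in RKHS norm by finitely many kernel sections, whose
centres are moved to nearby sample points before truncation (`exists_pcFun_mem_gSpace`). -/

namespace KNP

/-! ### Compact classes of bounded continuous functions -/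

/-- The `L`-Lipschitz functions with values in `[0, 1]` whose distances to the limits `0` at `-∞`
and `1` at `∞` are bounded by `τ`. -/
def cdfClass (L : NNReal) (τ : ℝ → ℝ) : Set (ℝ →ᵇ ℝ) :=
  {F | (∀ x, F x ∈ Icc (0 : ℝ) 1) ∧ (∀ x y, |F x - F y| ≤ L * |x - y|) ∧
    (∀ x ≤ 0, F x ≤ τ x) ∧ ∀ x, 0 ≤ x → 1 - F x ≤ τ x}

lemma continuous_bcf_eval {α : Type*} [TopologicalSpace α] (x : α) :
    Continuous fun F : α →ᵇ ℝ => F x :=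
  continuous_eval_const x

lemma isClosed_cdfClass (L : NNReal) (τ : ℝ → ℝ) : IsClosed (cdfClass L τ) := by
  have hc := fun x : ℝ => continuous_bcf_eval x
  simp only [cdfClass, ofPred_and, ofPred_forall]
  refine (isClosed_iInter fun x => isClosed_Icc.preimage (hc x)).inter
    ((isClosed_iInter fun x => isClosed_iInter fun y =>
      isClosed_le (((hc x).sub (hc y)).abs) continuous_const).inter
    ((isClosed_iInter fun x => isClosed_iInter fun _ => isClosed_le (hc x) continuous_const).inter
      (isClosed_iInter fun x => isClosed_iInter fun _ =>
        isClosed_le (continuous_const.sub (hc x)) continuous_const)))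

lemma abs_sub_le_of_mem_cdfClass {L : NNReal} {τ : ℝ → ℝ} {F G : ℝ →ᵇ ℝ}
    (hF : F ∈ cdfClass L τ) (hG : G ∈ cdfClass L τ) (x : ℝ) : |F x - G x| ≤ τ x := by
  have h1 := hF.1 x
  have h2 := hG.1 x
  rcases le_total x 0 with hx | hx
  · have h3 := hF.2.2.1 x hx
    have h4 := hG.2.2.1 x hx
    rw [abs_le]; constructor <;> linarith [h1.1, h2.1]
  · have h3 := hF.2.2.2 x hx
    have h4 := hG.2.2.2 x hx
    rw [abs_le]; constructor <;> linarith [h1.2, h2.2]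

/-- Outside a compact set `S` the tail bound is below `e / 2`, so any two members are close there
without further argument. On `S`, Arzelà–Ascoli gives a finite net for the restrictions, and cells
of this net have small diameter on the whole line. -/
lemma isCompact_cdfClass (L : NNReal) {τ : ℝ → ℝ} (hτ : Tendsto τ (cocompact ℝ) (𝓝 0)) :
    IsCompact (cdfClass L τ) := by
  refine TotallyBounded.isCompact_of_isClosed ?_ (isClosed_cdfClass L τ)
  refine Metric.totallyBounded_of_finite_discretization fun e he => ?_
  have h1 : ∀ᶠ x in cocompact ℝ, τ x < e / 2 := hτ.eventually (gt_mem_nhds (by positivity))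
  obtain ⟨S, hS, hSτ⟩ := mem_cocompact.1 h1
  have : CompactSpace S := isCompact_iff_compactSpace.1 hS
  let ρ : (ℝ →ᵇ ℝ) → (S →ᵇ ℝ) := fun F => F.domRestrict S
  have hρ : IsCompact (closure (ρ '' cdfClass L τ)) := by
    refine BoundedContinuousFunction.arzela_ascoli (Icc (0 : ℝ) 1) isCompact_Icc _ ?_ ?_
    · rintro _ x ⟨F, hF, rfl⟩
      exact hF.1 x
    · apply UniformEquicontinuous.equicontinuous
      refine LipschitzWith.uniformEquicontinuous _ L ?_
      rintro ⟨_, F, hF, rfl⟩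
      refine LipschitzWith.of_dist_le_mul fun x y => ?_
      exact hF.2.1 x y
  have htb : TotallyBounded (ρ '' cdfClass L τ) :=
    hρ.totallyBounded.subset subset_closure
  obtain ⟨t, htf, ht⟩ := Metric.totallyBounded_iff.1 htb (e / 4) (by positivity)
  have hex : ∀ F : cdfClass L τ, ∃ c : t, dist (ρ F) c < e / 4 := fun F => by
    have := ht (mem_image_of_mem ρ F.2)
    simp only [mem_iUnion, exists_prop] at this
    obtain ⟨c, hc, h⟩ := this
    exact ⟨⟨c, hc⟩, h⟩
  choose c hc using hex
  have : Fintype t := htf.fintype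
  let ι := Fintype.equivFin t
  refine ⟨Fin (Fintype.card t), inferInstance, fun F => ι (c F), fun F G hFG => ?_⟩
  have hFG' : c F = c G := ι.injective hFG
  have hd : dist (ρ F) (ρ G) < e / 2 := by
    have h2 := hc F
    have h3 := hc G
    rw [← hFG', dist_comm] at h3
    linarith [dist_triangle (ρ F) (c F) (ρ G)]
  refine lt_of_le_of_lt ((BoundedContinuousFunction.dist_le (by positivity : 0 ≤ e / 2)).2
    fun x => ?_) (by linarith)
  by_cases hx : x ∈ S
  · exact ((BoundedContinuousFunction.dist_coe_le_dist (⟨x, hx⟩ : S)).trans hd.le :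
      dist (ρ F ⟨x, hx⟩) (ρ G ⟨x, hx⟩) ≤ e / 2)
  · rw [Real.dist_eq]
    exact (abs_sub_le_of_mem_cdfClass F.2 G.2 x).trans (hSτ hx).le

/-- The functions on `S`, bounded by `M`, vanishing at `a` and `L`-Lipschitz at each `w`
inside the ball of radius `ρ w`. -/
def gClass {E : Type*} [PseudoMetricSpace E] (S : Set E) (a : S) (L M : ℝ) (ρ : S → ℝ) :
    Set (S →ᵇ ℝ) :=
  {g | (∀ w, |g w| ≤ M) ∧ g a = 0 ∧ ∀ w w', dist w w' < ρ w → |g w - g w'| ≤ L * dist w w'}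

/-- Arzelà–Ascoli needs equicontinuity only pointwise, so a Lipschitz bound on a ball whose radius
depends on the centre is enough. A global bound is not to be expected, because `O` need not be
convex. -/
lemma isCompact_gClass {E : Type*} [PseudoMetricSpace E] {S : Set E} (hS : IsCompact S) (a : S)
    {L M : ℝ} {ρ : S → ℝ} (hL : 0 ≤ L) (hρ : ∀ w, 0 < ρ w) : IsCompact (gClass S a L M ρ) := by
  have : CompactSpace S := isCompact_iff_compactSpace.1 hS
  have hc := fun x : S => continuous_bcf_eval x
  refine BoundedContinuousFunction.arzela_ascoli₂ (Icc (-M) M) isCompact_Icc _ ?_ ?_ ?_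
  · simp only [gClass, ofPred_and, ofPred_forall]
    refine (isClosed_iInter fun x => isClosed_le (hc x).abs continuous_const).inter
      ((isClosed_eq (hc a) continuous_const).inter
        (isClosed_iInter fun x => isClosed_iInter fun y => isClosed_iInter fun _ =>
          isClosed_le (((hc x).sub (hc y)).abs) continuous_const))
  · intro g w hg
    exact abs_le.1 (hg.1 w)
  · intro w
    rw [Metric.equicontinuousAt_iff]
    intro e he
    refine ⟨min (ρ w) (e / (L + 1)), lt_min (hρ w) (by positivity), fun w' hw' g => ?_⟩
    have h1 : dist w w' < ρ w := by rw [dist_comm]; exact lt_of_lt_of_le hw' (min_le_left _ _)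
    have h2 : dist w w' < e / (L + 1) := by
      rw [dist_comm]; exact lt_of_lt_of_le hw' (min_le_right _ _)
    rw [Real.dist_eq]
    have h3 := g.2.2.2 w w' h1
    rw [lt_div_iff₀ (by positivity)] at h2
    have h4 : 0 ≤ dist w w' := dist_nonneg
    have h5 : 0 < L + 1 := by positivity
    refine lt_of_le_of_lt h3 ?_
    nlinarith

/-! ### The class of the index functions -/

lemma BoundedDerivs.abs_le {d : ℕ} {O : Set (E d)} {m : ℕ} {M : ℝ} {h : E d → ℝ}
    (hh : BoundedDerivs O m M h) {x : E d} (hx : x ∈ O) : |h x| ≤ M := by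
  simpa using hh.2 0 (Nat.zero_le _) x hx Fin.elim0

lemma BoundedDerivs.differentiableAt {d : ℕ} {O : Set (E d)} {m : ℕ} {M : ℝ} {h : E d → ℝ}
    (hh : BoundedDerivs O m M h) (hm : 1 ≤ m) {x : E d} (hx : x ∈ O) :
    DifferentiableAt ℝ h x := by
  have := hh.1 0 hm x hx
  rw [iteratedFDeriv_zero_eq_comp] at this
  exact ((LinearIsometryEquiv.comp_differentiableAt_iff _).1 this)

/-- The hypothesis controls partial derivatives only; expanding a vector in the coordinate basis,
with each coordinate bounded by the norm, costs the factor `d`. -/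
lemma BoundedDerivs.norm_fderiv_le {d : ℕ} {O : Set (E d)} {m : ℕ} {M : ℝ} {h : E d → ℝ}
    (hh : BoundedDerivs O m M h) (hm : 1 ≤ m) {x : E d} (hx : x ∈ O) :
    ‖fderiv ℝ h x‖ ≤ d * M := by
  have hM : 0 ≤ M := (abs_nonneg _).trans (hh.abs_le hx)
  refine ContinuousLinearMap.opNorm_le_bound _ (by positivity) fun v => ?_
  have h1 : ∀ c : Fin d, |fderiv ℝ h x (EuclideanSpace.single c (1 : ℝ))| ≤ M := fun c => by
    simpa using hh.2 1 hm x hx (fun _ => c)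
  have hv : v = ∑ c, v c • EuclideanSpace.single c (1 : ℝ) := by
    ext i
    simp [Finset.sum_apply, Pi.single_apply]
  calc ‖fderiv ℝ h x v‖ = ‖∑ c, v c * fderiv ℝ h x (EuclideanSpace.single c (1 : ℝ))‖ := by
        conv_lhs => rw [hv]
        simp [map_sum]
    _ ≤ ∑ c, ‖v c * fderiv ℝ h x (EuclideanSpace.single c (1 : ℝ))‖ := norm_sum_le _ _
    _ ≤ ∑ _c : Fin d, ‖v‖ * M := by
        refine Finset.sum_le_sum fun c _ => ?_
        rw [norm_mul]
        exact mul_le_mul (PiLp.norm_apply_le v c) (h1 c) (norm_nonneg _) (norm_nonneg _)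
    _ = d * M * ‖v‖ := by simp; ring

lemma BoundedDerivs.abs_sub_le {d : ℕ} {O : Set (E d)} {m : ℕ} {M : ℝ} {h : E d → ℝ}
    (hh : BoundedDerivs O m M h) (hm : 1 ≤ m) {w : E d} {ρ : ℝ} (hρ : Metric.ball w ρ ⊆ O)
    {x y : E d} (hx : x ∈ Metric.ball w ρ) (hy : y ∈ Metric.ball w ρ) :
    |h x - h y| ≤ d * M * dist x y := by
  have := (convex_ball w ρ).norm_image_sub_le_of_norm_fderiv_le (𝕜 := ℝ) (f := h)
    (fun z hz => hh.differentiableAt hm (hρ hz)) (fun z hz => hh.norm_fderiv_le hm (hρ hz)) hy hx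
  rwa [← dist_eq_norm x y] at this

lemma exists_ball_subset_of_isOpen {E : Type*} [PseudoMetricSpace E] {𝒲 O : Set E}
    (hO : IsOpen O) (h𝒲O : 𝒲 ⊆ O) :
    ∃ ρ : 𝒲 → ℝ, (∀ w, 0 < ρ w) ∧ ∀ w : 𝒲, Metric.ball (w : E) (ρ w) ⊆ O := by
  have := fun w : 𝒲 => Metric.isOpen_iff.1 hO w (h𝒲O w.2)
  choose ρ h1 h2 using this
  exact ⟨ρ, h1, h2⟩

lemma exists_bcf_of_mem_gSpace {d : ℕ} {𝒲 O : Set (E d)} {m : ℕ} {M : ℝ}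
    {a : 𝒲} {ρ : 𝒲 → ℝ} (hρ : ∀ w, 0 < ρ w) (hρO : ∀ w : 𝒲, Metric.ball (w : E d) (ρ w) ⊆ O)
    (hm : 1 ≤ m) {g : E d → ℝ} (hg : g ∈ gSpace 𝒲 O m M a) :
    ∃ G ∈ gClass 𝒲 a (d * M) M ρ, ∀ w : 𝒲, G w = g w := by
  obtain ⟨⟨h, hgh, hh⟩, hga⟩ := hg
  have hO : ∀ w : 𝒲, (w : E d) ∈ O := fun w => hρO w (Metric.mem_ball_self (hρ w))
  have hb : ∀ w : 𝒲, |g w| ≤ M := fun w => by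
    rw [hgh w.2]; exact hh.abs_le (hO w)
  have hcont : Continuous fun w : 𝒲 => g w := by
    have : (fun w : 𝒲 => g w) = fun w : 𝒲 => h w := funext fun w => hgh w.2
    rw [this, continuous_iff_continuousAt]
    intro w
    exact (hh.differentiableAt hm (hO w)).continuousAt.comp continuous_subtype_val.continuousAt
  refine ⟨BoundedContinuousFunction.ofNormedAddCommGroup (fun w : 𝒲 => g w) hcont M hb,
    ⟨hb, hga, fun w w' hd => ?_⟩, fun w => rfl⟩
  change |g w - g w'| ≤ _
  rw [hgh w.2, hgh w'.2]
  exact hh.abs_sub_le hm (hρO w) (Metric.mem_ball_self (hρ w))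
    (by rw [Metric.mem_ball, dist_comm]; exact hd)

/-! ### The class of the distribution functions -/

/-- The squared weighted Sobolev norm. -/
noncomputable def sobolevEnergy (s : ℕ) (η : ℝ) (f : ℝ → ℝ) : ℝ≥0∞ :=
  ∑ j ∈ Finset.range (s + 1),
    ∫⁻ u : ℝ, ENNReal.ofReal (|iteratedDeriv j f u| ^ 2 * (1 + u ^ 2) ^ η)

lemma weightedSobolevNorm_lt_iff {s : ℕ} {η : ℝ} {f : ℝ → ℝ} {M : ℝ} (hM : 0 ≤ M) :
    weightedSobolevNorm s η f < ENNReal.ofReal M ↔ sobolevEnergy s η f < ENNReal.ofReal (M ^ 2) := by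
  rw [weightedSobolevNorm, ← sobolevEnergy, ENNReal.ofReal_pow hM,
    ← ENNReal.rpow_lt_rpow_iff (z := 2) (by norm_num), ← ENNReal.rpow_mul]
  norm_num

lemma one_le_one_add_sq_rpow {η : ℝ} (hη : 0 ≤ η) (u : ℝ) : 1 ≤ (1 + u ^ 2) ^ η :=
  Real.one_le_rpow (by nlinarith [sq_nonneg u]) hη

lemma integrable_and_integral_le_of_lintegral_le {g : ℝ → ℝ} (hg : AEStronglyMeasurable g)
    (h0 : ∀ u, 0 ≤ g u) {C : ℝ} (hC : 0 ≤ C) (h : ∫⁻ u, ENNReal.ofReal (g u) ≤ ENNReal.ofReal C) :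
    Integrable g ∧ ∫ u, g u ≤ C := by
  constructor
  · refine ⟨hg, ?_⟩
    rw [hasFiniteIntegral_iff_ofReal (Eventually.of_forall h0)]
    exact lt_of_le_of_lt h ENNReal.ofReal_lt_top
  · rw [integral_eq_lintegral_of_nonneg_ae (Eventually.of_forall h0) hg]
    exact ENNReal.toReal_le_of_le_ofReal hC h

lemma integrable_weighted_of_energy_le {s : ℕ} {η M : ℝ} {f : ℝ → ℝ}
    (hf : Differentiable ℝ f)
    (hE : sobolevEnergy s η f ≤ ENNReal.ofReal (M ^ 2)) {j : ℕ} (hj : j ≤ s) :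
    Integrable (fun u => |iteratedDeriv j f u| ^ 2 * (1 + u ^ 2) ^ η) ∧
    ∫ u, |iteratedDeriv j f u| ^ 2 * (1 + u ^ 2) ^ η ≤ M ^ 2 := by
  have hmeas : Measurable (iteratedDeriv j f) := by
    cases j with
    | zero => simpa using hf.continuous.measurable
    | succ j => rw [iteratedDeriv_succ]; exact measurable_deriv _
  refine integrable_and_integral_le_of_lintegral_le ?_ (fun u => by positivity) (by positivity) ?_
  · have h1 : Measurable fun u : ℝ => (1 + u ^ 2) ^ η := by fun_prop
    have h2 : Measurable fun u => |iteratedDeriv j f u| := by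
      simpa [Real.norm_eq_abs] using hmeas.norm
    exact ((h2.pow_const 2).mul h1).aestronglyMeasurable
  · refine le_trans ?_ hE
    exact Finset.single_le_sum (f := fun j => ∫⁻ u : ℝ,
      ENNReal.ofReal (|iteratedDeriv j f u| ^ 2 * (1 + u ^ 2) ^ η)) (fun _ _ => zero_le)
      (Finset.mem_range.2 (Nat.lt_succ_of_le hj))

lemma integrable_sq_of_energy_le {s : ℕ} {η M : ℝ} (hη : 0 ≤ η) {f : ℝ → ℝ}
    (hf : Differentiable ℝ f)
    (hE : sobolevEnergy s η f ≤ ENNReal.ofReal (M ^ 2)) {j : ℕ} (hj : j ≤ s) :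
    Integrable (fun u => iteratedDeriv j f u ^ 2) ∧ ∫ u, iteratedDeriv j f u ^ 2 ≤ M ^ 2 := by
  obtain ⟨h1, h2⟩ := integrable_weighted_of_energy_le hf hE hj
  have hmeas : Measurable (iteratedDeriv j f) := by
    cases j with
    | zero => simpa using hf.continuous.measurable
    | succ j => rw [iteratedDeriv_succ]; exact measurable_deriv _
  have hle : ∀ u, iteratedDeriv j f u ^ 2 ≤ |iteratedDeriv j f u| ^ 2 * (1 + u ^ 2) ^ η :=
    fun u => by
      rw [sq_abs]
      exact le_mul_of_one_le_right (sq_nonneg _) (one_le_one_add_sq_rpow hη u)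
  have hi : Integrable (fun u => iteratedDeriv j f u ^ 2) :=
    h1.mono' (hmeas.pow_const 2).aestronglyMeasurable (Eventually.of_forall fun u => by
      rw [Real.norm_of_nonneg (sq_nonneg _)]; exact hle u)
  exact ⟨hi, (integral_mono hi h1 hle).trans h2⟩

/-- An elementary Sobolev inequality. -/
lemma sq_le_of_integrable_sq {f : ℝ → ℝ} (hf : Differentiable ℝ f)
    (h0 : Integrable fun u => f u ^ 2) (h1 : Integrable fun u => deriv f u ^ 2) (u : ℝ) :
    f u ^ 2 ≤ 2 * (∫ t, f t ^ 2) + ∫ t, deriv f t ^ 2 := by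
  have hd : ∀ x, HasDerivAt (fun t => f t ^ 2) (2 * f x * deriv f x) x := fun x => by
    simpa using (hf x).hasDerivAt.fun_pow 2
  have hle : ∀ x, |2 * f x * deriv f x| ≤ f x ^ 2 + deriv f x ^ 2 := fun x => by
    rw [abs_le]; constructor <;> nlinarith [sq_nonneg (f x - deriv f x), sq_nonneg (f x + deriv f x)]
  have hint : Integrable fun x => 2 * f x * deriv f x :=
    (h0.add h1).mono' ((by
      have := hf.continuous.measurable
      have := measurable_deriv f
      fun_prop : Measurable fun x => 2 * f x * deriv f x).aestronglyMeasurable)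
      (Eventually.of_forall hle)
  have hI : ∫ x, |2 * f x * deriv f x| ≤ (∫ t, f t ^ 2) + ∫ t, deriv f t ^ 2 := by
    rw [← integral_add h0 h1]
    exact integral_mono hint.abs (h0.add h1) hle
  -- The variation of `f²` is at most `∫ |2 f f'| ≤ ∫ f² + ∫ f'²`. Averaging the resulting lower
  -- bound for `f v ^ 2` over an interval of length one turns it into a bound by `∫ f²`.
  have key : ∀ v ∈ Ioc u (u + 1), f u ^ 2 - ((∫ t, f t ^ 2) + ∫ t, deriv f t ^ 2) ≤ f v ^ 2 := by
    intro v hv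
    have h2 := intervalIntegral.integral_eq_sub_of_hasDerivAt (a := u) (b := v)
      (fun x _ => hd x) hint.intervalIntegrable
    have h3 : |∫ x in u..v, 2 * f x * deriv f x| ≤ ∫ x, |2 * f x * deriv f x| := by
      rw [intervalIntegral.integral_of_le hv.1.le]
      refine (abs_integral_le_integral_abs).trans ?_
      exact setIntegral_le_integral hint.abs (Eventually.of_forall fun _ => abs_nonneg _)
    have h4 := neg_abs_le (∫ x in u..v, 2 * f x * deriv f x)
    linarith
  have h5 : f u ^ 2 - ((∫ t, f t ^ 2) + ∫ t, deriv f t ^ 2) ≤ ∫ v in Ioc u (u + 1), f v ^ 2 := by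
    have : ∫ _v in Ioc u (u + 1), (f u ^ 2 - ((∫ t, f t ^ 2) + ∫ t, deriv f t ^ 2)) =
        f u ^ 2 - ((∫ t, f t ^ 2) + ∫ t, deriv f t ^ 2) := by simp
    rw [← this]
    refine setIntegral_mono_on ?_ h0.integrableOn measurableSet_Ioc key
    exact integrableOn_const (by simp)
  have h6 : ∫ v in Ioc u (u + 1), f v ^ 2 ≤ ∫ v, f v ^ 2 :=
    setIntegral_le_integral h0 (Eventually.of_forall fun _ => sq_nonneg _)
  linarith

lemma HasSqDensity.sub_eq {F f : ℝ → ℝ} (h : HasSqDensity F f) {a b : ℝ} (hab : a ≤ b) :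
    F b - F a = ∫ t in Ioc a b, f t ^ 2 := by
  rw [h.2.2, h.2.2, ← intervalIntegral.integral_of_le hab,
    intervalIntegral.integral_Iic_sub_Iic h.1.integrableOn h.1.integrableOn]

lemma HasSqDensity.one_sub_eq {F f : ℝ → ℝ} (h : HasSqDensity F f) (a : ℝ) :
    1 - F a = ∫ t in Ioi a, f t ^ 2 := by
  rw [h.2.2, ← h.2.1, ← intervalIntegral.integral_Iic_add_Ioi (b := a) h.1.integrableOn
    h.1.integrableOn]
  ring

/-- The tail bound of the distribution functions in `distSpace s η M`. -/
noncomputable def tailBound (η M x : ℝ) : ℝ := M ^ 2 * (1 + x ^ 2) ^ (-η)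

lemma tendsto_tailBound {η : ℝ} (hη : 0 < η) (M : ℝ) :
    Tendsto (tailBound η M) (cocompact ℝ) (𝓝 0) := by
  have h1 : Tendsto (fun x : ℝ => 1 + x ^ 2) (cocompact ℝ) atTop := by
    refine tendsto_atTop_add_const_left _ _ ?_
    have := (tendsto_pow_atTop (α := ℝ) two_ne_zero).comp (tendsto_norm_cocompact_atTop (E := ℝ))
    refine this.congr fun x => ?_
    simp
  have := ((tendsto_rpow_neg_atTop hη).comp h1).const_mul (M ^ 2)
  rw [mul_zero] at this
  exact this

/-- The density `f²` is bounded by `2 + M²`, by the Sobolev inequality with `∫ f² = 1` and `∫ f'² ≤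
M²`; this is the Lipschitz constant of `F`. The tails are bounded by the weighted norm, in the
manner of Chebyshev. -/
lemma exists_bcf_of_mem_distSpace {s : ℕ} (hs : 1 ≤ s) {η M : ℝ} (hη : 0 ≤ η) {F : ℝ → ℝ}
    (hF : F ∈ distSpace s η M) :
    ∃ G ∈ cdfClass (Real.toNNReal (2 + M ^ 2)) (tailBound η M), ∀ u, G u = F u := by
  obtain ⟨f, hdiff, hnorm, hd⟩ := hF
  have hM : 0 ≤ M := by
    by_contra hM
    rw [ENNReal.ofReal_of_nonpos (not_le.1 hM).le] at hnorm
    exact not_lt_zero hnorm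
  rw [weightedSobolevNorm_lt_iff hM] at hnorm
  have hf : Differentiable ℝ f := by simpa using hdiff 0 hs
  have hw := integrable_weighted_of_energy_le hf hnorm.le (Nat.zero_le s)
  simp only [iteratedDeriv_zero, sq_abs] at hw
  have hsq := integrable_sq_of_energy_le hη hf hnorm.le hs
  simp only [iteratedDeriv_one] at hsq
  have hb : ∀ u, f u ^ 2 ≤ 2 + M ^ 2 := fun u => by
    have := sq_le_of_integrable_sq hf hd.1 hsq.1 u
    rw [hd.2.1] at this
    linarith [hsq.2]
  have hIcc : ∀ u, F u ∈ Icc (0 : ℝ) 1 := fun u => by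
    have h1 : 0 ≤ F u := by
      rw [hd.2.2]; exact integral_nonneg fun _ => sq_nonneg _
    have h2 : 0 ≤ 1 - F u := by
      rw [hd.one_sub_eq]; exact integral_nonneg fun _ => sq_nonneg _
    exact ⟨h1, by linarith⟩
  have hmono : ∀ x y, x ≤ y → |F x - F y| ≤ (Real.toNNReal (2 + M ^ 2) : ℝ) * |x - y| := by
    intro x y hxy
    rw [Real.coe_toNNReal _ (by positivity), abs_sub_comm, hd.sub_eq hxy,
      abs_of_nonneg (integral_nonneg fun _ => sq_nonneg _), abs_sub_comm,
      abs_of_nonneg (sub_nonneg.2 hxy)]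
    calc ∫ t in Ioc x y, f t ^ 2 ≤ ∫ _t in Ioc x y, (2 + M ^ 2) :=
          setIntegral_mono_on hd.1.integrableOn (integrableOn_const (by simp)) measurableSet_Ioc
            fun t _ => hb t
      _ = (2 + M ^ 2) * (y - x) := by
          simp [hxy, mul_comm]
  have hLip : ∀ x y, |F x - F y| ≤ (Real.toNNReal (2 + M ^ 2) : ℝ) * |x - y| := fun x y => by
    rcases le_total x y with h | h
    · exact hmono x y h
    · rw [abs_sub_comm (F x), abs_sub_comm x]; exact hmono y x h
  -- On `S` the weight at `t` is at least the weight at `x`, so `f t ^ 2` may be multiplied by their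
  -- quotient. The same bound serves both tails.
  have htail : ∀ x : ℝ, ∀ S : Set ℝ, MeasurableSet S → (∀ t ∈ S, x ^ 2 ≤ t ^ 2) →
      ∫ t in S, f t ^ 2 ≤ tailBound η M x := by
    intro x S hS h
    have hpos : 0 < 1 + x ^ 2 := by positivity
    calc ∫ t in S, f t ^ 2 ≤ ∫ t in S, (f t ^ 2 * (1 + t ^ 2) ^ η) * (1 + x ^ 2) ^ (-η) := by
          refine setIntegral_mono_on hd.1.integrableOn (hw.1.integrableOn.mul_const _) hS
            fun t ht => ?_
          rw [mul_assoc]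
          refine le_mul_of_one_le_right (sq_nonneg _) ?_
          rw [Real.rpow_neg hpos.le, ← div_eq_mul_inv, one_le_div (by positivity)]
          exact Real.rpow_le_rpow hpos.le (by linarith [h t ht]) hη
      _ = (∫ t in S, f t ^ 2 * (1 + t ^ 2) ^ η) * (1 + x ^ 2) ^ (-η) := integral_mul_const _ _
      _ ≤ M ^ 2 * (1 + x ^ 2) ^ (-η) := by
          refine mul_le_mul_of_nonneg_right ?_ (by positivity)
          exact (setIntegral_le_integral hw.1 (Eventually.of_forall fun _ => by positivity)).trans
            hw.2
  refine ⟨BoundedContinuousFunction.ofNormedAddCommGroup F ?_ 1 fun u => ?_,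
    ⟨hIcc, hLip, fun x hx => ?_, fun x hx => ?_⟩, fun u => rfl⟩
  · exact (LipschitzWith.of_dist_le_mul hLip).continuous
  · rw [Real.norm_of_nonneg (hIcc u).1]; exact (hIcc u).2
  · change F x ≤ _
    rw [hd.2.2]
    exact htail x _ measurableSet_Iic fun t ht => by
      have : t ≤ x := ht
      nlinarith
  · change 1 - F x ≤ _
    rw [hd.one_sub_eq]
    exact htail x _ measurableSet_Ioi fun t ht => by
      have : x < t := ht
      nlinarith

/-! ### Events of (outer) probability tending to one -/

/-- `P n` holds with (inner) probability approaching one. -/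
def WithProbToOne {Ω : Type*} [MeasurableSpace Ω] (μ : Measure Ω) (P : ℕ → Ω → Prop) : Prop :=
  Tendsto (fun n => μ {ω | ¬ P n ω}) atTop (𝓝 0)

namespace WithProbToOne

variable {Ω : Type*} [MeasurableSpace Ω] {μ : Measure Ω} {P Q R : ℕ → Ω → Prop}

lemma mono_ae (hP : WithProbToOne μ P) (h : ∀ᶠ n in atTop, ∀ᵐ ω ∂μ, P n ω → Q n ω) :
    WithProbToOne μ Q := by
  refine tendsto_of_tendsto_of_tendsto_of_le_of_le' tendsto_const_nhds hP
    (Eventually.of_forall fun _ => zero_le) ?_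
  filter_upwards [h] with n hn
  refine measure_mono_ae ?_
  filter_upwards [hn] with ω hω hQ hP
  exact hQ (hω hP)

lemma mono (hP : WithProbToOne μ P) (h : ∀ n ω, P n ω → Q n ω) : WithProbToOne μ Q :=
  hP.mono_ae (Eventually.of_forall fun n => Eventually.of_forall fun ω => h n ω)

lemma and (hP : WithProbToOne μ P) (hQ : WithProbToOne μ Q) :
    WithProbToOne μ (fun n ω => P n ω ∧ Q n ω) := by
  have h := hP.add hQ
  rw [add_zero] at h
  refine tendsto_of_tendsto_of_tendsto_of_le_of_le tendsto_const_nhds h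
    (fun _ => zero_le) fun n => ?_
  refine (measure_mono fun ω hω => ?_).trans (measure_union_le {ω | ¬ P n ω} {ω | ¬ Q n ω})
  by_cases h : P n ω
  · exact Or.inr fun hq => hω ⟨h, hq⟩
  · exact Or.inl h

lemma of_ae (h : ∀ᶠ n in atTop, ∀ᵐ ω ∂μ, P n ω) : WithProbToOne μ P := by
  refine tendsto_const_nhds.congr' ?_
  filter_upwards [h] with n hn
  exact (ae_iff.1 hn).symm

lemma forall_finite {ι : Type*} {t : Set ι} (ht : t.Finite) {P : ι → ℕ → Ω → Prop}
    (h : ∀ i ∈ t, WithProbToOne μ (P i)) :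
    WithProbToOne μ (fun n ω => ∀ i ∈ t, P i n ω) := by
  induction t, ht using Set.Finite.induction_on with
  | empty => exact of_ae (by simp)
  | insert _ _ ih =>
    refine ((h _ (mem_insert _ _)).and (ih fun i hi => h i (mem_insert_of_mem _ hi))).mono ?_
    rintro n ω ⟨h1, h2⟩ i (rfl | hi)
    · exact h1
    · exact h2 i hi

lemma of_tendstoInMeasure {r : ℕ → Ω → ℝ} {c : ℝ}
    (hr : TendstoInMeasure μ r atTop (fun _ => c)) {e : ℝ} (he : 0 < e) :
    WithProbToOne μ (fun n ω => |r n ω - c| < e) := by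
  have := tendstoInMeasure_iff_dist.1 hr e he
  simpa [WithProbToOne, not_lt, Real.dist_eq] using this

lemma of_tendsto_ae [IsFiniteMeasure μ] {r : ℕ → Ω → ℝ} {c : ℝ}
    (hm : ∀ n, Measurable (r n)) (h : ∀ᵐ ω ∂μ, Tendsto (fun n => r n ω) atTop (𝓝 c))
    {e : ℝ} (he : 0 < e) :
    WithProbToOne μ (fun n ω => |r n ω - c| < e) :=
  of_tendstoInMeasure
    (tendstoInMeasure_of_tendsto_ae (fun n => (hm n).aestronglyMeasurable) h) he

lemma toZeroInProb {D : ℕ → Ω → ℝ≥0∞}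
    (h : ∀ e : ℝ, 0 < e → WithProbToOne μ (fun n ω => D n ω ≤ ENNReal.ofReal e)) :
    ToZeroInProb μ D := by
  intro e he
  obtain ⟨e', he', hlt⟩ : ∃ e' : ℝ, 0 < e' ∧ ENNReal.ofReal e' < e := by
    obtain ⟨q, hq, hqe⟩ := ENNReal.lt_iff_exists_nnreal_btwn.1 he
    exact ⟨q, by exact_mod_cast hq, by simpa using hqe⟩
  refine tendsto_of_tendsto_of_tendsto_of_le_of_le tendsto_const_nhds (h e' he')
    (fun _ => zero_le) fun n => measure_mono fun ω hω => ?_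
  exact fun hle => absurd (lt_of_le_of_lt hle hlt) (not_lt.2 hω)

end WithProbToOne

/-! ### A uniform law of large numbers -/

lemma abs_mean_sub_mean_le {n : ℕ} {a b : Fin n → ℝ} {c : ℝ} (hc : 0 ≤ c)
    (h : ∀ i, |a i - b i| ≤ c) : |1 / (n : ℝ) * ∑ i, a i - 1 / (n : ℝ) * ∑ i, b i| ≤ c := by
  rw [← mul_sub, ← Finset.sum_sub_distrib, abs_mul, abs_of_nonneg (by positivity)]
  have h1 : |∑ i, (a i - b i)| ≤ n * c := by
    refine (Finset.abs_sum_le_sum_abs _ _).trans ((Finset.sum_le_sum fun i _ => h i).trans ?_)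
    simp
  rcases Nat.eq_zero_or_pos n with rfl | hn
  · simpa using hc
  · have hn' : (0 : ℝ) < n := by exact_mod_cast hn
    calc 1 / (n : ℝ) * |∑ i, (a i - b i)| ≤ 1 / (n : ℝ) * (n * c) := by gcongr
      _ = c := by field_simp

/-- The strong law holds at the points of a finite `e / (3C)`-net. Passing from a parameter to its
net point changes the sample mean and the expectation by at most `e / 3` each. The set `A` carries
the observations almost surely, so the bounds on the loss are needed only there. -/
theorem uniform_lln {Ω 𝒵 Θ : Type*} [MeasurableSpace Ω] {μ : Measure Ω} [IsProbabilityMeasure μ]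
    [MeasurableSpace 𝒵] [PseudoMetricSpace Θ] {K : Set Θ} (hK : TotallyBounded K)
    {Z : ℕ → Ω → 𝒵} (hZ : ∀ i, Measurable (Z i)) (hindep : iIndepFun Z μ)
    (hident : ∀ i, IdentDistrib (Z i) (Z 0) μ μ) {ℓ : Θ → 𝒵 → ℝ}
    (hℓ : ∀ θ ∈ K, Measurable (ℓ θ)) {A : Set 𝒵} (hA : ∀ i, ∀ᵐ ω ∂μ, Z i ω ∈ A) {C : ℝ}
    (hC : 0 < C) (hbound : ∀ θ ∈ K, ∀ z ∈ A, |ℓ θ z| ≤ C)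
    (hlip : ∀ θ ∈ K, ∀ θ' ∈ K, ∀ z ∈ A, |ℓ θ z - ℓ θ' z| ≤ C * dist θ θ') {e : ℝ} (he : 0 < e) :
    WithProbToOne μ (fun n ω => ∀ θ ∈ K,
      |1 / (n : ℝ) * ∑ i : Fin n, ℓ θ (Z i ω) - ∫ ω, ℓ θ (Z 0 ω) ∂μ| ≤ e) := by
  obtain ⟨t, htK, htf, ht⟩ := Metric.finite_approx_of_totallyBounded hK (e / (3 * C)) (by positivity)
  have hint : ∀ θ ∈ K, Integrable (fun ω => ℓ θ (Z 0 ω)) μ := fun θ hθ =>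
    Integrable.of_bound ((hℓ θ hθ).comp (hZ 0)).aestronglyMeasurable C (by
      filter_upwards [hA 0] with ω hω
      exact hbound θ hθ _ hω)
  have hpt : ∀ θ ∈ K, WithProbToOne μ (fun n ω =>
      |1 / (n : ℝ) * ∑ i : Fin n, ℓ θ (Z i ω) - ∫ ω, ℓ θ (Z 0 ω) ∂μ| < e / 3) := by
    intro θ hθ
    refine WithProbToOne.of_tendsto_ae (fun n => ?_) ?_ (by positivity)
    · have := fun i : Fin n => (hℓ θ hθ).comp (hZ i)
      exact (Finset.measurable_sum _ fun i _ => this i).const_mul _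
    · have := strong_law_ae_real (μ := μ) (fun i ω => ℓ θ (Z i ω)) (hint θ hθ)
        (fun i j hij => (hindep.indepFun hij).comp (hℓ θ hθ) (hℓ θ hθ))
        (fun i => (hident i).comp (hℓ θ hθ))
      filter_upwards [this] with ω hω
      refine hω.congr fun n => ?_
      rw [div_eq_inv_mul, one_div, Finset.sum_range]
  have hall := WithProbToOne.forall_finite htf (fun θ hθ => hpt θ (htK hθ))
  refine hall.mono_ae (Eventually.of_forall fun n => ?_)
  filter_upwards [ae_all_iff.2 hA] with ω hω h θ hθ
  obtain ⟨θ', hθ', hd⟩ : ∃ θ' ∈ t, dist θ θ' < e / (3 * C) := by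
    simpa using ht hθ
  have hCd : C * dist θ θ' ≤ e / 3 := by
    rw [lt_div_iff₀ (by positivity)] at hd
    linarith
  have h1 : |1 / (n : ℝ) * ∑ i : Fin n, ℓ θ (Z i ω) - 1 / (n : ℝ) * ∑ i : Fin n, ℓ θ' (Z i ω)|
      ≤ e / 3 :=
    abs_mean_sub_mean_le (by positivity) fun i =>
      (hlip θ hθ θ' (htK hθ') _ (hω i)).trans hCd
  have h2 : |∫ ω, ℓ θ' (Z 0 ω) ∂μ - ∫ ω, ℓ θ (Z 0 ω) ∂μ| ≤ e / 3 := by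
    rw [← integral_sub (hint θ' (htK hθ')) (hint θ hθ)]
    have : ∀ᵐ ω ∂μ, ‖ℓ θ' (Z 0 ω) - ℓ θ (Z 0 ω)‖ ≤ e / 3 := by
      filter_upwards [hA 0] with ω hω
      rw [Real.norm_eq_abs, abs_sub_comm]
      exact (hlip θ hθ θ' (htK hθ') _ hω).trans hCd
    simpa using norm_integral_le_of_norm_le_const this
  have h3 := h θ' hθ'
  rw [abs_le] at h1 h2 ⊢
  rw [abs_lt] at h3
  constructor <;> linarith [h1.1, h1.2, h2.1, h2.2, h3.1, h3.2]

/-! ### Choice probabilities of the parameters -/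

/-- The extension by zero of a function on a subset. -/
noncomputable def extendZero {α : Type*} {S : Set α} (G : S → ℝ) : α → ℝ :=
  Function.extend Subtype.val G 0

lemma extendZero_apply {α : Type*} {S : Set α} (G : S → ℝ) {w : α} (hw : w ∈ S) :
    extendZero G w = G ⟨w, hw⟩ :=
  Subtype.val_injective.extend_apply G 0 ⟨w, hw⟩

lemma measurable_extendZero {α : Type*} [MeasurableSpace α] {S : Set α} (hS : MeasurableSet S)
    {G : S → ℝ} (hG : Measurable G) : Measurable (extendZero G) :=
  (MeasurableEmbedding.subtype_coe hS).measurable_extend hG measurable_const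

/-- The choice probability of a pair of bounded continuous functions. -/
noncomputable def choiceProb {α : Type*} [TopologicalSpace α] {S : Set α}
    (θ : (S →ᵇ ℝ) × (ℝ →ᵇ ℝ)) (x : ℝ × α) : ℝ :=
  θ.2 (x.1 + extendZero θ.1 x.2)

lemma measurable_choiceProb {α : Type*} [TopologicalSpace α] [MeasurableSpace α] [BorelSpace α]
    {S : Set α} (hS : MeasurableSet S) (θ : (S →ᵇ ℝ) × (ℝ →ᵇ ℝ)) : Measurable (choiceProb θ) := by
  have h1 : Measurable (extendZero θ.1) := measurable_extendZero hS θ.1.continuous.measurable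
  exact θ.2.continuous.measurable.comp (measurable_fst.add (h1.comp measurable_snd))

/-- The change of `F` is compared at the same index and costs the distance itself; the change of the
index is then measured by the Lipschitz constant of `θ'` alone. -/
lemma abs_choiceProb_sub_le {α : Type*} [TopologicalSpace α] {S : Set α}
    (θ θ' : (S →ᵇ ℝ) × (ℝ →ᵇ ℝ)) {L : ℝ} (hL : 0 ≤ L)
    (hθ : ∀ a b, |θ'.2 a - θ'.2 b| ≤ L * |a - b|) {x : ℝ × α} (hx : x.2 ∈ S) :
    |choiceProb θ x - choiceProb θ' x| ≤ (1 + L) * dist θ θ' := by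
  simp only [choiceProb, extendZero_apply _ hx]
  set w : S := ⟨x.2, hx⟩
  have h1 : |θ.2 (x.1 + θ.1 w) - θ'.2 (x.1 + θ.1 w)| ≤ dist θ θ' :=
    (BoundedContinuousFunction.dist_coe_le_dist (f := θ.2) (g := θ'.2) _).trans
      (le_max_right (dist θ.1 θ'.1) (dist θ.2 θ'.2))
  have h2 : |θ'.2 (x.1 + θ.1 w) - θ'.2 (x.1 + θ'.1 w)| ≤ L * dist θ θ' := by
    refine (hθ _ _).trans (mul_le_mul_of_nonneg_left ?_ hL)
    rw [add_sub_add_left_eq_sub]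
    exact (BoundedContinuousFunction.dist_coe_le_dist (f := θ.1) (g := θ'.1) w).trans
      (le_max_left (dist θ.1 θ'.1) (dist θ.2 θ'.2))
  calc _ ≤ _ := abs_sub_le _ (θ'.2 (x.1 + θ.1 w)) _
    _ ≤ dist θ θ' + L * dist θ θ' := add_le_add h1 h2
    _ = _ := by ring

lemma choiceProb_mem_Icc {α : Type*} [TopologicalSpace α] {S : Set α}
    {θ : (S →ᵇ ℝ) × (ℝ →ᵇ ℝ)} (h : ∀ u, θ.2 u ∈ Icc (0 : ℝ) 1) (x : ℝ × α) :
    choiceProb θ x ∈ Icc (0 : ℝ) 1 := h _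

/-! ### The regression function -/

/-- The choice `Y = 1` is the event that `ε` is strictly below the index, whereas a distribution
function measures closed half-lines; continuity rules out the atoms that would make a difference. -/
lemma measureReal_Iio_eq_of_cdf {ν : Measure ℝ} [IsProbabilityMeasure ν] {F : ℝ → ℝ}
    (hF : Continuous F) (h : ∀ u, cdf ν u = F u) (t : ℝ) : ν.real (Iio t) = F t := by
  refine le_antisymm ?_ ?_
  · rw [← h, cdf_eq_real]
    exact measureReal_mono Iio_subset_Iic_self
  · have h1 : Tendsto F (𝓝[<] t) (𝓝 (F t)) := hF.continuousAt.tendsto.mono_left nhdsWithin_le_nhds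
    refine le_of_tendsto h1 ?_
    filter_upwards [self_mem_nhdsWithin] with s hs
    rw [← h, cdf_eq_real]
    exact measureReal_mono (Iic_subset_Iio.2 hs)

section Model

variable {Ω : Type*} [MeasurableSpace Ω] {μ : Measure Ω}
  {d : ℕ} {Y V : ℕ → Ω → ℝ} {W : ℕ → Ω → E d} {ε : ℕ → Ω → ℝ} {g₀ : E d → ℝ} {F₀ : ℝ → ℝ}

/-- This says that `F₀(V + g₀(W))` is the conditional mean of `Y` given `X`. By independence the
error can be integrated out first, by Fubini. The function `g` is a measurable version of `g₀`,
which is constrained only on the support of `W`. -/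
lemma BinaryChoiceModel.integral_residual_mul_eq_zero [IsProbabilityMeasure μ]
    (hmodel : BinaryChoiceModel μ Y V W ε g₀ F₀) (hF₀ : Continuous F₀)
    {g : E d → ℝ} (hg : Measurable g) (hgg : ∀ᵐ ω ∂μ, g (W 0 ω) = g₀ (W 0 ω))
    {h : ℝ × E d → ℝ} (hh : Measurable h) {C : ℝ} (hC : ∀ x, |h x| ≤ C) :
    ∫ ω, (Y 0 ω - F₀ (V 0 ω + g (W 0 ω))) * h (V 0 ω, W 0 ω) ∂μ = 0 := by
  have hX : Measurable fun ω => (V 0 ω, W 0 ω) :=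
    (hmodel.measurable_V 0).prodMk (hmodel.measurable_W 0)
  have hε := hmodel.measurable_error 0
  have : IsProbabilityMeasure (μ.map (ε 0)) := Measure.isProbabilityMeasure_map hε.aemeasurable
  have : IsProbabilityMeasure (μ.map fun ω => (V 0 ω, W 0 ω)) :=
    Measure.isProbabilityMeasure_map hX.aemeasurable
  have hprod := (indepFun_iff_map_prod_eq_prod_map_map hε.aemeasurable hX.aemeasurable).1
    (hmodel.error_indep 0)
  have hF01 : ∀ u, F₀ u ∈ Icc (0 : ℝ) 1 := fun u => by
    rw [← hmodel.error_cdf 0 u]; exact ⟨cdf_nonneg _ _, cdf_le_one _ _⟩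
  let T : ℝ × (ℝ × E d) → ℝ := fun z =>
    ((if 0 < z.2.1 + g z.2.2 - z.1 then 1 else 0) - F₀ (z.2.1 + g z.2.2)) * h z.2
  have hindex : Measurable fun z : ℝ × (ℝ × E d) => z.2.1 + g z.2.2 :=
    measurable_snd.fst.add (hg.comp measurable_snd.snd)
  have hTm : Measurable T := by
    refine ((Measurable.ite (measurableSet_lt measurable_const (hindex.sub measurable_fst))
      measurable_const measurable_const).sub (hF₀.measurable.comp hindex)).mul
      (hh.comp measurable_snd)
  have hC0 : 0 ≤ C := (abs_nonneg _).trans (hC (0, 0))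
  have hTb : ∀ z, ‖T z‖ ≤ C := fun z => by
    have h1 := hF01 (z.2.1 + g z.2.2)
    rw [Real.norm_eq_abs, abs_mul, ← one_mul C]
    refine mul_le_mul ?_ (hC _) (abs_nonneg _) zero_le_one
    rw [abs_le]
    split_ifs <;> constructor <;> linarith [h1.1, h1.2]
  have hTint : Integrable T ((μ.map (ε 0)).prod (μ.map fun ω => (V 0 ω, W 0 ω))) :=
    Integrable.of_bound hTm.aestronglyMeasurable C (Eventually.of_forall hTb)
  calc ∫ ω, (Y 0 ω - F₀ (V 0 ω + g (W 0 ω))) * h (V 0 ω, W 0 ω) ∂μ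
      = ∫ ω, T (ε 0 ω, (V 0 ω, W 0 ω)) ∂μ := by
        refine integral_congr_ae ?_
        filter_upwards [hmodel.choice 0, hgg] with ω h1 h2
        simp only [T, h1, h2]
    _ = ∫ z, T z ∂((μ.map (ε 0)).prod (μ.map fun ω => (V 0 ω, W 0 ω))) := by
        rw [← hprod, integral_map (hε.prodMk hX).aemeasurable hTm.aestronglyMeasurable]
    _ = ∫ x, ∫ e, T (e, x) ∂(μ.map (ε 0)) ∂(μ.map fun ω => (V 0 ω, W 0 ω)) :=
        integral_prod_symm _ hTint
    _ = ∫ x, 0 ∂(μ.map fun ω => (V 0 ω, W 0 ω)) := by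
        congr 1
        ext x
        simp only [T]
        rw [integral_mul_const, integral_sub, integral_const]
        · have h1 : (fun e : ℝ => if 0 < x.1 + g x.2 - e then (1 : ℝ) else 0) =
              (Iio (x.1 + g x.2)).indicator fun _ => 1 := by
            ext e
            simp [indicator_apply]
          rw [h1, integral_indicator measurableSet_Iio]
          simp only [integral_const, smul_eq_mul, mul_one, probReal_univ, one_mul,
            measureReal_restrict_apply_univ]
          rw [measureReal_Iio_eq_of_cdf hF₀ (hmodel.error_cdf 0), sub_self, zero_mul]
        · refine Integrable.of_bound (Measurable.ite (measurableSet_lt measurable_const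
            (measurable_const.sub measurable_id)) measurable_const
            measurable_const).aestronglyMeasurable 1 (Eventually.of_forall fun e => ?_)
          split_ifs <;> simp
        · exact integrable_const _
    _ = 0 := integral_zero _ _

/-! ### Identification -/

/-- Otherwise some product neighbourhood of the point is null. A tent function at `v` supported in
its first factor then has conditional expectation zero on all small balls about `w_*`, hence
integral zero under the limit `ν`, although `v` lies in the support of `ν`. -/
lemma mk_mem_support_of_isCondLawAt {V : Ω → ℝ} {W : Ω → E d} (hV : Measurable V)
    (hW : Measurable W) {wstar : E d} {ν : Measure ℝ} [IsProbabilityMeasure ν]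
    (hν : IsCondLawAt μ V W wstar ν) (hsupp : ν.support = univ) (v : ℝ) :
    (v, wstar) ∈ (μ.map (fun ω => (V ω, W ω))).support := by
  rw [Measure.mem_support_iff_forall]
  intro U hU
  by_contra hpos
  have h0 : μ.map (fun ω => (V ω, W ω)) U = 0 := by simpa using hpos
  obtain ⟨δ, hδ, hδU⟩ := Metric.nhds_basis_closedBall.mem_iff.1 hU
  have h1 : μ ((fun ω => (V ω, W ω)) ⁻¹' U) = 0 :=
    nonpos_iff_eq_zero.1 ((Measure.le_map_apply (hV.prodMk hW).aemeasurable U).trans h0.le)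
  let f : ℝ →ᵇ ℝ := BoundedContinuousFunction.ofNormedAddCommGroup
    (fun t => max 0 (δ - |t - v|)) (by fun_prop) δ (fun t => by
      rw [Real.norm_of_nonneg (le_max_left _ _)]
      exact max_le hδ.le (by linarith [abs_nonneg (t - v)]))
  have hf : ∀ t, f t = max 0 (δ - |t - v|) := fun t => rfl
  have hf0 : ∀ t, 0 ≤ f t := fun t => le_max_left _ _
  have hzero : ∀ᶠ r in 𝓝[>] (0 : ℝ),
      ∫ ω, f (V ω) ∂(ProbabilityTheory.cond μ (W ⁻¹' Metric.closedBall wstar r)) = 0 := by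
    filter_upwards [Ioc_mem_nhdsGT hδ] with r hr
    refine integral_eq_zero_of_ae ?_
    have hms : MeasurableSet (W ⁻¹' Metric.closedBall wstar r) :=
      hW Metric.isClosed_closedBall.measurableSet
    have hac : ∀ᵐ ω ∂(ProbabilityTheory.cond μ (W ⁻¹' Metric.closedBall wstar r)),
        ω ∉ (fun ω => (V ω, W ω)) ⁻¹' U :=
      ProbabilityTheory.cond_absolutelyContinuous (measure_eq_zero_iff_ae_notMem.1 h1)
    filter_upwards [hac, ProbabilityTheory.ae_cond_mem hms] with ω h2 h3
    by_contra hne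
    have h4 : |V ω - v| < δ := by
      by_contra hge
      exact hne (by simp [hf]; linarith)
    refine h2 (hδU ?_)
    rw [← closedBall_prod_same]
    exact ⟨by rw [Metric.mem_closedBall, Real.dist_eq]; exact h4.le,
      Metric.closedBall_subset_closedBall hr.2 h3⟩
  have hlim : ∫ t, f t ∂ν = 0 := by
    have : Tendsto (fun _ : ℝ => (0 : ℝ)) (𝓝[>] (0 : ℝ)) (𝓝 (∫ t, f t ∂ν)) :=
      (hν f).congr' hzero
    exact (tendsto_nhds_unique this tendsto_const_nhds)
  have hae : ∀ᵐ t ∂ν, f t = 0 :=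
    (integral_eq_zero_iff_of_nonneg hf0 (f.integrable ν)).1 hlim
  have hv : v ∈ ν.support := by rw [hsupp]; trivial
  rw [Measure.mem_support_iff_forall] at hv
  refine (hv (Metric.ball v δ) (Metric.ball_mem_nhds v hδ)).ne' ?_
  refine measure_mono_null (fun t ht => ?_) (ae_iff.1 hae)
  rw [Metric.mem_ball, Real.dist_eq] at ht
  intro h5
  have : δ - |t - v| ≤ 0 := by
    rw [← h5, hf]; exact le_max_right _ _
  linarith

/-- The set where the two choice probabilities agree is closed and has full measure, so it contains
the support. Closedness is proved on `ℝ × S`, where both sides are continuous, and is carried over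
by the closed embedding; the extensions by zero need not be continuous. -/
lemma eq_on_support_of_ae_eq {S : Set (E d)} (hS : IsClosed S) {X : Ω → ℝ × E d}
    (hX : Measurable X) (hXS : ∀ᵐ ω ∂μ, (X ω).2 ∈ S) {θ θ' : (S →ᵇ ℝ) × (ℝ →ᵇ ℝ)}
    (h : ∀ᵐ ω ∂μ, choiceProb θ (X ω) = choiceProb θ' (X ω)) {x : ℝ × E d}
    (hx : x ∈ (μ.map X).support) : ∃ hS : x.2 ∈ S,
      θ.2 (x.1 + θ.1 ⟨x.2, hS⟩) = θ'.2 (x.1 + θ'.1 ⟨x.2, hS⟩) := by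
  let ι : ℝ × S → ℝ × E d := Prod.map id Subtype.val
  have hι : IsClosedMap ι := (Topology.IsClosedEmbedding.id.prodMap hS.isClosedEmbedding_subtypeVal).isClosedMap
  have hC : IsClosed (ι '' {z | θ.2 (z.1 + θ.1 z.2) = θ'.2 (z.1 + θ'.1 z.2)}) := by
    refine hι _ (isClosed_eq ?_ ?_) <;> fun_prop
  have hmem : ι '' {z | θ.2 (z.1 + θ.1 z.2) = θ'.2 (z.1 + θ'.1 z.2)} ∈ ae (μ.map X) := by
    rw [mem_ae_map_iff hX.aemeasurable hC.measurableSet]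
    filter_upwards [hXS, h] with ω h1 h2
    refine ⟨((X ω).1, ⟨(X ω).2, h1⟩), ?_, rfl⟩
    simp only [choiceProb, extendZero_apply _ h1] at h2
    exact h2
  obtain ⟨z, hz, rfl⟩ := Measure.support_subset_of_isClosed hC hmem hx
  exact ⟨z.2.2, hz⟩

/-- Identification. At `(v, a)` the index is `v` for both parameters, and all these points lie in
the support of `X`, so the distribution functions agree everywhere. Cancelling the strictly
increasing function gives equality of the index functions almost surely, and by continuity on the
support of `W`. -/
theorem eq_of_ae_choiceProb_eq {V : Ω → ℝ} {W : Ω → E d} (hV : Measurable V)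
    (hW : Measurable W) {S : Set (E d)} (hS : S = (μ.map W).support) {a : S} {ν : Measure ℝ}
    [IsProbabilityMeasure ν] (hν : IsCondLawAt μ V W a ν) (hsupp : ν.support = univ)
    {θ θ' : (S →ᵇ ℝ) × (ℝ →ᵇ ℝ)} (ha : θ.1 a = 0) (ha' : θ'.1 a = 0) (hmono : StrictMono θ'.2)
    (h : ∀ᵐ ω ∂μ, choiceProb θ (V ω, W ω) = choiceProb θ' (V ω, W ω)) : θ = θ' := by
  have hSc : IsClosed S := by rw [hS]; exact Measure.isClosed_support
  have hWS : ∀ᵐ ω ∂μ, W ω ∈ S := by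
    have : S ∈ ae (μ.map W) := by rw [hS]; exact Measure.support_mem_ae
    exact (mem_ae_map_iff hW.aemeasurable hSc.measurableSet).1 this
  have h2 : θ.2 = θ'.2 := by
    ext v
    obtain ⟨_, h1⟩ := eq_on_support_of_ae_eq hSc (hV.prodMk hW) hWS h
      (mk_mem_support_of_isCondLawAt hV hW hν hsupp v)
    simpa [ha, ha'] using h1
  refine Prod.ext ?_ h2
  have hC : IsClosed (Subtype.val '' {w : S | θ.1 w = θ'.1 w}) :=
    hSc.isClosedEmbedding_subtypeVal.isClosedMap _
      (isClosed_eq θ.1.continuous θ'.1.continuous)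
  have hmem : Subtype.val '' {w : S | θ.1 w = θ'.1 w} ∈ ae (μ.map W) := by
    rw [mem_ae_map_iff hW.aemeasurable hC.measurableSet]
    filter_upwards [hWS, h] with ω h1 h3
    refine ⟨⟨W ω, h1⟩, ?_, rfl⟩
    simp only [choiceProb, extendZero_apply _ h1, h2] at h3
    exact add_left_cancel (hmono.injective h3)
  have hsub := Measure.support_subset_of_isClosed hC hmem
  ext w
  have hw : (w : E d) ∈ (μ.map W).support := by rw [← hS]; exact w.2
  obtain ⟨w', hw', hww⟩ := hsub hw
  obtain rfl : w' = w := Subtype.ext hww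
  exact hw'

end Model

/-! ### Consistency of approximate minimisers -/

section Consistency

variable {Ω : Type*} [MeasurableSpace Ω] {μ : Measure Ω}
  {d : ℕ} {Y V : ℕ → Ω → ℝ} {W : ℕ → Ω → E d} {ε : ℕ → Ω → ℝ} {g₀ : E d → ℝ} {F₀ : ℝ → ℝ}

lemma BinaryChoiceModel.measurable_X (hmodel : BinaryChoiceModel μ Y V W ε g₀ F₀) (i : ℕ) :
    Measurable fun ω => (V i ω, W i ω) :=
  (hmodel.measurable_V i).prodMk (hmodel.measurable_W i)

lemma BinaryChoiceModel.ae_Y_mem_Icc (hmodel : BinaryChoiceModel μ Y V W ε g₀ F₀) (i : ℕ) :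
    ∀ᵐ ω ∂μ, Y i ω ∈ Icc (0 : ℝ) 1 := by
  filter_upwards [hmodel.choice i] with ω hω
  rw [hω]
  split_ifs <;> simp

lemma BinaryChoiceModel.ae_W_mem (hmodel : BinaryChoiceModel μ Y V W ε g₀ F₀) {S : Set (E d)}
    (hS : S = (μ.map (W 0)).support) (i : ℕ) : ∀ᵐ ω ∂μ, W i ω ∈ S := by
  have hSc : IsClosed S := by rw [hS]; exact Measure.isClosed_support
  have hid : IdentDistrib (W i) (W 0) μ μ :=
    (hmodel.identical_obs i).comp (u := fun z : ℝ × ℝ × E d => z.2.2) measurable_snd.snd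
  have : S ∈ ae (μ.map (W 0)) := by rw [hS]; exact Measure.support_mem_ae
  rw [← hid.map_eq] at this
  exact (mem_ae_map_iff (hmodel.measurable_W i).aemeasurable hSc.measurableSet).1 this

/-- The population least squares criterion. -/
noncomputable def populationCriterion (μ : Measure Ω) (Y V : ℕ → Ω → ℝ) (W : ℕ → Ω → E d)
    {S : Set (E d)} (θ : (S →ᵇ ℝ) × (ℝ →ᵇ ℝ)) : ℝ :=
  ∫ ω, (Y 0 ω - choiceProb θ (V 0 ω, W 0 ω)) ^ 2 ∂μ

/-- The mean squared distance of two choice probabilities. -/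
noncomputable def meanSqDist (μ : Measure Ω) (V : ℕ → Ω → ℝ) (W : ℕ → Ω → E d)
    {S : Set (E d)} (θ θ₀ : (S →ᵇ ℝ) × (ℝ →ᵇ ℝ)) : ℝ :=
  ∫ ω, (choiceProb θ (V 0 ω, W 0 ω) - choiceProb θ₀ (V 0 ω, W 0 ω)) ^ 2 ∂μ

lemma abs_sq_sub_sq_le_of_mem_Icc {y p q : ℝ} (hy : y ∈ Icc (0 : ℝ) 1) (hp : p ∈ Icc (0 : ℝ) 1)
    (hq : q ∈ Icc (0 : ℝ) 1) : |(y - p) ^ 2 - (y - q) ^ 2| ≤ 2 * |p - q| := by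
  have h1 : (y - p) ^ 2 - (y - q) ^ 2 = (2 * y - p - q) * (q - p) := by ring
  rw [h1, abs_mul, abs_sub_comm q p]
  refine mul_le_mul_of_nonneg_right ?_ (abs_nonneg _)
  rw [abs_le]
  constructor <;> linarith [hy.1, hy.2, hp.1, hp.2, hq.1, hq.2]

variable [IsProbabilityMeasure μ] {S : Set (E d)} {K : Set ((S →ᵇ ℝ) × (ℝ →ᵇ ℝ))} {L : ℝ} {θ₀ : (S →ᵇ ℝ) × (ℝ →ᵇ ℝ)}

theorem BinaryChoiceModel.uniform_lln (hmodel : BinaryChoiceModel μ Y V W ε g₀ F₀)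
    (hS : S = (μ.map (W 0)).support) (hK : TotallyBounded K) (hL : 0 ≤ L)
    (hK01 : ∀ θ ∈ K, ∀ u, θ.2 u ∈ Icc (0 : ℝ) 1)
    (hKL : ∀ θ ∈ K, ∀ a b, |θ.2 a - θ.2 b| ≤ L * |a - b|) {e : ℝ} (he : 0 < e) :
    WithProbToOne μ (fun n ω => ∀ θ ∈ K,
      |Qhat Y V W n ω (extendZero θ.1) θ.2 - populationCriterion μ Y V W θ| ≤ e) := by
  have hSm : MeasurableSet S := by rw [hS]; exact Measure.isClosed_support.measurableSet
  refine KNP.uniform_lln (Z := fun i ω => (Y i ω, V i ω, W i ω)) (K := K) hK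
    (fun i => (hmodel.measurable_Y i).prodMk (hmodel.measurable_X i)) hmodel.independent_obs
    hmodel.identical_obs (ℓ := fun θ z => (z.1 - choiceProb θ z.2) ^ 2)
    (fun θ _ => ?_) (A := {z | z.1 ∈ Icc (0 : ℝ) 1 ∧ z.2.2 ∈ S}) (fun i => ?_)
    (C := 2 * (1 + L)) (by positivity) (fun θ hθ z hz => ?_) (fun θ hθ θ' hθ' z hz => ?_) he
  · exact (measurable_fst.sub ((measurable_choiceProb hSm θ).comp measurable_snd)).pow_const 2
  · filter_upwards [hmodel.ae_Y_mem_Icc i, hmodel.ae_W_mem hS i] with ω h1 h2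
    exact ⟨h1, h2⟩
  · have h1 := choiceProb_mem_Icc (hK01 θ hθ) z.2
    rw [abs_of_nonneg (sq_nonneg _)]
    have h2 : |z.1 - choiceProb θ z.2| ≤ 1 := by
      rw [abs_le]; constructor <;> linarith [hz.1.1, hz.1.2, h1.1, h1.2]
    have h3 := (sq_le_one_iff_abs_le_one _).2 h2
    linarith
  · refine (abs_sq_sub_sq_le_of_mem_Icc hz.1 (choiceProb_mem_Icc (hK01 θ hθ) z.2)
      (choiceProb_mem_Icc (hK01 θ' hθ') z.2)).trans ?_
    have := abs_choiceProb_sub_le θ θ' hL (hKL θ' hθ') hz.2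
    linarith

/-- A Pythagorean identity: the cross term is the residual at the truth times a bounded function of
`X`, so its expectation vanishes. -/
theorem BinaryChoiceModel.populationCriterion_eq (hmodel : BinaryChoiceModel μ Y V W ε g₀ F₀)
    (hS : S = (μ.map (W 0)).support) (h01 : ∀ u, θ₀.2 u ∈ Icc (0 : ℝ) 1)
    (hg : ∀ w : S, θ₀.1 w = g₀ w) (hF : ∀ u, θ₀.2 u = F₀ u) {θ : (S →ᵇ ℝ) × (ℝ →ᵇ ℝ)}
    (hθ : ∀ u, θ.2 u ∈ Icc (0 : ℝ) 1) :
    populationCriterion μ Y V W θ =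
      populationCriterion μ Y V W θ₀ + meanSqDist μ V W θ θ₀ := by
  have hSm : MeasurableSet S := by rw [hS]; exact Measure.isClosed_support.measurableSet
  have hF₀ : Continuous F₀ := by
    have : F₀ = θ₀.2 := (funext hF).symm
    rw [this]; exact θ₀.2.continuous
  have hX := hmodel.measurable_X 0
  have hp := (measurable_choiceProb hSm θ).comp hX
  have hp₀ := (measurable_choiceProb hSm θ₀).comp hX
  have hY := hmodel.measurable_Y 0
  have hm : Measurable fun x => choiceProb θ₀ x - choiceProb θ x :=
    (measurable_choiceProb hSm θ₀).sub (measurable_choiceProb hSm θ)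
  have hcross := hmodel.integral_residual_mul_eq_zero hF₀
    (measurable_extendZero hSm θ₀.1.continuous.measurable) (by
      filter_upwards [hmodel.ae_W_mem hS 0] with ω hω
      rw [extendZero_apply _ hω, hg]) hm (C := 1) (fun x => by
      have h1 := choiceProb_mem_Icc hθ x
      have h2 := choiceProb_mem_Icc h01 x
      rw [abs_le]; constructor <;> linarith [h1.1, h1.2, h2.1, h2.2])
  have hcross' : ∫ ω, (Y 0 ω - choiceProb θ₀ (V 0 ω, W 0 ω)) *
      (choiceProb θ₀ (V 0 ω, W 0 ω) - choiceProb θ (V 0 ω, W 0 ω)) ∂μ = 0 := by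
    simpa only [choiceProb, hF] using hcross
  have hi : ∀ {f : Ω → ℝ}, Measurable f → (∀ᵐ ω ∂μ, |f ω| ≤ 1) → Integrable f μ :=
    fun hf h => Integrable.of_bound hf.aestronglyMeasurable 1 h
  have hbd : ∀ᵐ ω ∂μ, |Y 0 ω - choiceProb θ₀ (V 0 ω, W 0 ω)| ≤ 1 := by
    filter_upwards [hmodel.ae_Y_mem_Icc 0] with ω h1
    have h2 := choiceProb_mem_Icc h01 (V 0 ω, W 0 ω)
    rw [abs_le]; constructor <;> linarith [h1.1, h1.2, h2.1, h2.2]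
  have hbd' : ∀ ω, |choiceProb θ (V 0 ω, W 0 ω) - choiceProb θ₀ (V 0 ω, W 0 ω)| ≤ 1 := fun ω => by
    have h1 := choiceProb_mem_Icc hθ (V 0 ω, W 0 ω)
    have h2 := choiceProb_mem_Icc h01 (V 0 ω, W 0 ω)
    rw [abs_le]; constructor <;> linarith [h1.1, h1.2, h2.1, h2.2]
  have h1 : Integrable (fun ω => (Y 0 ω - choiceProb θ₀ (V 0 ω, W 0 ω)) ^ 2) μ := by
    refine hi ((hY.sub hp₀).pow_const 2) ?_
    filter_upwards [hbd] with ω h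
    rw [abs_of_nonneg (sq_nonneg _)]
    exact (sq_le_one_iff_abs_le_one _).2 h
  have h2 : Integrable (fun ω =>
      (choiceProb θ (V 0 ω, W 0 ω) - choiceProb θ₀ (V 0 ω, W 0 ω)) ^ 2) μ := by
    refine hi ((hp.sub hp₀).pow_const 2) (Eventually.of_forall fun ω => ?_)
    rw [abs_of_nonneg (sq_nonneg _)]
    exact (sq_le_one_iff_abs_le_one _).2 (hbd' ω)
  have h3 : Integrable (fun ω => (Y 0 ω - choiceProb θ₀ (V 0 ω, W 0 ω)) *
      (choiceProb θ₀ (V 0 ω, W 0 ω) - choiceProb θ (V 0 ω, W 0 ω))) μ := by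
    refine hi ((hY.sub hp₀).mul (hp₀.sub hp)) ?_
    filter_upwards [hbd] with ω h
    rw [abs_mul, abs_sub_comm (choiceProb θ₀ _)]
    exact mul_le_one₀ h (abs_nonneg _) (hbd' ω)
  have hsplit : ∀ ω, (Y 0 ω - choiceProb θ (V 0 ω, W 0 ω)) ^ 2 =
      (Y 0 ω - choiceProb θ₀ (V 0 ω, W 0 ω)) ^ 2 +
        (choiceProb θ (V 0 ω, W 0 ω) - choiceProb θ₀ (V 0 ω, W 0 ω)) ^ 2 +
      2 * ((Y 0 ω - choiceProb θ₀ (V 0 ω, W 0 ω)) *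
      (choiceProb θ₀ (V 0 ω, W 0 ω) - choiceProb θ (V 0 ω, W 0 ω))) := fun ω => by ring
  have h12 : Integrable (fun ω => (Y 0 ω - choiceProb θ₀ (V 0 ω, W 0 ω)) ^ 2 +
      (choiceProb θ (V 0 ω, W 0 ω) - choiceProb θ₀ (V 0 ω, W 0 ω)) ^ 2) μ := h1.add h2
  simp only [populationCriterion, meanSqDist, hsplit]
  rw [integral_add h12 (h3.const_mul 2), integral_add h1 h2, integral_const_mul, hcross']
  ring

lemma abs_meanSqDist_sub_le (hV : Measurable (V 0)) (hW : Measurable (W 0))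
    (hS : MeasurableSet S) (hWS : ∀ᵐ ω ∂μ, W 0 ω ∈ S) (hL : 0 ≤ L)
    (h01 : ∀ u, θ₀.2 u ∈ Icc (0 : ℝ) 1) {θ θ' : (S →ᵇ ℝ) × (ℝ →ᵇ ℝ)}
    (hθ : ∀ u, θ.2 u ∈ Icc (0 : ℝ) 1) (hθ' : ∀ u, θ'.2 u ∈ Icc (0 : ℝ) 1)
    (hθL : ∀ a b, |θ'.2 a - θ'.2 b| ≤ L * |a - b|) :
    |meanSqDist μ V W θ θ₀ - meanSqDist μ V W θ' θ₀| ≤ 2 * (1 + L) * dist θ θ' := by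
  have hX := hV.prodMk hW
  have hm : ∀ θ : (S →ᵇ ℝ) × (ℝ →ᵇ ℝ), Measurable fun ω => choiceProb θ (V 0 ω, W 0 ω) :=
    fun θ => (measurable_choiceProb hS θ).comp hX
  have hint : ∀ θ : (S →ᵇ ℝ) × (ℝ →ᵇ ℝ), (∀ u, θ.2 u ∈ Icc (0 : ℝ) 1) → Integrable
      (fun ω => (choiceProb θ (V 0 ω, W 0 ω) - choiceProb θ₀ (V 0 ω, W 0 ω)) ^ 2) μ := by
    intro θ hθ
    refine Integrable.of_bound (((hm θ).sub (hm θ₀)).pow_const 2).aestronglyMeasurable 1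
      (Eventually.of_forall fun ω => ?_)
    have h1 := choiceProb_mem_Icc hθ (V 0 ω, W 0 ω)
    have h2 := choiceProb_mem_Icc h01 (V 0 ω, W 0 ω)
    rw [Real.norm_of_nonneg (sq_nonneg _)]
    refine (sq_le_one_iff_abs_le_one _).2 ?_
    rw [abs_le]; constructor <;> linarith [h1.1, h1.2, h2.1, h2.2]
  rw [meanSqDist, meanSqDist, ← integral_sub (hint θ hθ) (hint θ' hθ')]
  have : ∀ᵐ ω ∂μ, ‖(choiceProb θ (V 0 ω, W 0 ω) - choiceProb θ₀ (V 0 ω, W 0 ω)) ^ 2 -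
      (choiceProb θ' (V 0 ω, W 0 ω) - choiceProb θ₀ (V 0 ω, W 0 ω)) ^ 2‖
      ≤ 2 * (1 + L) * dist θ θ' := by
    filter_upwards [hWS] with ω hω
    -- The signs are flipped so that the choice probability at `θ₀` takes the place of the response
    -- in the bound for squared losses.
    rw [Real.norm_eq_abs, ← neg_sq, neg_sub, ← neg_sq (choiceProb θ' _ - _), neg_sub]
    refine (abs_sq_sub_sq_le_of_mem_Icc (choiceProb_mem_Icc h01 _) (choiceProb_mem_Icc hθ _)
      (choiceProb_mem_Icc hθ' _)).trans ?_
    have := abs_choiceProb_sub_le (x := (V 0 ω, W 0 ω)) θ θ' hL hθL hω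
    linarith
  simpa using norm_integral_le_of_norm_le_const this

/-- The truth is a well-separated minimum: on the compact set of parameters at distance at least `e`
the continuous mean squared distance attains a minimum, which is positive by identification. Half of
it serves as `δ`. -/
lemma exists_dist_lt_of_meanSqDist_le (hV : Measurable (V 0)) (hW : Measurable (W 0))
    (hS : MeasurableSet S) (hWS : ∀ᵐ ω ∂μ, W 0 ω ∈ S) (hK : IsCompact K) (hL : 0 ≤ L)
    (hK01 : ∀ θ ∈ K, ∀ u, θ.2 u ∈ Icc (0 : ℝ) 1)
    (hKL : ∀ θ ∈ K, ∀ a b, |θ.2 a - θ.2 b| ≤ L * |a - b|) (hθ₀ : θ₀ ∈ K)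
    (hid : ∀ θ ∈ K, (∀ᵐ ω ∂μ, choiceProb θ (V 0 ω, W 0 ω) = choiceProb θ₀ (V 0 ω, W 0 ω)) →
      θ = θ₀) {e : ℝ} (he : 0 < e) :
    ∃ δ > 0, ∀ θ ∈ K, meanSqDist μ V W θ θ₀ ≤ δ → dist θ θ₀ < e := by
  have hcont : ContinuousOn (fun θ => meanSqDist μ V W θ θ₀) K := by
    refine LipschitzOnWith.continuousOn (K := Real.toNNReal (2 * (1 + L)))
      (LipschitzOnWith.of_dist_le_mul fun θ hθ θ' hθ' => ?_)
    rw [Real.coe_toNNReal _ (by positivity)]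
    exact abs_meanSqDist_sub_le hV hW hS hWS hL (hK01 θ₀ hθ₀) (hK01 θ hθ) (hK01 θ' hθ')
      (hKL θ' hθ')
  have hK' : IsCompact (K ∩ {θ | e ≤ dist θ θ₀}) :=
    hK.inter_right (isClosed_le continuous_const (continuous_id.dist continuous_const))
  rcases (K ∩ {θ | e ≤ dist θ θ₀}).eq_empty_or_nonempty with hempty | hne
  · refine ⟨1, one_pos, fun θ hθ _ => ?_⟩
    by_contra h
    have : θ ∈ K ∩ {θ | e ≤ dist θ θ₀} := ⟨hθ, not_lt.1 h⟩
    simp [hempty] at this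
  · obtain ⟨θ₁, hθ₁, hmin⟩ := hK'.exists_isMinOn hne (hcont.mono inter_subset_left)
    have hpos : 0 < meanSqDist μ V W θ₁ θ₀ := by
      refine lt_of_le_of_ne (integral_nonneg fun _ => sq_nonneg _) fun h0 => ?_
      have hm : ∀ θ : (S →ᵇ ℝ) × (ℝ →ᵇ ℝ), Measurable fun ω => choiceProb θ (V 0 ω, W 0 ω) :=
        fun θ => (measurable_choiceProb hS θ).comp (hV.prodMk hW)
      have hint : Integrable (fun ω =>
          (choiceProb θ₁ (V 0 ω, W 0 ω) - choiceProb θ₀ (V 0 ω, W 0 ω)) ^ 2) μ := by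
        refine Integrable.of_bound (((hm θ₁).sub (hm θ₀)).pow_const 2).aestronglyMeasurable 1
          (Eventually.of_forall fun ω => ?_)
        have h1 := choiceProb_mem_Icc (hK01 θ₁ hθ₁.1) (V 0 ω, W 0 ω)
        have h2 := choiceProb_mem_Icc (hK01 θ₀ hθ₀) (V 0 ω, W 0 ω)
        rw [Real.norm_of_nonneg (sq_nonneg _)]
        refine (sq_le_one_iff_abs_le_one _).2 ?_
        rw [abs_le]; constructor <;> linarith [h1.1, h1.2, h2.1, h2.2]
      have hae := (integral_eq_zero_iff_of_nonneg (fun _ => sq_nonneg _) hint).1 h0.symm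
      have := hid θ₁ hθ₁.1 (by
        filter_upwards [hae] with ω hω
        exact sub_eq_zero.1 (pow_eq_zero_iff two_ne_zero |>.1 hω))
      have h2 : e ≤ dist θ₁ θ₀ := hθ₁.2
      rw [this, dist_self] at h2
      linarith
    refine ⟨meanSqDist μ V W θ₁ θ₀ / 2, by positivity, fun θ hθ hle => ?_⟩
    by_contra h
    have := hmin (show θ ∈ K ∩ {θ | e ≤ dist θ θ₀} from ⟨hθ, not_lt.1 h⟩)
    simp only [mem_ofPred_eq] at this
    linarith

lemma dTheta_le_of_dist_lt {θ : (S →ᵇ ℝ) × (ℝ →ᵇ ℝ)} {g : E d → ℝ} {F : ℝ → ℝ}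
    (hg : ∀ w : S, θ.1 w = g w) (hF : ∀ u, θ.2 u = F u) (hg₀ : ∀ w : S, θ₀.1 w = g₀ w)
    (hF₀ : ∀ u, θ₀.2 u = F₀ u) {e : ℝ} (h : dist θ θ₀ ≤ e) :
    dTheta S g g₀ F F₀ ≤ ENNReal.ofReal (2 * e) := by
  have he : 0 ≤ e := dist_nonneg.trans h
  rw [two_mul, ENNReal.ofReal_add he he, dTheta]
  refine add_le_add (iSup₂_le fun w hw => ENNReal.ofReal_le_ofReal ?_)
    (iSup_le fun u => ENNReal.ofReal_le_ofReal ?_)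
  · rw [← hg ⟨w, hw⟩, ← hg₀ ⟨w, hw⟩]
    exact (BoundedContinuousFunction.dist_coe_le_dist (f := θ.1) (g := θ₀.1) _).trans
      ((le_max_left (dist θ.1 θ₀.1) (dist θ.2 θ₀.2)).trans h)
  · rw [← hF, ← hF₀]
    exact (BoundedContinuousFunction.dist_coe_le_dist (f := θ.2) (g := θ₀.2) _).trans
      ((le_max_right (dist θ.1 θ₀.1) (dist θ.2 θ₀.2)).trans h)

lemma dPi_le_of_dist_lt {θ : (S →ᵇ ℝ) × (ℝ →ᵇ ℝ)} {g : E d → ℝ} {F : ℝ → ℝ}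
    (hg : ∀ w : S, θ.1 w = g w) (hF : ∀ u, θ.2 u = F u) (hg₀ : ∀ w : S, θ₀.1 w = g₀ w)
    (hF₀ : ∀ u, θ₀.2 u = F₀ u) {𝒳 : Set (ℝ × E d)} (h𝒳 : ∀ x ∈ 𝒳, x.2 ∈ S) (hL : 0 ≤ L)
    (hθ₀ : ∀ a b, |θ₀.2 a - θ₀.2 b| ≤ L * |a - b|) {e : ℝ} (h : dist θ θ₀ ≤ e) :
    dPi 𝒳 (ccp g F) (ccp g₀ F₀) ≤ ENNReal.ofReal ((1 + L) * e) := by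
  refine iSup₂_le fun x hx => ENNReal.ofReal_le_ofReal ?_
  have h1 := abs_choiceProb_sub_le θ θ₀ hL hθ₀ (h𝒳 x hx)
  simp only [choiceProb, extendZero_apply _ (h𝒳 x hx), hg, hF, hg₀, hF₀] at h1
  exact h1.trans (mul_le_mul_of_nonneg_left h (by positivity))

/-- The sieve-free core. The first conclusion reduces consistency to an upper bound on the empirical
criterion of the estimator. The second provides such a bound at every parameter near the truth,
simultaneously, so that it may be applied to a competitor depending on the sample. -/
theorem consistency_of_nearMin (hmodel : BinaryChoiceModel μ Y V W ε g₀ F₀)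
    (hS : S = (μ.map (W 0)).support) {𝒳 : Set (ℝ × E d)}
    (h𝒳 : 𝒳 = (μ.map (fun ω => (V 0 ω, W 0 ω))).support) {wstar : E d} (hwstar : wstar ∈ S)
    (hcond : ∃ ν : Measure ℝ, IsProbabilityMeasure ν ∧
      IsCondLawAt μ (V 0) (W 0) wstar ν ∧ ν.support = Set.univ)
    (hF₀mono : StrictMono F₀) (hcompact : IsCompact S) {O : Set (E d)} (hO : IsOpen O)
    (hSO : S ⊆ O) {mw : ℕ} (hmw : 1 ≤ mw) {Mg : ℝ} (hg₀ : g₀ ∈ gSpace S O mw Mg wstar)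
    {s : ℕ} (hs : 1 ≤ s) {η MF : ℝ} (hη : 0 < η) (hF₀ : F₀ ∈ distSpace s η MF) :
    ∃ Q₀ : ℝ,
      (∀ (ghat : ℕ → Ω → E d → ℝ) (Fhat : ℕ → Ω → ℝ → ℝ),
        (∀ᶠ n in atTop, ∀ᵐ ω ∂μ, ghat n ω ∈ gSpace S O mw Mg wstar ∧
          Fhat n ω ∈ distSpace s η MF) →
        (∀ e > 0, WithProbToOne μ
          (fun n ω => Qhat Y V W n ω (ghat n ω) (Fhat n ω) ≤ Q₀ + e)) →
        ToZeroInProb μ (fun n ω => dTheta S (ghat n ω) g₀ (Fhat n ω) F₀) ∧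
        ToZeroInProb μ (fun n ω => dPi 𝒳 (ccp (ghat n ω) (Fhat n ω)) (ccp g₀ F₀))) ∧
      ∀ e > 0, ∃ δ > 0, WithProbToOne μ (fun n ω =>
        ∀ g ∈ gSpace S O mw Mg wstar, ∀ F ∈ distSpace s η MF,
          (∀ w ∈ S, |g w - g₀ w| ≤ δ) → (∀ u, |F u - F₀ u| ≤ δ) →
          Qhat Y V W n ω g F ≤ Q₀ + e) := by
  obtain ⟨ν, hνp, hν, hνs⟩ := hcond
  have hSc : IsClosed S := by rw [hS]; exact Measure.isClosed_support
  have hSm := hSc.measurableSet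
  have hV := hmodel.measurable_V 0
  have hW := hmodel.measurable_W 0
  have hWS := fun i => hmodel.ae_W_mem hS i
  obtain ⟨ρ, hρ, hρO⟩ := exists_ball_subset_of_isOpen hO hSO
  have hMg : 0 ≤ Mg := by
    obtain ⟨h, -, hb⟩ := hg₀.1
    exact (abs_nonneg _).trans (hb.abs_le (hSO hwstar))
  have rep : ∀ g ∈ gSpace S O mw Mg wstar, ∀ F ∈ distSpace s η MF,
      ∃ θ ∈ gClass S ⟨wstar, hwstar⟩ (d * Mg) Mg ρ ×ˢ
        cdfClass (Real.toNNReal (2 + MF ^ 2)) (tailBound η MF),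
        (∀ w : S, θ.1 w = g w) ∧ ∀ u, θ.2 u = F u := by
    intro g hg F hF
    obtain ⟨G, hG, hGg⟩ := exists_bcf_of_mem_gSpace (a := ⟨wstar, hwstar⟩) hρ hρO hmw hg
    obtain ⟨F', hF', hFF⟩ := exists_bcf_of_mem_distSpace hs hη.le hF
    exact ⟨(G, F'), ⟨hG, hF'⟩, hGg, hFF⟩
  set K := gClass S ⟨wstar, hwstar⟩ (d * Mg) Mg ρ ×ˢ
    cdfClass (Real.toNNReal (2 + MF ^ 2)) (tailBound η MF) with hKdef
  have hK : IsCompact K := (isCompact_gClass hcompact _ (by positivity) hρ).prod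
    (isCompact_cdfClass _ (tendsto_tailBound hη MF))
  obtain ⟨θ₀, hθ₀, hθ₀g, hθ₀F⟩ := rep g₀ hg₀ F₀ hF₀
  set L : ℝ := ((Real.toNNReal (2 + MF ^ 2) : NNReal) : ℝ)
  have hL : 0 ≤ L := NNReal.coe_nonneg _
  have hK01 : ∀ θ ∈ K, ∀ u, θ.2 u ∈ Icc (0 : ℝ) 1 := fun θ hθ => hθ.2.1
  have hKL : ∀ θ ∈ K, ∀ a b, |θ.2 a - θ.2 b| ≤ L * |a - b| := fun θ hθ => hθ.2.2.1
  have hmono : StrictMono θ₀.2 := by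
    intro a b hab
    rw [hθ₀F, hθ₀F]; exact hF₀mono hab
  have hid : ∀ θ ∈ K, (∀ᵐ ω ∂μ, choiceProb θ (V 0 ω, W 0 ω) = choiceProb θ₀ (V 0 ω, W 0 ω)) →
      θ = θ₀ := fun θ hθ h =>
    eq_of_ae_choiceProb_eq hV hW hS (a := ⟨wstar, hwstar⟩) hν hνs hθ.1.2.1 hθ₀.1.2.1 hmono h
  have hpop : ∀ θ ∈ K, populationCriterion μ Y V W θ =
      populationCriterion μ Y V W θ₀ + meanSqDist μ V W θ θ₀ := fun θ hθ =>
    hmodel.populationCriterion_eq hS (hK01 θ₀ hθ₀) hθ₀g hθ₀F (hK01 θ hθ)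
  have hlln := fun {e : ℝ} (he : 0 < e) =>
    hmodel.uniform_lln hS hK.totallyBounded hL hK01 hKL he
  -- The empirical criterion sees an index function only at the sample points, which almost surely
  -- lie in `S`. This passes between the parameters as given and their representatives in `K`.
  have hQ : ∀ᵐ ω ∂μ, ∀ n : ℕ, ∀ θ : (S →ᵇ ℝ) × (ℝ →ᵇ ℝ), ∀ g : E d → ℝ, ∀ F : ℝ → ℝ,
      (∀ w : S, θ.1 w = g w) → (∀ u, θ.2 u = F u) →
      Qhat Y V W n ω (extendZero θ.1) θ.2 = Qhat Y V W n ω g F := by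
    filter_upwards [ae_all_iff.2 hWS] with ω hω n θ g F h1 h2
    simp only [Qhat, h2, extendZero_apply _ (hω _), h1]
  have h𝒳S : ∀ x ∈ 𝒳, x.2 ∈ S := by
    intro x hx
    rw [h𝒳] at hx
    exact (eq_on_support_of_ae_eq hSc (hV.prodMk hW) (hWS 0) (θ := θ₀) (θ' := θ₀)
      (Eventually.of_forall fun _ => rfl) hx).1
  refine ⟨populationCriterion μ Y V W θ₀, fun ghat Fhat hmem hmin => ?_, fun e he => ?_⟩
  · have key : ∀ e > 0, WithProbToOne μ (fun n ω => ∃ θ : (S →ᵇ ℝ) × (ℝ →ᵇ ℝ),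
        (∀ w : S, θ.1 w = ghat n ω w) ∧ (∀ u, θ.2 u = Fhat n ω u) ∧ dist θ θ₀ ≤ e) := by
      intro e he
      obtain ⟨δ, hδ, hδe⟩ := exists_dist_lt_of_meanSqDist_le hV hW hSm (hWS 0) hK hL hK01 hKL hθ₀
        hid he
      refine ((hlln (half_pos hδ)).and (hmin (δ / 2) (half_pos hδ))).mono_ae ?_
      filter_upwards [hmem] with n hn
      filter_upwards [hn, hQ] with ω hω hQω h
      obtain ⟨θ, hθ, hθg, hθF⟩ := rep _ hω.1 _ hω.2
      refine ⟨θ, hθg, hθF, (hδe θ hθ ?_).le⟩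
      have h1 := (abs_le.1 (h.1 θ hθ)).1
      have h2 := h.2
      rw [hQω n θ _ _ hθg hθF, hpop θ hθ] at h1
      linarith
    constructor
    · refine WithProbToOne.toZeroInProb fun e he => (key (e / 2) (by positivity)).mono ?_
      rintro n ω ⟨θ, h1, h2, h3⟩
      have := dTheta_le_of_dist_lt h1 h2 hθ₀g hθ₀F h3
      rwa [mul_div_cancel₀ e two_ne_zero] at this
    · refine WithProbToOne.toZeroInProb fun e he => (key (e / (1 + L)) (by positivity)).mono ?_
      rintro n ω ⟨θ, h1, h2, h3⟩
      have := dPi_le_of_dist_lt h1 h2 hθ₀g hθ₀F h𝒳S hL (hKL θ₀ hθ₀) h3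
      rwa [mul_div_cancel₀ e (by positivity)] at this
  -- The mean squared distance is `2 * (1 + L)`-Lipschitz and vanishes at the truth, so this radius
  -- keeps it below `e / 2`; the other half is spent on the law of large numbers.
  · refine ⟨e / (4 * (1 + L)), by positivity, (hlln (half_pos he)).mono_ae
      (Eventually.of_forall fun n => ?_)⟩
    filter_upwards [hQ] with ω hQω h g hg F hF hgg hFF
    obtain ⟨θ, hθ, hθg, hθF⟩ := rep g hg F hF
    have hd : dist θ θ₀ ≤ e / (4 * (1 + L)) := by
      refine max_le ?_ ?_
      · refine (BoundedContinuousFunction.dist_le (by positivity)).2 fun w => ?_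
        rw [hθg, hθ₀g]; exact hgg w w.2
      · refine (BoundedContinuousFunction.dist_le (by positivity)).2 fun u => ?_
        rw [hθF, hθ₀F]; exact hFF u
    have h1 := abs_meanSqDist_sub_le hV hW hSm (hWS 0) hL (hK01 θ₀ hθ₀) (hK01 θ hθ)
      (hK01 θ₀ hθ₀) (hKL θ₀ hθ₀)
    have h0 : meanSqDist μ V W θ₀ θ₀ = 0 := by simp [meanSqDist]
    rw [h0, sub_zero] at h1
    have h2 : 2 * (1 + L) * dist θ θ₀ ≤ e / 2 := by
      rw [le_div_iff₀ (by positivity)] at hd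
      linarith
    have h3 := (abs_le.1 (h θ hθ)).2
    rw [hQω n θ _ _ hθg hθF, hpop θ hθ] at h3
    have h4 := (abs_le.1 h1).2
    linarith

end Consistency

/-! ### Polynomials times a Gaussian are dense in `L²(ℝ)` -/

lemma exists_abs_eval_le_exp (P : Polynomial ℝ) {c : ℝ} (hc : 0 < c) :
    ∃ C, 0 ≤ C ∧ ∀ u : ℝ, |P.eval u| ≤ C * Real.exp (c * u ^ 2) := by
  induction P using Polynomial.induction_on' with
  | add p q hp hq =>
    obtain ⟨C, hC, h⟩ := hp
    obtain ⟨D, hD, h'⟩ := hq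
    refine ⟨C + D, by positivity, fun u => ?_⟩
    rw [Polynomial.eval_add, add_mul]
    exact (abs_add_le _ _).trans (add_le_add (h u) (h' u))
  | monomial n a =>
    refine ⟨|a| * (1 + n.factorial / c ^ n), by positivity, fun u => ?_⟩
    rw [Polynomial.eval_monomial, abs_mul, abs_pow, mul_assoc]
    refine mul_le_mul_of_nonneg_left ?_ (abs_nonneg a)
    have h1 : |u| ^ n ≤ 1 + (u ^ 2) ^ n := by
      rw [← sq_abs u, ← pow_mul, mul_comm, pow_mul]
      nlinarith [sq_nonneg (|u| ^ n - 1)]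
    have h2 := Real.pow_div_factorial_le_exp (x := c * u ^ 2) (by positivity) n
    have h3 : (u ^ 2) ^ n ≤ n.factorial / c ^ n * Real.exp (c * u ^ 2) := by
      rw [div_le_iff₀ (by positivity), mul_pow] at h2
      rw [div_mul_eq_mul_div, le_div_iff₀ (by positivity)]
      linarith
    have h4 : 1 ≤ Real.exp (c * u ^ 2) := Real.one_le_exp (by positivity)
    linarith

lemma integrable_polynomial_mul_exp (P : Polynomial ℝ) {c : ℝ} (hc : 0 < c) :
    Integrable fun u : ℝ => P.eval u * Real.exp (-c * u ^ 2) := by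
  obtain ⟨C, hC, h⟩ := exists_abs_eval_le_exp P (half_pos hc)
  refine ((integrable_exp_neg_mul_sq (half_pos hc)).const_mul C).mono'
    (by fun_prop) (Eventually.of_forall fun u => ?_)
  rw [norm_mul, Real.norm_eq_abs, Real.norm_eq_abs, abs_of_pos (Real.exp_pos _)]
  calc |P.eval u| * Real.exp (-c * u ^ 2)
      ≤ C * Real.exp (c / 2 * u ^ 2) * Real.exp (-c * u ^ 2) := by gcongr; exact h u
    _ = C * Real.exp (-(c / 2) * u ^ 2) := by
      rw [mul_assoc, ← Real.exp_add]; congr 2; ring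

lemma memLp_polynomial_mul_exp (P : Polynomial ℝ) {c : ℝ} (hc : 0 < c) :
    MemLp (fun u : ℝ => P.eval u * Real.exp (-c * u ^ 2)) 2 := by
  rw [memLp_two_iff_integrable_sq (by fun_prop)]
  refine (integrable_polynomial_mul_exp (P ^ 2) (c := 2 * c) (by positivity)).congr
    (Eventually.of_forall fun u => ?_)
  simp only [Polynomial.eval_pow, mul_pow, ← Real.exp_nat_mul]
  congr 2
  push_cast
  ring

/-- A function with exponential moments whose polynomial moments vanish is zero. -/
theorem ae_eq_zero_of_moments_eq_zero {w : ℝ → ℝ} (hw : Measurable w)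
    (hexp : ∀ t : ℝ, Integrable fun x => w x * Real.exp (t * x))
    (hpow : ∀ n : ℕ, Integrable fun x => w x * x ^ n)
    (hzero : ∀ n : ℕ, ∫ x, w x * x ^ n = 0) : w =ᵐ[volume] 0 := by
  -- Since `ENNReal.ofReal` cuts off negative values, `ν w` and `ν (-w)` have the positive and the
  -- negative part of `w` as densities. The claim is that these measures coincide.
  let ν : (ℝ → ℝ) → Measure ℝ := fun v => volume.withDensity fun x => ENNReal.ofReal (v x)
  have hpos : ∀ {g h : ℝ → ℝ}, Measurable g → Integrable (fun x => g x * h x) → Measurable h →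
      Integrable (fun x => max (g x) 0 * h x) := by
    intro g h hg hgh hh
    refine hgh.mono ((hg.max measurable_const).mul hh).aestronglyMeasurable
      (Eventually.of_forall fun x => ?_)
    rw [norm_mul, norm_mul]
    refine mul_le_mul_of_nonneg_right ?_ (norm_nonneg _)
    rw [Real.norm_eq_abs, Real.norm_eq_abs, abs_of_nonneg (le_max_right _ _)]
    exact max_le (le_abs_self _) (abs_nonneg _)
  have main : ∀ v : ℝ → ℝ, Measurable v → (∀ t : ℝ, Integrable fun x => v x * Real.exp (t * x)) →
      IsFiniteMeasure (ν v) ∧ (∀ z : ℂ, AnalyticAt ℂ (complexMGF id (ν v)) z) ∧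
      ∀ n : ℕ, iteratedDeriv n (complexMGF id (ν v)) 0 =
        ∫ x, ((max (v x) 0 * x ^ n : ℝ) : ℂ) := by
    intro v hv hvexp
    have hvi : Integrable v := by simpa using hvexp 0
    have hset : integrableExpSet id (ν v) = univ := by
      refine eq_univ_of_forall fun t => ?_
      change Integrable (fun x => Real.exp (t * x)) (ν v)
      rw [integrable_withDensity_iff_integrable_smul' (by fun_prop)
        (Eventually.of_forall fun _ => ENNReal.ofReal_lt_top)]
      simp only [ENNReal.toReal_ofReal', smul_eq_mul]
      exact hpos hv (hvexp t) (by fun_prop)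
    have hint : ∀ z : ℂ, z.re ∈ interior (integrableExpSet id (ν v)) := fun z => by
      rw [hset, interior_univ]; trivial
    refine ⟨?_, fun z => analyticAt_complexMGF (hint z), fun n => ?_⟩
    · refine isFiniteMeasure_withDensity_ofReal hvi.2
    · rw [iteratedDeriv_complexMGF (hint 0)]
      simp only [zero_mul, Complex.exp_zero, mul_one, id]
      rw [integral_withDensity_eq_integral_toReal_smul (by fun_prop)
        (Eventually.of_forall fun _ => ENNReal.ofReal_lt_top)]
      simp [ENNReal.toReal_ofReal']
  obtain ⟨hf1, ha1, hd1⟩ := main w hw hexp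
  have hnexp : ∀ t : ℝ, Integrable fun x => -w x * Real.exp (t * x) := fun t => by
    exact (hexp t).neg.congr (Eventually.of_forall fun x => by simp)
  obtain ⟨hf2, ha2, hd2⟩ := main (fun x => -w x) hw.neg hnexp
  have hder : ∀ n : ℕ, iteratedDeriv n (complexMGF id (ν w)) 0 =
      iteratedDeriv n (complexMGF id (ν fun x => -w x)) 0 := by
    intro n
    rw [hd1, hd2, integral_complex_ofReal, integral_complex_ofReal]
    congr 1
    have hneg : Integrable fun x => -w x * x ^ n :=
      (hpow n).neg.congr (Eventually.of_forall fun x => by simp)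
    rw [← sub_eq_zero, ← integral_sub (hpos hw (hpow n) (by fun_prop))
      (hpos (g := fun x => -w x) hw.neg hneg (by fun_prop))]
    refine Eq.trans ?_ (hzero n)
    congr 1
    ext x
    rcases le_total 0 (w x) with h | h
    · rw [max_eq_left h, max_eq_right (by linarith)]; ring
    · rw [max_eq_right h, max_eq_left (by linarith)]; ring
  -- All exponential moments are finite, so both transforms are entire; equal moments mean equal
  -- Taylor coefficients at `0`.
  have hmgf : complexMGF id (ν w) = complexMGF id (ν fun x => -w x) := by
    ext z
    have h1 := Complex.hasSum_taylorSeries_of_entire (f := complexMGF id (ν w))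
      (fun z => (ha1 z).differentiableAt) 0 z
    have h2 := Complex.hasSum_taylorSeries_of_entire (f := complexMGF id (ν fun x => -w x))
      (fun z => (ha2 z).differentiableAt) 0 z
    simp only [hder] at h1
    exact h1.unique h2
  have hν := Measure.ext_of_complexMGF_id_eq hmgf
  have hae := (withDensity_eq_iff_of_sigmaFinite (by fun_prop) (by fun_prop)).1 hν
  filter_upwards [hae] with x hx
  rcases le_total 0 (w x) with h | h
  · rw [ENNReal.ofReal_of_nonpos (by linarith : -w x ≤ 0), ENNReal.ofReal_eq_zero] at hx
    exact le_antisymm hx h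
  · rw [ENNReal.ofReal_of_nonpos h, eq_comm, ENNReal.ofReal_eq_zero] at hx
    exact le_antisymm h (by simpa using hx)

/-- In a Hilbert space, density of a subspace means that its orthogonal complement is trivial. If
`g` is orthogonal to all polynomials times the Gaussian, then `g` times the Gaussian has vanishing
moments, and it has exponential moments because of the Gaussian factor. -/
theorem exists_polynomial_integral_sq_le {c : ℝ} (hc : 0 < c) {h : ℝ → ℝ} (hh : MemLp h 2)
    {e : ℝ} (he : 0 < e) :
    ∃ P : Polynomial ℝ, Integrable (fun u => (h u - P.eval u * Real.exp (-c * u ^ 2)) ^ 2) ∧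
      ∫ u, (h u - P.eval u * Real.exp (-c * u ^ 2)) ^ 2 ≤ e := by
  let Φ : Polynomial ℝ →ₗ[ℝ] Lp ℝ 2 (volume : Measure ℝ) :=
    { toFun := fun P => (memLp_polynomial_mul_exp P hc).toLp
      map_add' := fun P Q => by
        rw [← MemLp.toLp_add]
        congr 1
        ext u
        simp [add_mul]
      map_smul' := fun a P => by
        rw [RingHom.id_apply, ← MemLp.toLp_const_smul]
        congr 1
        ext u
        simp [mul_assoc] }
  have horth : (LinearMap.range Φ)ᗮ = ⊥ := by
    rw [Submodule.eq_bot_iff]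
    intro g hg
    rw [Submodule.mem_orthogonal] at hg
    have hgm : Measurable g := (Lp.stronglyMeasurable g).measurable
    have hgL : MemLp g 2 := Lp.memLp g
    let w : ℝ → ℝ := fun x => g x * Real.exp (-c * x ^ 2)
    have hinner : ∀ P : Polynomial ℝ, ∫ x, w x * P.eval x = 0 := by
      intro P
      have h1 := hg (Φ P) ⟨P, rfl⟩
      rw [L2.inner_def] at h1
      rw [← h1]
      refine integral_congr_ae ?_
      filter_upwards [(memLp_polynomial_mul_exp P hc).coeFn_toLp] with x hx
      change _ = inner ℝ ((memLp_polynomial_mul_exp P hc).toLp _ x) _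
      rw [hx]
      simp only [w, RCLike.inner_apply, conj_trivial]
      ring
    have hwm : Measurable w := hgm.mul (by fun_prop)
    -- Only half of the Gaussian is spent on the growth of `f`; the rest keeps the product in `L²`,
    -- and Hölder with `g` gives integrability. Exponentials and monomials are both covered.
    have hmul : ∀ {f : ℝ → ℝ} {C : ℝ}, Measurable f →
        (∀ x, |f x| ≤ C * Real.exp (c / 2 * x ^ 2)) → Integrable fun x => w x * f x := by
      intro f C hf hC
      have hL : MemLp (fun x => f x * Real.exp (-c * x ^ 2)) 2 := by
        refine (((memLp_polynomial_mul_exp 1 (half_pos hc)).const_mul C).mono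
          (hf.mul (by fun_prop)).aestronglyMeasurable (Eventually.of_forall fun x => ?_))
        rw [norm_mul, Real.norm_eq_abs, Real.norm_eq_abs, abs_of_pos (Real.exp_pos _)]
        refine le_trans ?_ (le_abs_self _)
        calc |f x| * Real.exp (-c * x ^ 2)
            ≤ C * Real.exp (c / 2 * x ^ 2) * Real.exp (-c * x ^ 2) := by gcongr; exact hC x
          _ = _ := by
            rw [mul_assoc, ← Real.exp_add, Polynomial.eval_one, one_mul]; congr 2; ring
      refine (hgL.integrable_mul hL).congr (Eventually.of_forall fun x => ?_)
      simp only [w, Pi.mul_apply]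
      ring
    have hw0 : w =ᵐ[volume] 0 := by
      refine ae_eq_zero_of_moments_eq_zero hwm (fun t => ?_) (fun n => ?_) fun n => ?_
      · refine hmul (C := Real.exp (t ^ 2 / (2 * c))) (by fun_prop) fun x => ?_
        rw [abs_of_pos (Real.exp_pos _), ← Real.exp_add, Real.exp_le_exp]
        have h1 : t ^ 2 / (2 * c) + c / 2 * x ^ 2 - t * x = (t - c * x) ^ 2 / (2 * c) := by
          field_simp; ring
        have h2 : 0 ≤ (t - c * x) ^ 2 / (2 * c) := by positivity
        linarith
      · obtain ⟨C, -, hC⟩ := exists_abs_eval_le_exp (Polynomial.X ^ n) (half_pos hc)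
        refine hmul (C := C) (by fun_prop) fun x => ?_
        simpa using hC x
      · simpa using hinner (Polynomial.X ^ n)
    refine (Lp.eq_zero_iff_ae_eq_zero).2 ?_
    filter_upwards [hw0] with x hx
    exact (mul_eq_zero.1 hx).resolve_right (Real.exp_pos _).ne'
  have htop := (Submodule.topologicalClosure_eq_top_iff (K := LinearMap.range Φ)).2 horth
  have hmem : hh.toLp ∈ closure (LinearMap.range Φ : Set (Lp ℝ 2 (volume : Measure ℝ))) := by
    rw [← Submodule.topologicalClosure_coe, htop]; trivial
  obtain ⟨_, ⟨P, rfl⟩, hP⟩ := Metric.mem_closure_iff.1 hmem (Real.sqrt e) (Real.sqrt_pos.2 he)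
  have hL : MemLp (fun u => h u - P.eval u * Real.exp (-c * u ^ 2)) 2 :=
    hh.sub (memLp_polynomial_mul_exp P hc)
  refine ⟨P, hL.integrable_sq, ?_⟩
  have h1 : hh.toLp - Φ P = hL.toLp := (MemLp.toLp_sub hh (memLp_polynomial_mul_exp P hc)).symm
  rw [dist_eq_norm, h1] at hP
  have h2 : ‖hL.toLp‖ ^ 2 = ∫ u, (h u - P.eval u * Real.exp (-c * u ^ 2)) ^ 2 := by
    rw [← real_inner_self_eq_norm_sq, L2.inner_def]
    refine integral_congr_ae ?_
    filter_upwards [hL.coeFn_toLp] with u hu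
    rw [hu, RCLike.inner_apply, conj_trivial]
    ring
  rw [← h2, ← Real.sq_sqrt he.le]
  exact pow_le_pow_left₀ (norm_nonneg _) hP.le 2

/-! ### Finite sequences of successive derivatives -/

/-- `a 0, …, a s` are successive derivatives. -/
def IsJet (s : ℕ) (a : ℕ → ℝ → ℝ) : Prop := ∀ j < s, ∀ x, HasDerivAt (a j) (a (j + 1) x) x

lemma IsJet.iteratedDeriv_eq {s : ℕ} {a : ℕ → ℝ → ℝ} (h : IsJet s a) {j : ℕ} (hj : j ≤ s) :
    iteratedDeriv j (a 0) = a j := by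
  induction j with
  | zero => exact iteratedDeriv_zero
  | succ j ih =>
    rw [iteratedDeriv_succ, ih (by omega)]
    exact funext fun x => (h j hj x).deriv

lemma IsJet.shift {s : ℕ} {a : ℕ → ℝ → ℝ} (h : IsJet (s + 1) a) : IsJet s fun j => a (j + 1) :=
  fun j hj => h (j + 1) (by omega)

lemma IsJet.mono {s s' : ℕ} {a : ℕ → ℝ → ℝ} (h : IsJet s a) (hs : s' ≤ s) : IsJet s' a :=
  fun j hj => h j (by omega)

lemma IsJet.measurable {s : ℕ} {a : ℕ → ℝ → ℝ} (h : IsJet s a) (hs : 1 ≤ s) {j : ℕ}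
    (hj : j ≤ s) : Measurable (a j) := by
  rcases Nat.lt_or_ge j s with hlt | hge
  · exact (continuous_iff_continuousAt.2 fun x => (h j hlt x).continuousAt).measurable
  · obtain ⟨i, rfl⟩ : ∃ i, j = i + 1 := ⟨j - 1, by omega⟩
    have : a (i + 1) = deriv (a i) := funext fun x => ((h i (by omega) x).deriv).symm
    rw [this]
    exact measurable_deriv _

lemma isJet_iteratedDeriv {s : ℕ} {f : ℝ → ℝ}
    (h : ∀ j < s, Differentiable ℝ (iteratedDeriv j f)) : IsJet s fun j => iteratedDeriv j f := by
  intro j hj x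
  have := (h j hj x).hasDerivAt
  rwa [← iteratedDeriv_succ] at this

lemma isJet_of_contDiff {s : ℕ} {f : ℝ → ℝ} (h : ContDiff ℝ (⊤ : ℕ∞) f) :
    IsJet s fun j => iteratedDeriv j f :=
  isJet_iteratedDeriv fun j _ => h.differentiable_iteratedDeriv j
    (by exact_mod_cast ENat.natCast_lt_top j)

lemma IsJet.add {s : ℕ} {a b : ℕ → ℝ → ℝ} (ha : IsJet s a) (hb : IsJet s b) :
    IsJet s fun j x => a j x + b j x := fun j hj x => (ha j hj x).add (hb j hj x)

lemma IsJet.sub {s : ℕ} {a b : ℕ → ℝ → ℝ} (ha : IsJet s a) (hb : IsJet s b) :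
    IsJet s fun j x => a j x - b j x := fun j hj x => (ha j hj x).sub (hb j hj x)

/-- The derivatives of a product, by the Leibniz rule. -/
def jetMul : ℕ → (ℕ → ℝ → ℝ) → (ℕ → ℝ → ℝ) → ℝ → ℝ
  | 0, a, b => fun x => a 0 x * b 0 x
  | j + 1, a, b => fun x => jetMul j (fun i => a (i + 1)) b x + jetMul j a (fun i => b (i + 1)) x

lemma IsJet.hasDerivAt_jetMul {j : ℕ} : ∀ {a b : ℕ → ℝ → ℝ}, IsJet (j + 1) a → IsJet (j + 1) b →
    ∀ x, HasDerivAt (jetMul j a b) (jetMul (j + 1) a b x) x := by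
  induction j with
  | zero =>
    intro a b ha hb x
    exact (ha 0 one_pos x).mul (hb 0 one_pos x)
  | succ j ih =>
    intro a b ha hb x
    exact (ih ha.shift (hb.mono (by omega)) x).add (ih (ha.mono (by omega)) hb.shift x)

lemma IsJet.mul {s : ℕ} {a b : ℕ → ℝ → ℝ} (ha : IsJet s a) (hb : IsJet s b) :
    IsJet s fun j => jetMul j a b := fun _ hj =>
  IsJet.hasDerivAt_jetMul (ha.mono (by omega)) (hb.mono (by omega))

/-- The recursion doubles the number of products in each step, without collecting binomial
coefficients; hence `2 ^ j`. -/
lemma abs_jetMul_le {j : ℕ} {x A B : ℝ} : ∀ {a b : ℕ → ℝ → ℝ}, (∀ i ≤ j, |a i x| ≤ A) →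
    (∀ i ≤ j, |b i x| ≤ B) → |jetMul j a b x| ≤ 2 ^ j * (A * B) := by
  induction j with
  | zero =>
    intro a b ha hb
    rw [jetMul, abs_mul, pow_zero, one_mul]
    exact mul_le_mul (ha 0 le_rfl) (hb 0 le_rfl) (abs_nonneg _) ((abs_nonneg _).trans (ha 0 le_rfl))
  | succ j ih =>
    intro a b ha hb
    have h1 := ih (a := fun i => a (i + 1)) (b := b) (fun i hi => ha (i + 1) (by omega))
      (fun i hi => hb i (by omega))
    have h2 := ih (a := a) (b := fun i => b (i + 1)) (fun i hi => ha i (by omega))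
      (fun i hi => hb (i + 1) (by omega))
    refine (abs_add_le _ _).trans ((add_le_add h1 h2).trans (le_of_eq ?_))
    ring

/-! ### Integration in Gaussian weighted `L²` spaces -/

/-- By Cauchy–Schwarz, `f(u)²` is at most `|u|` times the integral of `f'²` between `0` and `u`,
where the Gaussian weight is at least `exp(-c u²)`. -/
lemma sq_le_of_hasDerivAt {f f' : ℝ → ℝ} (h : ∀ x, HasDerivAt f (f' x) x) (h0 : f 0 = 0) {c : ℝ}
    (hc : 0 ≤ c) (hi : Integrable fun t => f' t ^ 2 * Real.exp (-c * t ^ 2)) (u : ℝ) :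
    f u ^ 2 ≤ |u| * Real.exp (c * u ^ 2) * ∫ t, f' t ^ 2 * Real.exp (-c * t ^ 2) := by
  have hm : Measurable f' := by
    have : f' = deriv f := funext fun x => (h x).deriv.symm
    rw [this]; exact measurable_deriv f
  have habs : ∀ t ∈ Set.uIoc 0 u, t ^ 2 ≤ u ^ 2 := fun t ht => by
    rcases Set.mem_uIoc.1 ht with h | h <;> nlinarith [h.1, h.2]
  have hle : ∀ t ∈ Set.uIoc 0 u,
      f' t ^ 2 ≤ Real.exp (c * u ^ 2) * (f' t ^ 2 * Real.exp (-c * t ^ 2)) := fun t ht => by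
    rw [mul_left_comm, ← Real.exp_add]
    refine le_mul_of_one_le_right (sq_nonneg _) (Real.one_le_exp ?_)
    nlinarith [habs t ht]
  have hsq : IntegrableOn (fun t => f' t ^ 2) (Set.uIoc 0 u) :=
    (hi.const_mul (Real.exp (c * u ^ 2))).integrableOn.mono' (hm.pow_const 2).aestronglyMeasurable
      ((ae_restrict_iff' measurableSet_uIoc).2 (Eventually.of_forall fun t ht => by
        rw [Real.norm_of_nonneg (sq_nonneg _)]; exact hle t ht))
  have hconst : ∀ C : ℝ, IntegrableOn (fun _ : ℝ => C) (Set.uIoc 0 u) := fun C =>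
    integrableOn_const (by simp [Set.uIoc])
  have hone : IntegrableOn f' (Set.uIoc 0 u) :=
    ((hconst 1).add hsq).mono' hm.aestronglyMeasurable (Eventually.of_forall fun t => by
      simp only [Real.norm_eq_abs, Pi.add_apply]
      nlinarith [sq_nonneg (|f' t| - 1), sq_abs (f' t)])
  have hvol : volume.real (Set.uIoc 0 u) = |u| := by
    rw [measureReal_def, Set.uIoc, Real.volume_Ioc, max_sub_min_eq_abs, sub_zero]
    simp
  have hf : f u ^ 2 = (∫ t in Set.uIoc 0 u, f' t) ^ 2 := by
    have h1 := intervalIntegral.integral_eq_sub_of_hasDerivAt (a := 0) (b := u)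
      (fun x _ => h x) (intervalIntegrable_iff.2 hone)
    rw [h0, sub_zero] at h1
    rw [← sq_abs, ← h1, intervalIntegral.abs_intervalIntegral_eq, sq_abs]
  -- Cauchy–Schwarz against the constant `1`: the nonnegative quadratic `x ↦ ∫ (x f' - 1)²` has
  -- nonpositive discriminant.
  have hdisc : (∫ t in Set.uIoc 0 u, f' t) ^ 2 ≤ |u| * ∫ t in Set.uIoc 0 u, f' t ^ 2 := by
    have hq : ∀ x : ℝ, 0 ≤ (∫ t in Set.uIoc 0 u, f' t ^ 2) * (x * x) +
        (-2 * ∫ t in Set.uIoc 0 u, f' t) * x + |u| := by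
      intro x
      have h1 : ∫ t in Set.uIoc 0 u, (x * f' t - 1) ^ 2 =
          (∫ t in Set.uIoc 0 u, f' t ^ 2) * (x * x) +
          (-2 * ∫ t in Set.uIoc 0 u, f' t) * x + |u| := by
        have h2 : ∀ t, (x * f' t - 1) ^ 2 = (x * x) * f' t ^ 2 + (-2 * x) * f' t + 1 :=
          fun t => by ring
        simp only [h2]
        have h3 : IntegrableOn (fun t => (x * x) * f' t ^ 2 + (-2 * x) * f' t) (Set.uIoc 0 u) :=
          (hsq.const_mul _).add (hone.const_mul _)
        rw [integral_add h3 (hconst 1),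
          integral_add (hsq.const_mul _) (hone.const_mul _), integral_const_mul,
          integral_const_mul, setIntegral_const, hvol]
        simp only [smul_eq_mul]
        ring
      rw [← h1]
      exact integral_nonneg fun t => sq_nonneg _
    have := discrim_le_zero hq
    rw [discrim] at this
    nlinarith
  have hsqle : ∫ t in Set.uIoc 0 u, f' t ^ 2 ≤
      Real.exp (c * u ^ 2) * ∫ t, f' t ^ 2 * Real.exp (-c * t ^ 2) := by
    rw [← integral_const_mul]
    refine (setIntegral_mono_on hsq (hi.const_mul _).integrableOn measurableSet_uIoc hle).trans ?_
    exact setIntegral_le_integral (hi.const_mul _) (Eventually.of_forall fun t => by positivity)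
  rw [hf, mul_assoc]
  exact hdisc.trans (mul_le_mul_of_nonneg_left hsqle (abs_nonneg _))

/-- Integration from `0` is bounded between Gaussian weighted spaces once the weight is allowed to
decay slightly faster: the gap `c' - c` absorbs the factor `|u|` of the pointwise bound. -/
lemma exists_integral_sq_le_of_hasDerivAt {c c' : ℝ} (hc : 0 ≤ c) (hcc : c < c') :
    ∃ C, 0 ≤ C ∧ ∀ {f f' : ℝ → ℝ}, (∀ x, HasDerivAt f (f' x) x) → f 0 = 0 →
      Integrable (fun t => f' t ^ 2 * Real.exp (-c * t ^ 2)) →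
      Integrable (fun t => f t ^ 2 * Real.exp (-c' * t ^ 2)) ∧
      ∫ t, f t ^ 2 * Real.exp (-c' * t ^ 2) ≤ C * ∫ t, f' t ^ 2 * Real.exp (-c * t ^ 2) := by
  have hw : Integrable fun u : ℝ => |u| * Real.exp (-(c' - c) * u ^ 2) := by
    have := (integrable_polynomial_mul_exp Polynomial.X (sub_pos.2 hcc)).abs
    refine this.congr (Eventually.of_forall fun u => ?_)
    simp [abs_mul]
  refine ⟨∫ u, |u| * Real.exp (-(c' - c) * u ^ 2), integral_nonneg fun u => by positivity,
    fun {f f'} h h0 hi => ?_⟩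
  set I := ∫ t, f' t ^ 2 * Real.exp (-c * t ^ 2)
  have hle : ∀ u, f u ^ 2 * Real.exp (-c' * u ^ 2) ≤
      |u| * Real.exp (-(c' - c) * u ^ 2) * I := fun u => by
    have h1 := mul_le_mul_of_nonneg_right (sq_le_of_hasDerivAt h h0 hc hi u)
      (Real.exp_pos (-c' * u ^ 2)).le
    refine h1.trans (le_of_eq ?_)
    have h2 : Real.exp (-(c' - c) * u ^ 2) = Real.exp (c * u ^ 2) * Real.exp (-c' * u ^ 2) := by
      rw [← Real.exp_add]; congr 1; ring
    rw [h2]; ring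
  have hcont : Continuous f := continuous_iff_continuousAt.2 fun x => (h x).continuousAt
  have hint : Integrable fun t => f t ^ 2 * Real.exp (-c' * t ^ 2) :=
    (hw.mul_const I).mono' (by fun_prop) (Eventually.of_forall fun u => by
      rw [Real.norm_of_nonneg (by positivity)]; exact hle u)
  refine ⟨hint, ?_⟩
  rw [← integral_mul_const]
  exact integral_mono hint (hw.mul_const I) hle

lemma integrable_sq_mul_exp_of_le {f : ℝ → ℝ} {c c' : ℝ} (hcc : c ≤ c')
    (hi : Integrable fun t => f t ^ 2 * Real.exp (-c * t ^ 2)) :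
    Integrable (fun t => f t ^ 2 * Real.exp (-c' * t ^ 2)) ∧
      ∫ t, f t ^ 2 * Real.exp (-c' * t ^ 2) ≤ ∫ t, f t ^ 2 * Real.exp (-c * t ^ 2) := by
  have heq : ∀ t, f t ^ 2 * Real.exp (-c' * t ^ 2) =
      Real.exp (-(c' - c) * t ^ 2) * (f t ^ 2 * Real.exp (-c * t ^ 2)) := fun t => by
    rw [mul_left_comm, ← Real.exp_add]; congr 2; ring
  have hone : ∀ t : ℝ, Real.exp (-(c' - c) * t ^ 2) ≤ 1 := fun t =>
    Real.exp_le_one_iff.2 (by nlinarith [sq_nonneg t])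
  have hint : Integrable fun t => f t ^ 2 * Real.exp (-c' * t ^ 2) := by
    simp only [heq]
    refine hi.bdd_mul (c := 1) (by fun_prop) (Eventually.of_forall fun t => ?_)
    rw [Real.norm_of_nonneg (Real.exp_pos _).le]
    exact hone t
  refine ⟨hint, integral_mono hint hi fun t => ?_⟩
  simp only [heq]
  exact mul_le_of_le_one_left (by positivity) (hone t)

/-- Control of the highest derivative controls all lower ones that vanish at `0`. Each integration
needs a strictly faster decay, so the induction uses the interval up to the midpoint for the shifted
jet and the rest for the last integration. -/
lemma exists_integral_sq_le_of_isJet (s : ℕ) : ∀ {c c' : ℝ}, 0 ≤ c → c < c' →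
    ∃ C, 0 ≤ C ∧ ∀ {a : ℕ → ℝ → ℝ}, IsJet s a → (∀ i < s, a i 0 = 0) →
      Integrable (fun t => a s t ^ 2 * Real.exp (-c * t ^ 2)) → ∀ i ≤ s,
      Integrable (fun t => a i t ^ 2 * Real.exp (-c' * t ^ 2)) ∧
      ∫ t, a i t ^ 2 * Real.exp (-c' * t ^ 2) ≤ C * ∫ t, a s t ^ 2 * Real.exp (-c * t ^ 2) := by
  induction s with
  | zero =>
    intro c c' hc hcc
    refine ⟨1, zero_le_one, fun {a} _ _ hi i hi0 => ?_⟩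
    obtain rfl : i = 0 := by omega
    rw [one_mul]
    exact integrable_sq_mul_exp_of_le hcc.le hi
  | succ s ih =>
    intro c c' hc hcc
    obtain ⟨C₁, hC₁, h₁⟩ := ih hc (left_lt_add_div_two.2 hcc)
    obtain ⟨C₂, hC₂, h₂⟩ := exists_integral_sq_le_of_hasDerivAt
      (c := (c + c') / 2) (c' := c') (by linarith) (add_div_two_lt_right.2 hcc)
    refine ⟨(1 + C₂) * C₁, by positivity, fun {a} ha h0 hi i his => ?_⟩
    have hI : 0 ≤ ∫ t, a (s + 1) t ^ 2 * Real.exp (-c * t ^ 2) :=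
      integral_nonneg fun t => by positivity
    have hshift := h₁ ha.shift (fun i hi => h0 (i + 1) (by omega)) hi
    cases i with
    | zero =>
      obtain ⟨h3, h4⟩ := hshift 0 (Nat.zero_le _)
      obtain ⟨h5, h6⟩ := h₂ (ha 0 (by omega)) (h0 0 (by omega)) h3
      refine ⟨h5, h6.trans ?_⟩
      nlinarith [mul_le_mul_of_nonneg_left h4 hC₂, mul_nonneg hC₁ hI]
    | succ i =>
      obtain ⟨h3, h4⟩ := hshift i (by omega)
      obtain ⟨h5, h6⟩ := integrable_sq_mul_exp_of_le (add_div_two_lt_right.2 hcc).le h3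
      refine ⟨h5, (h6.trans h4).trans ?_⟩
      nlinarith [mul_nonneg hC₂ (mul_nonneg hC₁ hI)]

lemma exists_polynomial_iterate_derivative_eq (s : ℕ) : ∀ (q : Polynomial ℝ) (v : ℕ → ℝ),
    ∃ p : Polynomial ℝ, Polynomial.derivative^[s] p = q ∧
      ∀ i < s, (Polynomial.derivative^[i] p).eval 0 = v i := by
  induction s with
  | zero => exact fun q v => ⟨q, rfl, by simp⟩
  | succ s ih =>
    intro q v
    obtain ⟨Q, hQ⟩ : ∃ Q : Polynomial ℝ, Polynomial.derivative Q = q := by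
      induction q using Polynomial.induction_on' with
      | add p q hp hq =>
        obtain ⟨P, rfl⟩ := hp
        obtain ⟨Q, rfl⟩ := hq
        exact ⟨P + Q, by simp⟩
      | monomial n a =>
        refine ⟨Polynomial.monomial (n + 1) (a / (n + 1)), ?_⟩
        rw [Polynomial.derivative_monomial]
        congr 1
        push_cast
        field_simp
    obtain ⟨p, hp, hpv⟩ := ih (Q + Polynomial.C (v s - Q.eval 0)) v
    refine ⟨p, ?_, fun i hi => ?_⟩
    · rw [Function.iterate_succ_apply', hp]
      simp [hQ]
    · rcases Nat.lt_succ_iff_lt_or_eq.1 hi with h | rfl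
      · exact hpv i h
      · rw [hp]; simp

/-! ### Approximation in weighted Sobolev spaces -/

lemma sq_jetMul_le {s j : ℕ} (hj : j ≤ s) (a b : ℕ → ℝ → ℝ) (x : ℝ) :
    jetMul j a b x ^ 2 ≤ 4 ^ s * ((∑ i ∈ Finset.range (s + 1), a i x ^ 2) *
      ∑ i ∈ Finset.range (s + 1), b i x ^ 2) := by
  have hle : ∀ (c : ℕ → ℝ → ℝ), ∀ i ≤ j,
      |c i x| ≤ Real.sqrt (∑ i ∈ Finset.range (s + 1), c i x ^ 2) := fun c i hi => by
    refine Real.abs_le_sqrt ?_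
    exact Finset.single_le_sum (f := fun i => c i x ^ 2) (fun _ _ => sq_nonneg _)
      (Finset.mem_range.2 (by omega))
  have h1 := abs_jetMul_le (hle a) (hle b)
  have h2 : ∀ c : ℕ → ℝ → ℝ, 0 ≤ ∑ i ∈ Finset.range (s + 1), c i x ^ 2 := fun c =>
    Finset.sum_nonneg fun _ _ => sq_nonneg _
  have h3 := pow_le_pow_left₀ (abs_nonneg _) h1 2
  rw [sq_abs, mul_pow, mul_pow, Real.sq_sqrt (h2 a), Real.sq_sqrt (h2 b), ← pow_mul, mul_comm j,
    pow_mul] at h3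
  refine h3.trans (mul_le_mul_of_nonneg_right ?_ (mul_nonneg (h2 a) (h2 b)))
  norm_num
  exact pow_le_pow_right₀ (by norm_num) hj

lemma contDiff_gaussian : ContDiff ℝ (⊤ : ℕ∞) fun u : ℝ => Real.exp (-u ^ 2 / 4) := by
  fun_prop

lemma exists_iteratedDeriv_gaussian_eq (j : ℕ) : ∃ P : Polynomial ℝ, ∀ u : ℝ,
    iteratedDeriv j (fun u : ℝ => Real.exp (-u ^ 2 / 4)) u = P.eval u * Real.exp (-u ^ 2 / 4) := by
  induction j with
  | zero => exact ⟨1, fun u => by simp⟩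
  | succ j ih =>
    obtain ⟨P, hP⟩ := ih
    refine ⟨Polynomial.derivative P - Polynomial.C (1 / 2) * (Polynomial.X * P), fun u => ?_⟩
    rw [iteratedDeriv_succ, funext hP]
    have h1 : HasDerivAt (fun u : ℝ => -u ^ 2 / 4) (-u / 2) u := by
      have := ((hasDerivAt_pow 2 u).neg).div_const 4
      refine this.congr_deriv ?_
      norm_num
      ring
    rw [((P.hasDerivAt u).fun_mul h1.exp).deriv]
    simp
    ring

/-- The squared derivatives are polynomials times `exp(-u²/2)`, and the weight is dominated by a
polynomial. Giving up `1/8` of the exponent absorbs all polynomial factors and leaves `3/8`. -/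
lemma exists_sum_sq_gaussian_le (s : ℕ) (η : ℝ) : ∃ C, 0 ≤ C ∧ ∀ u : ℝ,
    (∑ i ∈ Finset.range (s + 1), iteratedDeriv i (fun u : ℝ => Real.exp (-u ^ 2 / 4)) u ^ 2) *
      (1 + u ^ 2) ^ η ≤ C * Real.exp (-(3 / 8) * u ^ 2) := by
  choose P hP using exists_iteratedDeriv_gaussian_eq
  obtain ⟨C, hC, h⟩ := exists_abs_eval_le_exp
    ((∑ i ∈ Finset.range (s + 1), P i ^ 2) * (1 + Polynomial.X ^ 2) ^ ⌈η⌉₊)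
    (by norm_num : (0 : ℝ) < 1 / 8)
  refine ⟨C, hC, fun u => ?_⟩
  have h1 : (1 + u ^ 2) ^ η ≤ (1 + u ^ 2) ^ ⌈η⌉₊ := by
    exact (Real.rpow_le_rpow_of_exponent_le (le_add_of_nonneg_right (sq_nonneg u))
      (Nat.le_ceil η)).trans_eq (Real.rpow_natCast _ _)
  have h2 := (le_abs_self _).trans (h u)
  simp only [Polynomial.eval_mul, Polynomial.eval_pow, Polynomial.eval_add, Polynomial.eval_one,
    Polynomial.eval_X, Polynomial.eval_finsetSum] at h2
  have h3 : Real.exp (-u ^ 2 / 4) ^ 2 = Real.exp (-(1 / 2) * u ^ 2) := by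
    rw [← Real.exp_nat_mul]; congr 1; push_cast; ring
  simp only [hP, mul_pow, h3, ← Finset.sum_mul]
  calc (∑ i ∈ Finset.range (s + 1), (P i).eval u ^ 2) * Real.exp (-(1 / 2) * u ^ 2) *
        (1 + u ^ 2) ^ η
      ≤ (∑ i ∈ Finset.range (s + 1), (P i).eval u ^ 2) * Real.exp (-(1 / 2) * u ^ 2) *
        (1 + u ^ 2) ^ ⌈η⌉₊ := by
        refine mul_le_mul_of_nonneg_left h1 (mul_nonneg (Finset.sum_nonneg fun _ _ => sq_nonneg _)
          (Real.exp_pos _).le)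
    _ = ((∑ i ∈ Finset.range (s + 1), (P i).eval u ^ 2) * (1 + u ^ 2) ^ ⌈η⌉₊) *
        Real.exp (-(1 / 2) * u ^ 2) := by ring
    _ ≤ (C * Real.exp (1 / 8 * u ^ 2)) * Real.exp (-(1 / 2) * u ^ 2) :=
        mul_le_mul_of_nonneg_right h2 (Real.exp_pos _).le
    _ = C * Real.exp (-(3 / 8) * u ^ 2) := by
        rw [mul_assoc, ← Real.exp_add]; congr 2; ring

lemma HasCompactSupport.exists_abs_iteratedDeriv_le {f : ℝ → ℝ} (hf : HasCompactSupport f)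
    (h : ContDiff ℝ (⊤ : ℕ∞) f) (j : ℕ) : ∃ C, ∀ u, |iteratedDeriv j f u| ≤ C := by
  have hc : Continuous (iteratedDeriv j f) :=
    h.continuous_iteratedDeriv j (by exact_mod_cast le_top)
  have hs : HasCompactSupport (iteratedDeriv j f) := by
    induction j with
    | zero => simpa using hf
    | succ j ih =>
      rw [iteratedDeriv_succ]
      exact (ih (h.continuous_iteratedDeriv j (by exact_mod_cast le_top))).deriv
  exact hc.bounded_above_of_compact_support hs

/-- Dilating one fixed bump by `R ≥ 1` multiplies its `j`-th derivative by `R⁻¹ ^ j ≤ 1`, so the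
constant does not depend on `R`. -/
lemma exists_cutoff (s : ℕ) : ∃ C, 0 ≤ C ∧ ∀ R : ℝ, 1 ≤ R → ∃ φ : ℝ → ℝ,
    ContDiff ℝ (⊤ : ℕ∞) φ ∧ HasCompactSupport φ ∧
    ∀ u, (∑ j ∈ Finset.range (s + 1), iteratedDeriv j (fun u => 1 - φ u) u ^ 2) ≤
      {u : ℝ | R ≤ |u|}.indicator (fun _ => C) u := by
  let χ : ContDiffBump (0 : ℝ) := ⟨1, 2, one_pos, one_lt_two⟩
  have hχ : ContDiff ℝ (⊤ : ℕ∞) χ := χ.contDiff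
  let κ : ℝ → ℝ := fun u => 1 - χ u
  have hκ : ContDiff ℝ (⊤ : ℕ∞) κ := contDiff_const.sub hχ
  have hb : ∀ j, ∃ C, ∀ u, |iteratedDeriv j κ u| ≤ C := by
    intro j
    rcases Nat.eq_zero_or_pos j with rfl | hj
    · refine ⟨1, fun u => ?_⟩
      rw [iteratedDeriv_zero, abs_le]
      constructor <;> simp only [κ] <;> linarith [χ.nonneg (x := u), χ.le_one (x := u)]
    · obtain ⟨C, hC⟩ := HasCompactSupport.exists_abs_iteratedDeriv_le χ.hasCompactSupport hχ j
      refine ⟨C, fun u => ?_⟩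
      rw [iteratedDeriv_const_sub hj, iteratedDeriv_neg, abs_neg]
      exact hC u
  choose C hC using hb
  refine ⟨∑ j ∈ Finset.range (s + 1), C j ^ 2, Finset.sum_nonneg fun _ _ => sq_nonneg _,
    fun R hR => ⟨fun u => χ (R⁻¹ * u), hχ.comp (contDiff_const.mul contDiff_id), ?_,
      fun u => ?_⟩⟩
  · have h0 : R⁻¹ ≠ 0 := by positivity
    exact χ.hasCompactSupport.comp_homeomorph (Homeomorph.mulLeft₀ R⁻¹ h0)
  · have hR' : R⁻¹ ≤ 1 := inv_le_one_of_one_le₀ hR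
    have hd : ∀ j, iteratedDeriv j (fun u => 1 - χ (R⁻¹ * u)) u =
        R⁻¹ ^ j * iteratedDeriv j κ (R⁻¹ * u) := fun j => by
      have := iteratedDeriv_comp_const_mul (n := j) (f := κ) (hκ.of_le (by exact_mod_cast le_top))
        R⁻¹
      exact congrFun this u
    by_cases hu : R ≤ |u|
    · rw [indicator_of_mem (by exact hu)]
      refine Finset.sum_le_sum fun j _ => ?_
      rw [hd, ← sq_abs]
      refine pow_le_pow_left₀ (abs_nonneg _) ?_ 2
      rw [abs_mul, abs_of_nonneg (by positivity)]
      exact (mul_le_of_le_one_left (abs_nonneg _) (pow_le_one₀ (by positivity) hR')).trans (hC j _)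
    · rw [indicator_of_notMem (by exact hu)]
      refine (Finset.sum_eq_zero fun j _ => ?_).le
      have hev : κ =ᶠ[𝓝 (R⁻¹ * u)] fun _ => 0 := by
        have hmem : R⁻¹ * u ∈ Metric.ball (0 : ℝ) 1 := by
          rw [Metric.mem_ball, dist_zero_right, norm_mul, Real.norm_eq_abs, Real.norm_eq_abs,
            abs_of_nonneg (by positivity), inv_mul_lt_iff₀ (by positivity), mul_one]
          exact not_le.1 hu
        filter_upwards [Metric.isOpen_ball.mem_nhds hmem] with v hv
        simp only [κ]
        rw [χ.one_of_mem_closedBall (Metric.ball_subset_closedBall hv), sub_self]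
      rw [hd, hev.iteratedDeriv_eq j]
      simp

lemma integrable_and_integral_le_of_le {f g : ℝ → ℝ} (hf : Measurable f) (h0 : ∀ x, 0 ≤ f x)
    (hg : Integrable g) (h : ∀ x, f x ≤ g x) : Integrable f ∧ ∫ x, f x ≤ ∫ x, g x := by
  have hi : Integrable f := hg.mono' hf.aestronglyMeasurable (Eventually.of_forall fun x => by
    rw [Real.norm_of_nonneg (h0 x)]; exact h x)
  exact ⟨hi, integral_mono hi hg h⟩

/-- By the Leibniz rule the cut-off part and its derivatives live on `|u| ≥ n` and are dominated
there by a fixed integrable function, whose tail integrals tend to zero. -/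
lemma exists_cutoff_approx {s : ℕ} (hs : 1 ≤ s) {η : ℝ} {a : ℕ → ℝ → ℝ} (ha : IsJet s a)
    (hai : ∀ i ≤ s, Integrable fun u => a i u ^ 2 * (1 + u ^ 2) ^ η) {e : ℝ} (he : 0 < e) :
    ∃ φ : ℝ → ℝ, ContDiff ℝ (⊤ : ℕ∞) φ ∧ HasCompactSupport φ ∧ ∀ j ≤ s,
      Integrable (fun u => jetMul j a (fun i => iteratedDeriv i fun u => 1 - φ u) u ^ 2 *
        (1 + u ^ 2) ^ η) ∧
      ∫ u, jetMul j a (fun i => iteratedDeriv i fun u => 1 - φ u) u ^ 2 * (1 + u ^ 2) ^ η ≤ e := by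
  obtain ⟨C, hC, hcut⟩ := exists_cutoff s
  let g : ℝ → ℝ := fun u =>
    4 ^ s * C * ∑ i ∈ Finset.range (s + 1), a i u ^ 2 * (1 + u ^ 2) ^ η
  have hg : Integrable g := (integrable_finsetSum _ fun i hi =>
    hai i (Nat.lt_succ_iff.1 (Finset.mem_range.1 hi))).const_mul _
  have hmeas : ∀ n : ℕ, MeasurableSet {u : ℝ | (n : ℝ) ≤ |u|} := fun n =>
    measurableSet_le measurable_const (by fun_prop)
  have hlim : Tendsto (fun n : ℕ => ∫ u in {u : ℝ | (n : ℝ) ≤ |u|}, g u) atTop (𝓝 0) := by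
    have := tendsto_setIntegral_of_antitone (f := g) hmeas
      (fun m n hmn u (hu : (n : ℝ) ≤ |u|) => (Nat.cast_le.2 hmn).trans hu)
      ⟨0, hg.integrableOn⟩
    have hempty : ⋂ n : ℕ, {u : ℝ | (n : ℝ) ≤ |u|} = ∅ := by
      refine eq_empty_of_forall_notMem fun u hu => ?_
      obtain ⟨n, hn⟩ := exists_nat_gt |u|
      exact absurd (mem_iInter.1 hu n) (not_le.2 hn)
    rwa [hempty, setIntegral_empty] at this
  obtain ⟨n, hn, hn1⟩ := ((hlim.eventually (gt_mem_nhds he)).and (eventually_ge_atTop 1)).exists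
  obtain ⟨φ, hφ, hφc, hφb⟩ := hcut n (by exact_mod_cast hn1)
  refine ⟨φ, hφ, hφc, fun j hj => ?_⟩
  have hκ : IsJet s fun i => iteratedDeriv i fun u => 1 - φ u :=
    isJet_of_contDiff (contDiff_const.sub hφ)
  have hle : ∀ u, jetMul j a (fun i => iteratedDeriv i fun u => 1 - φ u) u ^ 2 * (1 + u ^ 2) ^ η ≤
      {u : ℝ | (n : ℝ) ≤ |u|}.indicator g u := fun u => by
    have hw : (0 : ℝ) ≤ (1 + u ^ 2) ^ η := by positivity
    have hsum : 0 ≤ ∑ i ∈ Finset.range (s + 1), a i u ^ 2 :=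
      Finset.sum_nonneg fun _ _ => sq_nonneg _
    have h1 := sq_jetMul_le hj a (fun i => iteratedDeriv i fun u => 1 - φ u) u
    have h2 := h1.trans (mul_le_mul_of_nonneg_left (mul_le_mul_of_nonneg_left (hφb u) hsum)
      (by positivity))
    refine (mul_le_mul_of_nonneg_right h2 hw).trans (le_of_eq ?_)
    by_cases hu : u ∈ {u : ℝ | (n : ℝ) ≤ |u|}
    · rw [indicator_of_mem hu, indicator_of_mem hu]
      simp only [g, ← Finset.sum_mul]
      ring
    · rw [indicator_of_notMem hu, indicator_of_notMem hu]
      ring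
  obtain ⟨h3, h4⟩ := integrable_and_integral_le_of_le
    ((((ha.mul hκ).measurable hs hj).pow_const 2).mul (by fun_prop))
    (fun u => mul_nonneg (sq_nonneg _) (by positivity)) (hg.indicator (hmeas n)) hle
  rw [integral_indicator (hmeas n)] at h4
  exact ⟨h3, h4.trans hn.le⟩

/-- After cutting off, the function is divided by the Gaussian. The `s`-th derivative of the
quotient is approximated by a polynomial in a Gaussian weighted `L²` space, and this polynomial is
integrated `s` times with matching initial values at `0`. Multiplying back by the Gaussian controls
all derivatives at once. The remainder `r` is the cut-off part plus the Gaussian times the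
polynomial error. -/
theorem exists_polynomial_gaussian_approx {s : ℕ} (hs : 1 ≤ s) {η : ℝ} (hη : 0 ≤ η)
    {a : ℕ → ℝ → ℝ} (ha : IsJet s a)
    (hai : ∀ i ≤ s, Integrable fun u => a i u ^ 2 * (1 + u ^ 2) ^ η) {e : ℝ} (he : 0 < e) :
    ∃ (P : Polynomial ℝ) (r : ℕ → ℝ → ℝ), IsJet s r ∧
      (∀ u, a 0 u - r 0 u = P.eval u * Real.exp (-u ^ 2 / 4)) ∧ ∀ j ≤ s,
      Integrable (fun u => r j u ^ 2 * (1 + u ^ 2) ^ η) ∧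
      ∫ u, r j u ^ 2 * (1 + u ^ 2) ^ η ≤ e := by
  obtain ⟨φ, hφ, hφc, hφa⟩ := exists_cutoff_approx hs ha hai (e := e / 4) (by positivity)
  have hκ : IsJet s fun i => iteratedDeriv i fun u => 1 - φ u :=
    isJet_of_contDiff (contDiff_const.sub hφ)
  -- With this factor, `a 0 * φ` equals `b 0` times the Gaussian. The compact support of `φ` keeps
  -- the derivatives of `Φ` bounded despite the growing exponential.
  let Φ : ℝ → ℝ := fun u => φ u * Real.exp (u ^ 2 / 4)
  have hΦ : ContDiff ℝ (⊤ : ℕ∞) Φ := hφ.mul (by fun_prop)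
  have hΦc : HasCompactSupport Φ := hφc.mul_right
  let b : ℕ → ℝ → ℝ := fun j => jetMul j a fun i => iteratedDeriv i Φ
  have hb : IsJet s b := ha.mul (isJet_of_contDiff hΦ)
  choose CΦ hCΦ using HasCompactSupport.exists_abs_iteratedDeriv_le hΦc hΦ
  have hL2 : MemLp (fun u => b s u * Real.exp (-(1 / 8) * u ^ 2)) 2 := by
    have hm : Measurable fun u => b s u * Real.exp (-(1 / 8) * u ^ 2) :=
      (hb.measurable hs le_rfl).mul (by fun_prop)
    rw [memLp_two_iff_integrable_sq hm.aestronglyMeasurable]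
    refine (integrable_and_integral_le_of_le (hm.pow_const 2) (fun _ => sq_nonneg _)
      (((integrable_finsetSum (Finset.range (s + 1)) fun i hi =>
        hai i (Nat.lt_succ_iff.1 (Finset.mem_range.1 hi))).const_mul
          (4 ^ s * ∑ i ∈ Finset.range (s + 1), CΦ i ^ 2))) fun u => ?_).1
    have h1 := sq_jetMul_le le_rfl a (fun i => iteratedDeriv i Φ) u (s := s)
    have h2 : ∑ i ∈ Finset.range (s + 1), iteratedDeriv i Φ u ^ 2 ≤
        ∑ i ∈ Finset.range (s + 1), CΦ i ^ 2 := Finset.sum_le_sum fun i _ => by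
      rw [← sq_abs]; exact pow_le_pow_left₀ (abs_nonneg _) (hCΦ i u) 2
    have h3 : ∑ i ∈ Finset.range (s + 1), a i u ^ 2 ≤
        ∑ i ∈ Finset.range (s + 1), a i u ^ 2 * (1 + u ^ 2) ^ η := Finset.sum_le_sum fun i _ =>
      le_mul_of_one_le_right (sq_nonneg _) (one_le_one_add_sq_rpow hη u)
    have h4 : Real.exp (-(1 / 8) * u ^ 2) ^ 2 ≤ 1 :=
      pow_le_one₀ (Real.exp_pos _).le (Real.exp_le_one_iff.2 (by nlinarith [sq_nonneg u]))
    rw [mul_pow]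
    refine (mul_le_of_le_one_right (sq_nonneg _) h4).trans (h1.trans ?_)
    rw [mul_assoc, mul_comm (∑ i ∈ Finset.range (s + 1), CΦ i ^ 2)]
    refine mul_le_mul_of_nonneg_left (mul_le_mul h3 h2 (Finset.sum_nonneg fun _ _ => sq_nonneg _)
      (Finset.sum_nonneg fun _ _ => by positivity)) (by positivity)
  obtain ⟨CG, hCG, hG⟩ := exists_sum_sq_gaussian_le s η
  -- The exponent `1/4` is the square of the weight `exp(-u²/8)` in which the top derivative is
  -- approximated, and `3/8` is what the derivatives of the Gaussian can pay for; the integrations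
  -- fit into the gap.
  obtain ⟨CD, hCD, hD⟩ := exists_integral_sq_le_of_isJet s (c := 1 / 4) (c' := 3 / 8)
    (by norm_num) (by norm_num)
  -- `D` is the total amplification of the error of `q`. The division by `D + 1` below avoids a case
  -- distinction for `D = 0`.
  let D : ℝ := 4 ^ s * CG * ((s + 1 : ℕ) * CD)
  have hD0 : 0 ≤ D := by positivity
  obtain ⟨q, hqi, hq⟩ := exists_polynomial_integral_sq_le (by norm_num : (0 : ℝ) < 1 / 8) hL2
    (e := e / (4 * (D + 1))) (by positivity)
  obtain ⟨p, hp, hp0⟩ := exists_polynomial_iterate_derivative_eq s q fun i => b i 0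
  let ε : ℕ → ℝ → ℝ := fun j u => b j u - (Polynomial.derivative^[j] p).eval u
  have hpj : IsJet s fun j u => (Polynomial.derivative^[j] p).eval u := fun j _ u => by
    simp only [Function.iterate_succ_apply']
    exact (Polynomial.derivative^[j] p).hasDerivAt u
  have hε : IsJet s ε := hb.sub hpj
  have hsq : ∀ u, ε s u ^ 2 * Real.exp (-(1 / 4) * u ^ 2) =
      (b s u * Real.exp (-(1 / 8) * u ^ 2) - q.eval u * Real.exp (-(1 / 8) * u ^ 2)) ^ 2 :=
    fun u => by
      have : Real.exp (-(1 / 4) * u ^ 2) = Real.exp (-(1 / 8) * u ^ 2) ^ 2 := by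
        rw [← Real.exp_nat_mul]; congr 1; push_cast; ring
      simp only [ε, hp, this]
      ring
  have hεD := hD hε (fun i hi => by simp only [ε, hp0 i hi, sub_self]) (by simpa only [hsq] using hqi)
  simp only [hsq] at hεD
  have hGjet : IsJet s fun i => iteratedDeriv i fun u : ℝ => Real.exp (-u ^ 2 / 4) :=
    isJet_of_contDiff contDiff_gaussian
  let r₂ : ℕ → ℝ → ℝ := fun j => jetMul j ε fun i => iteratedDeriv i fun u : ℝ => Real.exp (-u ^ 2 / 4)
  have hr₂ : IsJet s r₂ := hε.mul hGjet
  let r₁ : ℕ → ℝ → ℝ := fun j => jetMul j a fun i => iteratedDeriv i fun u => 1 - φ u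
  have hr₁ : IsJet s r₁ := ha.mul hκ
  have hr₂b : ∀ j ≤ s, Integrable (fun u => r₂ j u ^ 2 * (1 + u ^ 2) ^ η) ∧
      ∫ u, r₂ j u ^ 2 * (1 + u ^ 2) ^ η ≤ e / 4 := by
    intro j hj
    have hint : ∀ i ∈ Finset.range (s + 1),
        Integrable fun u => ε i u ^ 2 * Real.exp (-(3 / 8) * u ^ 2) := fun i hi =>
      (hεD i (Nat.lt_succ_iff.1 (Finset.mem_range.1 hi))).1
    obtain ⟨h1, h2⟩ := integrable_and_integral_le_of_le
      (f := fun u => r₂ j u ^ 2 * (1 + u ^ 2) ^ η)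
      (((hr₂.measurable hs hj).pow_const 2).mul (by fun_prop)) (fun u => by positivity)
      ((integrable_finsetSum (Finset.range (s + 1)) hint).const_mul (4 ^ s * CG)) fun u => by
        have hw : (0 : ℝ) ≤ (1 + u ^ 2) ^ η := by positivity
        refine (mul_le_mul_of_nonneg_right (sq_jetMul_le hj _ _ u) hw).trans ?_
        rw [mul_assoc, mul_assoc, mul_assoc]
        refine mul_le_mul_of_nonneg_left ?_ (by positivity)
        refine (mul_le_mul_of_nonneg_left (hG u)
          (Finset.sum_nonneg fun _ _ => sq_nonneg _)).trans (le_of_eq ?_)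
        rw [← Finset.sum_mul]
        ring
    refine ⟨h1, h2.trans ?_⟩
    rw [integral_const_mul, integral_finsetSum _ hint]
    have h3 : ∑ i ∈ Finset.range (s + 1), ∫ u, ε i u ^ 2 * Real.exp (-(3 / 8) * u ^ 2) ≤
        (s + 1 : ℕ) * (CD * (e / (4 * (D + 1)))) := by
      refine (Finset.sum_le_card_nsmul _ _ (CD * (e / (4 * (D + 1)))) fun i hi => ?_).trans
        (by rw [Finset.card_range, nsmul_eq_mul])
      exact (hεD i (Nat.lt_succ_iff.1 (Finset.mem_range.1 hi))).2.trans
        (mul_le_mul_of_nonneg_left hq hCD)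
    calc _ ≤ 4 ^ s * CG * ((s + 1 : ℕ) * (CD * (e / (4 * (D + 1))))) :=
          mul_le_mul_of_nonneg_left h3 (by positivity)
      _ = D * e / (4 * (D + 1)) := by simp only [D]; ring
      _ ≤ e / 4 := by
          rw [div_le_div_iff₀ (by positivity) (by norm_num)]
          nlinarith
  refine ⟨p, fun j u => r₁ j u + r₂ j u, hr₁.add hr₂, fun u => ?_, fun j hj => ?_⟩
  · simp only [r₁, r₂, jetMul, iteratedDeriv_zero, ε, b, Φ, Function.iterate_zero, id]
    have : Real.exp (u ^ 2 / 4) * Real.exp (-u ^ 2 / 4) = 1 := by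
      rw [← Real.exp_add]; simp [neg_div]
    linear_combination (-(a 0 u * φ u)) * this
  · obtain ⟨h1, h2⟩ := hφa j hj
    obtain ⟨h3, h4⟩ := hr₂b j hj
    obtain ⟨h5, h6⟩ := integrable_and_integral_le_of_le
      (f := fun u => (r₁ j u + r₂ j u) ^ 2 * (1 + u ^ 2) ^ η)
      ((((hr₁.add hr₂).measurable hs hj).pow_const 2).mul (by fun_prop)) (fun u => by positivity)
      ((h1.const_mul 2).add (h3.const_mul 2)) fun u => by
        have hw : (0 : ℝ) ≤ (1 + u ^ 2) ^ η := by positivity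
        simp only [Pi.add_apply, ← mul_assoc, ← add_mul]
        refine mul_le_mul_of_nonneg_right ?_ hw
        nlinarith [sq_nonneg (r₁ j u - r₂ j u)]
    refine ⟨h5, h6.trans ?_⟩
    rw [integral_add' (h1.const_mul 2) (h3.const_mul 2), integral_const_mul, integral_const_mul]
    linarith

/-! ### The sieves approximate the distribution function -/

lemma sieveRoot_coeff {P : Polynomial ℝ} {J : ℕ} (hJ : P.natDegree ≤ J) (u : ℝ) :
    sieveRoot J (fun j => P.coeff j) u = P.eval u * Real.exp (-u ^ 2 / 4) := by
  rw [sieveRoot, ← Finset.sum_mul, Polynomial.eval_eq_sum_range' (Nat.lt_succ_of_le hJ),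
    Finset.sum_range]

lemma IsJet.sobolevEnergy_eq {s : ℕ} {η : ℝ} {c : ℕ → ℝ → ℝ} (hc : IsJet s c)
    (hci : ∀ j ≤ s, Integrable fun u => c j u ^ 2 * (1 + u ^ 2) ^ η) :
    sobolevEnergy s η (c 0) =
      ENNReal.ofReal (∑ j ∈ Finset.range (s + 1), ∫ u, c j u ^ 2 * (1 + u ^ 2) ^ η) := by
  have h0 : ∀ j u, 0 ≤ c j u ^ 2 * (1 + u ^ 2) ^ η := fun j u =>
    mul_nonneg (sq_nonneg _) (by positivity)
  rw [sobolevEnergy, ENNReal.ofReal_sum_of_nonneg fun j _ => integral_nonneg (h0 j)]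
  refine Finset.sum_congr rfl fun j hj => ?_
  have hj' : j ≤ s := Nat.lt_succ_iff.1 (Finset.mem_range.1 hj)
  rw [ofReal_integral_eq_lintegral_ofReal (hci j hj') (Eventually.of_forall (h0 j)),
    hc.iteratedDeriv_eq hj']
  simp only [sq_abs]

lemma IsJet.differentiable {s : ℕ} {c : ℕ → ℝ → ℝ} (hc : IsJet s c) {j : ℕ} (hj : j < s) :
    Differentiable ℝ (iteratedDeriv j (c 0)) := fun u => by
  rw [hc.iteratedDeriv_eq hj.le]
  exact (hc j hj u).differentiableAt

lemma IsJet.const_mul {s : ℕ} {c : ℕ → ℝ → ℝ} (hc : IsJet s c) (k : ℝ) :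
    IsJet s fun j u => k * c j u := fun j hj u => (hc j hj u).const_mul k

lemma sub_sq_le_mul_add_mul {t : ℝ} (ht : 0 < t) (x y : ℝ) :
    |(x - y) ^ 2 - x ^ 2| ≤ t * x ^ 2 + (1 + 1 / t) * y ^ 2 := by
  have h1 : 2 * |x * y| ≤ t * x ^ 2 + 1 / t * y ^ 2 := by
    have h2 : t * x ^ 2 + 1 / t * y ^ 2 - 2 * |x * y| = (t * |x| - |y|) ^ 2 / t := by
      rw [abs_mul]
      field_simp
      rw [← sq_abs x, ← sq_abs y]
      ring
    have h3 : 0 ≤ (t * |x| - |y|) ^ 2 / t := by positivity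
    linarith
  have h4 : (x - y) ^ 2 - x ^ 2 = y ^ 2 - 2 * (x * y) := by ring
  rw [h4, abs_le]
  have h5 := abs_le.1 (le_refl |x * y|)
  constructor <;> nlinarith [sq_nonneg y, h5.1, h5.2]

/-- The approximation `q` of the root density is divided by its `L²` norm. This norm is close to
one, and the norm bound defining the space is strict, so the normalised function stays inside. The
distribution functions differ by at most the `L¹` distance of the densities. -/
theorem exists_mem_distSieve {s : ℕ} (hs : 1 ≤ s) {η M : ℝ} (hη : 0 ≤ η) {F₀ : ℝ → ℝ}
    (hF₀ : F₀ ∈ distSpace s η M) {κ : ℝ} (hκ : 0 < κ) :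
    ∃ J₀, ∀ J ≥ J₀, ∃ F ∈ distSieve s η M J, ∀ u, |F u - F₀ u| ≤ κ := by
  obtain ⟨f, hdiff, hnorm, hd⟩ := hF₀
  have hM : 0 < M := by
    by_contra hM
    rw [ENNReal.ofReal_of_nonpos (not_lt.1 hM)] at hnorm
    exact not_lt_zero hnorm
  rw [weightedSobolevNorm_lt_iff hM.le] at hnorm
  have hf : Differentiable ℝ f := by simpa using hdiff 0 hs
  let a : ℕ → ℝ → ℝ := fun j => iteratedDeriv j f
  have ha : IsJet s a := isJet_iteratedDeriv hdiff
  have ha0 : a 0 = f := iteratedDeriv_zero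
  have hai : ∀ i ≤ s, Integrable fun u => a i u ^ 2 * (1 + u ^ 2) ^ η := fun i hi => by
    simpa only [sq_abs] using (integrable_weighted_of_energy_le hf hnorm.le hi).1
  set En := ∑ j ∈ Finset.range (s + 1), ∫ u, a j u ^ 2 * (1 + u ^ 2) ^ η with hEn
  have hEM : En < M ^ 2 := by
    have := ha.sobolevEnergy_eq hai
    rw [ha0] at this
    rw [this] at hnorm
    exact (ENNReal.ofReal_lt_ofReal_iff (by positivity)).1 hnorm
  have hE1 : 1 ≤ En := by
    have h1 : ∫ u, a 0 u ^ 2 * (1 + u ^ 2) ^ η ≤ En :=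
      Finset.single_le_sum (f := fun j => ∫ u, a j u ^ 2 * (1 + u ^ 2) ^ η)
        (fun j _ => integral_nonneg fun u => mul_nonneg (sq_nonneg _) (by positivity))
        (Finset.mem_range.2 (Nat.succ_pos s))
    refine hd.2.1.symm.le.trans ((integral_mono hd.1 (hai 0 (Nat.zero_le _)) fun u => ?_).trans h1)
    simp only [ha0]
    exact le_mul_of_one_le_right (sq_nonneg _) (one_le_one_add_sq_rpow hη u)
  -- `k` bounds both the `L¹` error of `q²` and the growth of the energy. The conditions give the
  -- final error `2k ≤ κ`, a squared norm `N ≥ 1/2`, and an energy below `M²` after division by `N ≥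
  -- 1 - k`.
  obtain ⟨k, hk, hk1, hk2, hk3⟩ : ∃ k : ℝ, 0 < k ∧ 2 * k ≤ κ ∧ k ≤ 1 / 2 ∧
      En + k < M ^ 2 * (1 - k) := by
    have h0 : 0 < (M ^ 2 - En) / (2 * (1 + M ^ 2)) := div_pos (by linarith) (by positivity)
    refine ⟨min (κ / 2) (min (1 / 2) ((M ^ 2 - En) / (2 * (1 + M ^ 2)))),
      lt_min (by positivity) (lt_min (by norm_num) h0), ?_, ?_, ?_⟩
    · linarith [min_le_left (κ / 2) (min (1 / 2) ((M ^ 2 - En) / (2 * (1 + M ^ 2))))]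
    · exact (min_le_right _ _).trans (min_le_left _ _)
    · have h1 : min (κ / 2) (min (1 / 2) ((M ^ 2 - En) / (2 * (1 + M ^ 2)))) ≤
          (M ^ 2 - En) / (2 * (1 + M ^ 2)) := (min_le_right _ _).trans (min_le_right _ _)
      rw [le_div_iff₀ (by positivity)] at h1
      nlinarith
  have ht : 0 < k / (2 * En) := by positivity
  set t := k / (2 * En) with htdef
  have hpos : 0 < (1 + 1 / t) * (s + 1 : ℕ) := by positivity
  obtain ⟨P, r, hr, hP, hrb⟩ := exists_polynomial_gaussian_approx hs hη ha hai
    (e := k / (2 * ((1 + 1 / t) * (s + 1 : ℕ)))) (by positivity)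
  set e := k / (2 * ((1 + 1 / t) * (s + 1 : ℕ))) with hedef
  -- In Young's inequality, `t` spends `k / 2` on the energy of `a`, and `e` spends `k / 2` on the
  -- `s + 1` remainder terms.
  have he : (1 + 1 / t) * ((s + 1 : ℕ) * e) = k / 2 := by
    rw [hedef]
    field_simp
  have htE : t * En = k / 2 := by rw [htdef]; field_simp
  let q : ℕ → ℝ → ℝ := fun j u => a j u - r j u
  have hq : IsJet s q := ha.sub hr
  have hqb : ∀ j ≤ s, Integrable (fun u => q j u ^ 2 * (1 + u ^ 2) ^ η) ∧
      ∫ u, q j u ^ 2 * (1 + u ^ 2) ^ η ≤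
        (1 + t) * (∫ u, a j u ^ 2 * (1 + u ^ 2) ^ η) + (1 + 1 / t) * e := by
    intro j hj
    obtain ⟨h1, h2⟩ := integrable_and_integral_le_of_le
      (f := fun u => q j u ^ 2 * (1 + u ^ 2) ^ η)
      (((hq.measurable hs hj).pow_const 2).mul (by fun_prop))
      (fun u => mul_nonneg (sq_nonneg _) (by positivity))
      (((hai j hj).const_mul (1 + t)).add ((hrb j hj).1.const_mul (1 + 1 / t))) fun u => by
        have hw : (0 : ℝ) ≤ (1 + u ^ 2) ^ η := by positivity
        simp only [Pi.add_apply, ← mul_assoc, ← add_mul]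
        refine mul_le_mul_of_nonneg_right ?_ hw
        have := (le_abs_self _).trans (sub_sq_le_mul_add_mul ht (a j u) (r j u))
        simp only [q]
        linarith
    refine ⟨h1, h2.trans ?_⟩
    rw [integral_add' ((hai j hj).const_mul (1 + t)) ((hrb j hj).1.const_mul (1 + 1 / t)),
      integral_const_mul, integral_const_mul]
    have := mul_le_mul_of_nonneg_left (hrb j hj).2 (by positivity : 0 ≤ 1 + 1 / t)
    linarith
  have hqE : ∑ j ∈ Finset.range (s + 1), ∫ u, q j u ^ 2 * (1 + u ^ 2) ^ η ≤ En + k := by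
    calc _ ≤ ∑ j ∈ Finset.range (s + 1),
          ((1 + t) * (∫ u, a j u ^ 2 * (1 + u ^ 2) ^ η) + (1 + 1 / t) * e) :=
          Finset.sum_le_sum fun j hj => (hqb j (Nat.lt_succ_iff.1 (Finset.mem_range.1 hj))).2
      _ = (1 + t) * En + (1 + 1 / t) * ((s + 1 : ℕ) * e) := by
          rw [Finset.sum_add_distrib, ← Finset.mul_sum, Finset.sum_const, Finset.card_range,
            nsmul_eq_mul]
          ring
      _ = En + k := by rw [he]; linarith
  have hfsq : Integrable fun u => a 0 u ^ 2 := by rw [ha0]; exact hd.1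
  have hsqw : ∀ {g : ℝ → ℝ}, Measurable g → Integrable (fun u => g u ^ 2 * (1 + u ^ 2) ^ η) →
      Integrable (fun u => g u ^ 2) ∧ ∫ u, g u ^ 2 ≤ ∫ u, g u ^ 2 * (1 + u ^ 2) ^ η :=
    fun hg hgi => integrable_and_integral_le_of_le (hg.pow_const 2) (fun _ => sq_nonneg _) hgi
      fun u => le_mul_of_one_le_right (sq_nonneg _) (one_le_one_add_sq_rpow hη u)
  obtain ⟨hqsq, -⟩ := hsqw (hq.measurable hs (Nat.zero_le _)) (hqb 0 (Nat.zero_le _)).1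
  obtain ⟨hrsq, hrle⟩ := hsqw (hr.measurable hs (Nat.zero_le _)) (hrb 0 (Nat.zero_le _)).1
  have hL1 : Integrable (fun u => |q 0 u ^ 2 - a 0 u ^ 2|) ∧
      ∫ u, |q 0 u ^ 2 - a 0 u ^ 2| ≤ k := by
    obtain ⟨h1, h2⟩ := integrable_and_integral_le_of_le
      (f := fun u => |q 0 u ^ 2 - a 0 u ^ 2|)
      (by
        have h1 := hq.measurable hs (Nat.zero_le _)
        have h2 := ha.measurable hs (Nat.zero_le _)
        exact ((h1.pow_const 2).sub (h2.pow_const 2)).norm)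
      (fun u => abs_nonneg _)
      ((hfsq.const_mul t).add (hrsq.const_mul (1 + 1 / t)))
      (fun u => sub_sq_le_mul_add_mul ht (a 0 u) (r 0 u))
    refine ⟨h1, h2.trans ?_⟩
    rw [integral_add' (hfsq.const_mul t) (hrsq.const_mul (1 + 1 / t)),
      integral_const_mul, integral_const_mul, ha0, hd.2.1]
    have h3 : (1 + 1 / t) * ∫ u, r 0 u ^ 2 ≤ (1 + 1 / t) * ((s + 1 : ℕ) * e) := by
      refine mul_le_mul_of_nonneg_left ((hrle.trans (hrb 0 (Nat.zero_le _)).2).trans ?_)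
        (by positivity)
      refine le_mul_of_one_le_left (by positivity) ?_
      push_cast
      linarith [(Nat.cast_nonneg s : (0 : ℝ) ≤ s)]
    rw [he] at h3
    nlinarith
  set N := ∫ u, q 0 u ^ 2 with hN
  have hN1 : |N - 1| ≤ k := by
    rw [hN, ← hd.2.1, ← ha0, ← integral_sub hqsq hfsq]
    exact abs_integral_le_integral_abs.trans hL1.2
  have hNpos : 0 < N := by linarith [(abs_le.1 hN1).1]
  have hNk : 1 - k ≤ N := by linarith [(abs_le.1 hN1).1]
  let c : ℕ → ℝ → ℝ := fun j u => (Real.sqrt N)⁻¹ * q j u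
  have hc : IsJet s c := hq.const_mul _
  have hcsq : ∀ j u, c j u ^ 2 = N⁻¹ * q j u ^ 2 := fun j u => by
    simp only [c]
    rw [mul_pow, inv_pow, Real.sq_sqrt hNpos.le]
  have hci : ∀ j ≤ s, Integrable fun u => c j u ^ 2 * (1 + u ^ 2) ^ η := fun j hj => by
    simp only [hcsq, mul_assoc]
    exact (hqb j hj).1.const_mul _
  have hcE : sobolevEnergy s η (c 0) < ENNReal.ofReal (M ^ 2) := by
    rw [hc.sobolevEnergy_eq hci]
    refine (ENNReal.ofReal_lt_ofReal_iff (by positivity)).2 ?_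
    simp only [hcsq, mul_assoc, integral_const_mul, ← Finset.mul_sum]
    rw [inv_mul_lt_iff₀ hNpos]
    have : M ^ 2 * (1 - k) ≤ M ^ 2 * N := mul_le_mul_of_nonneg_left hNk (sq_nonneg M)
    linarith
  have hcd : Integrable fun u => c 0 u ^ 2 := by
    simp only [hcsq]; exact hqsq.const_mul _
  have hdens : HasSqDensity (fun u => ∫ t in Iic u, c 0 t ^ 2) (c 0) := by
    refine ⟨hcd, ?_, fun u => rfl⟩
    simp only [hcsq, integral_const_mul]
    rw [← hN, inv_mul_cancel₀ hNpos.ne']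
  refine ⟨P.natDegree, fun J hJ => ⟨fun u => ∫ t in Iic u, c 0 t ^ 2, ⟨⟨c 0,
    fun j hj => hc.differentiable hj, (weightedSobolevNorm_lt_iff hM.le).2 hcE, hdens⟩,
    fun j => (Polynomial.C (Real.sqrt N)⁻¹ * P).coeff j, ?_⟩, fun u => ?_⟩⟩
  · have : sieveRoot J (fun j => (Polynomial.C (Real.sqrt N)⁻¹ * P).coeff j) = c 0 := by
      ext u
      rw [sieveRoot_coeff ((Polynomial.natDegree_C_mul_le _ _).trans hJ), Polynomial.eval_mul,
        Polynomial.eval_C, mul_assoc, ← hP u]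
    rw [this]
    exact hdens
  · have h1 : (∫ t in Iic u, c 0 t ^ 2) - F₀ u = ∫ t in Iic u, (c 0 t ^ 2 - a 0 t ^ 2) := by
      rw [hd.2.2, ← ha0, ← integral_sub hcd.integrableOn hfsq.integrableOn]
    have hint : Integrable fun t => |c 0 t ^ 2 - a 0 t ^ 2| := (hcd.sub hfsq).abs
    simp only [h1]
    refine abs_integral_le_integral_abs.trans
      ((setIntegral_le_integral hint (Eventually.of_forall fun _ => abs_nonneg _)).trans ?_)
    have h2 : ∀ t, |c 0 t ^ 2 - a 0 t ^ 2| ≤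
        |N⁻¹ - 1| * q 0 t ^ 2 + |q 0 t ^ 2 - a 0 t ^ 2| := fun t => by
      have h3 : c 0 t ^ 2 - a 0 t ^ 2 = (N⁻¹ - 1) * q 0 t ^ 2 + (q 0 t ^ 2 - a 0 t ^ 2) := by
        rw [hcsq]; ring
      rw [h3]
      refine (abs_add_le _ _).trans (le_of_eq ?_)
      rw [abs_mul, abs_of_nonneg (sq_nonneg (q 0 t))]
    refine (integral_mono hint ((hqsq.const_mul _).add hL1.1) h2).trans ?_
    rw [integral_add' (hqsq.const_mul _) hL1.1, integral_const_mul, ← hN]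
    have h4 : |N⁻¹ - 1| * N = |N - 1| := by
      conv_lhs => rw [← abs_of_pos hNpos, ← abs_mul]
      rw [abs_of_pos hNpos, sub_mul, inv_mul_cancel₀ hNpos.ne', one_mul, abs_sub_comm]
    rw [h4]
    linarith [hL1.2]

/-! ### Linear combinations in the smoothness classes -/

/-- The functions are `m` times differentiable, and only on `O`; the identity is therefore
differentiated inductively on that open set. -/
lemma iteratedFDeriv_linComb {d : ℕ} {O : Set (E d)} (hO : IsOpen O) {m : ℕ} {h h' : E d → ℝ}
    (hh : ∀ j < m, ∀ x ∈ O, DifferentiableAt ℝ (iteratedFDeriv ℝ j h) x)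
    (hh' : ∀ j < m, ∀ x ∈ O, DifferentiableAt ℝ (iteratedFDeriv ℝ j h') x) (a b : ℝ) {j : ℕ}
    (hj : j ≤ m) : ∀ x ∈ O, iteratedFDeriv ℝ j (fun x => a * h x + b * h' x) x =
      a • iteratedFDeriv ℝ j h x + b • iteratedFDeriv ℝ j h' x := by
  induction j with
  | zero =>
    intro x _
    ext v
    simp
  | succ j ih =>
    intro x hx
    have hev : iteratedFDeriv ℝ j (fun x => a * h x + b * h' x) =ᶠ[𝓝 x]
        fun x => a • iteratedFDeriv ℝ j h x + b • iteratedFDeriv ℝ j h' x := by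
      filter_upwards [hO.mem_nhds hx] with y hy
      exact ih (by omega) y hy
    have h1 := hh j (by omega) x hx
    have h2 := hh' j (by omega) x hx
    have h1' : DifferentiableAt ℝ (fun y => a • iteratedFDeriv ℝ j h y) x := h1.const_smul a
    have h2' : DifferentiableAt ℝ (fun y => b • iteratedFDeriv ℝ j h' y) x := h2.const_smul b
    rw [iteratedFDeriv_succ_eq_comp_left, iteratedFDeriv_succ_eq_comp_left,
      iteratedFDeriv_succ_eq_comp_left]
    simp only [Function.comp_apply]
    rw [hev.fderiv_eq, fderiv_fun_add h1' h2',
      fderiv_fun_const_smul h1, fderiv_fun_const_smul h2, map_add, map_smul, map_smul]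

lemma BoundedDerivs.linComb {d : ℕ} {O : Set (E d)} (hO : IsOpen O) {m : ℕ} {M M' : ℝ}
    {h h' : E d → ℝ} (hh : BoundedDerivs O m M h) (hh' : BoundedDerivs O m M' h') (a b : ℝ) :
    BoundedDerivs O m (|a| * M + |b| * M') (fun x => a * h x + b * h' x) := by
  have hlin := fun {j : ℕ} (hj : j ≤ m) => iteratedFDeriv_linComb hO hh.1 hh'.1 a b hj
  refine ⟨fun j hj x hx => ?_, fun j hj x hx c => ?_⟩
  · have hev : iteratedFDeriv ℝ j (fun x => a * h x + b * h' x) =ᶠ[𝓝 x]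
        fun x => a • iteratedFDeriv ℝ j h x + b • iteratedFDeriv ℝ j h' x := by
      filter_upwards [hO.mem_nhds hx] with y hy
      exact hlin hj.le y hy
    exact hev.differentiableAt_iff.2
      (((hh.1 j hj x hx).const_smul a).add ((hh'.1 j hj x hx).const_smul b))
  · rw [hlin hj x hx]
    simp only [_root_.add_apply, _root_.smul_apply, smul_eq_mul]
    refine (abs_add_le _ _).trans ?_
    rw [abs_mul, abs_mul]
    exact add_le_add (mul_le_mul_of_nonneg_left (hh.2 j hj x hx c) (abs_nonneg a))
      (mul_le_mul_of_nonneg_left (hh'.2 j hj x hx c) (abs_nonneg b))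

lemma boundedDerivs_const {d : ℕ} (O : Set (E d)) (m : ℕ) (c : ℝ) :
    BoundedDerivs O m |c| (fun _ => c) := by
  refine ⟨fun j _ x _ => ?_, fun j _ x _ v => ?_⟩
  · exact (contDiff_const.differentiable_iteratedFDeriv (n := ⊤)
      (by exact_mod_cast WithTop.coe_lt_top _)) x
  · cases j with
    | zero => simp
    | succ j => simp [iteratedFDeriv_succ_const]

lemma BoundedDerivs.mono {d : ℕ} {O : Set (E d)} {m : ℕ} {M M' : ℝ} {h : E d → ℝ}
    (hh : BoundedDerivs O m M h) (hM : M ≤ M') : BoundedDerivs O m M' h :=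
  ⟨hh.1, fun j hj x hx c => (hh.2 j hj x hx c).trans hM⟩

lemma smoothClass_mono {d : ℕ} {𝒲 O : Set (E d)} {m : ℕ} {M M' : ℝ} (hM : M ≤ M') :
    smoothClass 𝒲 O m M ⊆ smoothClass 𝒲 O m M' := by
  rintro g ⟨h, hgh, hh⟩
  exact ⟨h, hgh, hh.mono hM⟩

lemma linComb_mem_smoothClass {d : ℕ} {𝒲 O : Set (E d)} (hO : IsOpen O) {m : ℕ} {M M' : ℝ}
    {g g' : E d → ℝ} (hg : g ∈ smoothClass 𝒲 O m M) (hg' : g' ∈ smoothClass 𝒲 O m M')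
    (a b : ℝ) : (fun x => a * g x + b * g' x) ∈ smoothClass 𝒲 O m (|a| * M + |b| * M') := by
  obtain ⟨h, hgh, hh⟩ := hg
  obtain ⟨h', hgh', hh'⟩ := hg'
  exact ⟨_, fun x hx => by simp only [hgh hx, hgh' hx], hh.linComb hO hh' a b⟩

lemma smoothClass_congr {d : ℕ} {𝒲 O : Set (E d)} {m : ℕ} {M : ℝ} {g g' : E d → ℝ}
    (hg : g ∈ smoothClass 𝒲 O m M) (h : EqOn g' g 𝒲) : g' ∈ smoothClass 𝒲 O m M := by
  obtain ⟨f, hgf, hf⟩ := hg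
  exact ⟨f, h.trans hgf, hf⟩

lemma abs_le_of_mem_smoothClass {d : ℕ} {𝒲 O : Set (E d)} (h𝒲 : 𝒲 ⊆ O) {m : ℕ} {M : ℝ}
    {g : E d → ℝ} (hg : g ∈ smoothClass 𝒲 O m M) {w : E d} (hw : w ∈ 𝒲) : |g w| ≤ M := by
  obtain ⟨h, hgh, hh⟩ := hg
  rw [hgh hw]
  exact hh.abs_le (h𝒲 hw)

/-! ### The kernel sections -/

section RKHS

variable {d : ℕ} (H : Type*) [NormedAddCommGroup H] [InnerProductSpace ℝ H] [CompleteSpace H]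
  [RKHS ℝ H (E d) ℝ]

/-- The kernel section at `w`, i.e. the representer of the evaluation at `w`. -/
noncomputable def kerSection (w : E d) : H := RKHS.kerFun H w 1

variable {H}

lemma inner_kerSection (w : E d) (f : H) : inner ℝ (kerSection H w) f = f w := by
  rw [kerSection, RKHS.kerFun_inner]
  simp

lemma scalarKernel_eq (v w : E d) : scalarKernel H v w = kerSection H w v := by
  rw [scalarKernel, kerSection, RKHS.kerFun_apply]

lemma scalarKernel_comm (v w : E d) : scalarKernel H v w = scalarKernel H w v := by
  rw [scalarKernel_eq, scalarKernel_eq, ← inner_kerSection, ← inner_kerSection, real_inner_comm]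

variable (H) in
/-- The linear combination of the kernel sections at the points `x i` with coefficients `a i`. -/
noncomputable def kerComb {n : ℕ} (x : Fin n → E d) (a : Fin n → ℝ) : H :=
  ∑ j, a j • kerSection H (x j)

lemma rkhs_sum_apply {ι : Type*} (s : Finset ι) (f : ι → H) (w : E d) :
    (∑ i ∈ s, f i) w = ∑ i ∈ s, f i w := by
  rw [← inner_kerSection, inner_sum]
  simp only [inner_kerSection]

lemma kerComb_apply {n : ℕ} (x : Fin n → E d) (a : Fin n → ℝ) (w : E d) :
    kerComb H x a w = ∑ j, a j * scalarKernel H (x j) w := by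
  rw [kerComb, rkhs_sum_apply]
  simp only [RKHS.coe_smul, Pi.smul_apply, smul_eq_mul]
  refine Finset.sum_congr rfl fun j _ => ?_
  rw [scalarKernel_comm, scalarKernel_eq]

lemma inner_kerComb {n : ℕ} (x : Fin n → E d) (a : Fin n → ℝ) (f : H) :
    inner ℝ (kerComb H x a) f = ∑ j, a j * f (x j) := by
  rw [kerComb, sum_inner]
  simp only [real_inner_smul_left, inner_kerSection]

lemma kerComb_sum_smul {n : ℕ} {ι : Type*} (s : Finset ι) (x : Fin n → E d) (c : ι → ℝ)
    (v : ι → Fin n → ℝ) :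
    kerComb H x (fun j => ∑ l ∈ s, c l * v l j) = ∑ l ∈ s, c l • kerComb H x (v l) := by
  simp only [kerComb, Finset.sum_smul, Finset.smul_sum, mul_smul]
  rw [Finset.sum_comm]

/-! ### Principal components of the Gram matrix -/

variable {n : ℕ} {x : Fin (n + 1) → E d} {lam : Fin (n + 1) → ℝ}
  {u : Fin (n + 1) → Fin (n + 1) → ℝ}

lemma gram_mulVec (a : Fin (n + 1) → ℝ) (i : Fin (n + 1)) :
    (gram H x *ᵥ a) i = kerComb H x a (x i) := by
  rw [kerComb_apply, Matrix.mulVec, dotProduct]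
  refine Finset.sum_congr rfl fun j _ => ?_
  rw [gram, Matrix.of_apply, scalarKernel_comm, mul_comm]

namespace IsEigensystem

lemma kerComb_apply_point (h : IsEigensystem (gram H x) lam u) (l i : Fin (n + 1)) :
    kerComb H x (u l) (x i) = lam l * u l i := by
  rw [← gram_mulVec, h.eigen]
  rfl

lemma inner_eq (h : IsEigensystem (gram H x) lam u) (l l' : Fin (n + 1)) :
    inner ℝ (kerComb H x (u l)) (kerComb H x (u l')) = if l = l' then lam l else 0 := by
  rw [inner_kerComb]
  simp only [h.kerComb_apply_point]
  have h1 : ∑ j, u l j * (lam l' * u l' j) = lam l' * (u l ⬝ᵥ u l') := by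
    rw [dotProduct, Finset.mul_sum]
    exact Finset.sum_congr rfl fun j _ => by ring
  rw [h1, h.orthonormal]
  split_ifs with h2
  · rw [h2, mul_one]
  · rw [mul_zero]

lemma lam_nonneg (h : IsEigensystem (gram H x) lam u) (l : Fin (n + 1)) : 0 ≤ lam l := by
  have := h.inner_eq l l
  rw [if_pos rfl] at this
  rw [← this]
  exact real_inner_self_nonneg

lemma kerComb_eq_zero (h : IsEigensystem (gram H x) lam u) {l : Fin (n + 1)} (hl : lam l = 0) :
    kerComb H x (u l) = 0 := by
  have := h.inner_eq l l
  rw [if_pos rfl, hl] at this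
  exact inner_self_eq_zero.1 this

lemma norm_sq_sum (h : IsEigensystem (gram H x) lam u) (s : Finset (Fin (n + 1)))
    (c : Fin (n + 1) → ℝ) :
    ‖∑ l ∈ s, c l • kerComb H x (u l)‖ ^ 2 = ∑ l ∈ s, lam l * c l ^ 2 := by
  rw [← real_inner_self_eq_norm_sq, sum_inner]
  refine Finset.sum_congr rfl fun l hl => ?_
  rw [inner_sum]
  simp only [real_inner_smul_left, real_inner_smul_right, h.inner_eq]
  rw [Finset.sum_eq_single l]
  · rw [if_pos rfl]; ring
  · intro l' _ hne
    rw [if_neg (Ne.symm hne)]; ring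
  · exact fun hn => absurd hl hn

lemma sum_mul_eq (h : IsEigensystem (gram H x) lam u) (i j : Fin (n + 1)) :
    ∑ l, u l i * u l j = if i = j then 1 else 0 := by
  have h1 : (Matrix.of u) * (Matrix.of u)ᵀ = 1 := by
    ext l l'
    rw [Matrix.mul_apply, Matrix.one_apply]
    exact h.orthonormal l l'
  have h2 := mul_eq_one_comm.1 h1
  have h3 := congrFun (congrFun h2 i) j
  rw [Matrix.mul_apply, Matrix.one_apply] at h3
  exact h3

lemma expansion (h : IsEigensystem (gram H x) lam u) (a : Fin (n + 1) → ℝ) (i : Fin (n + 1)) :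
    a i = ∑ l, (u l ⬝ᵥ a) * u l i := by
  have h1 : ∑ l, (u l ⬝ᵥ a) * u l i = ∑ j, (∑ l, u l j * u l i) * a j := by
    simp only [dotProduct, Finset.sum_mul]
    rw [Finset.sum_comm]
    exact Finset.sum_congr rfl fun j _ => Finset.sum_congr rfl fun l _ => by ring
  rw [h1]
  simp [h.sum_mul_eq]

lemma parseval (h : IsEigensystem (gram H x) lam u) (a : Fin (n + 1) → ℝ) :
    ∑ l, (u l ⬝ᵥ a) ^ 2 = ∑ i, a i ^ 2 := by
  have h1 : ∀ i, a i ^ 2 = ∑ l, (u l ⬝ᵥ a) * (u l i * a i) := fun i => by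
    rw [sq]
    nth_rewrite 1 [h.expansion a i]
    rw [Finset.sum_mul]
    exact Finset.sum_congr rfl fun l _ => by ring
  simp only [h1]
  rw [Finset.sum_comm]
  refine Finset.sum_congr rfl fun l _ => ?_
  rw [← Finset.mul_sum, sq]
  rfl

lemma kerComb_eq_sum (h : IsEigensystem (gram H x) lam u) (a : Fin (n + 1) → ℝ) :
    kerComb H x a = ∑ l, (u l ⬝ᵥ a) • kerComb H x (u l) := by
  rw [← kerComb_sum_smul]
  congr 1
  ext i
  exact h.expansion a i

lemma kerComb_pcCoef (ζ : Fin (n + 1) → ℝ) :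
    kerComb H x (pcCoef lam u ζ) = ∑ l, (ζ l / lam l) • kerComb H x (u l) :=
  kerComb_sum_smul _ _ _ _

/-- The criterion, computed from `U_m ζ`, thus evaluates an actual RKHS function at the sample.
Admissibility is needed for the vanishing eigenvalues: there the quotient `ζ l / lam l` is `0`,
which agrees with the fitted value only if `ζ l = 0`. -/
lemma pcFitted_eq (h : IsEigensystem (gram H x) lam u) {m : ℕ} {B : ℝ} {ζ : Fin (n + 1) → ℝ}
    (hζ : ζ ∈ pcAdmissible lam m B) (i : Fin (n + 1)) :
    pcFitted u ζ i = kerComb H x (pcCoef lam u ζ) (x i) := by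
  rw [kerComb_pcCoef, rkhs_sum_apply, pcFitted]
  refine Finset.sum_congr rfl fun l _ => ?_
  rw [RKHS.coe_smul, Pi.smul_apply, smul_eq_mul, h.kerComb_apply_point]
  by_cases hl : lam l = 0
  · rw [hζ.2.1 l hl]; simp
  · field_simp

lemma lam_le_omitted (h : IsEigensystem (gram H x) lam u) {m : ℕ} {l : Fin (n + 1)}
    (hl : ¬ (l : ℕ) < m) : lam l ≤ omittedEigenvalue lam m := by
  have hm : m < n + 1 := lt_of_le_of_lt (not_lt.1 hl) l.2
  rw [omittedEigenvalue, dif_pos hm]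
  exact h.antitone (not_lt.1 hl)

lemma omitted_nonneg (h : IsEigensystem (gram H x) lam u) (m : ℕ) :
    0 ≤ omittedEigenvalue lam m := by
  rw [omittedEigenvalue]
  split_ifs
  · exact h.lam_nonneg _
  · exact le_rfl

/-- The truncation of a combination of kernel sections to the first principal components. -/
theorem exists_truncation (h : IsEigensystem (gram H x) lam u) (a : Fin (n + 1) → ℝ) (m : ℕ)
    {B : ℝ} (hB : ‖kerComb H x a‖ < B) :
    ∃ ζ ∈ pcAdmissible lam m B,
      ‖kerComb H x a - kerComb H x (pcCoef lam u ζ)‖ ^ 2 ≤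
        omittedEigenvalue lam m * ∑ i, a i ^ 2 ∧
      ∀ i, |kerComb H x a (x i) - kerComb H x (pcCoef lam u ζ) (x i)| ≤
        Real.sqrt (omittedEigenvalue lam m) * ‖kerComb H x a‖ := by
  classical
  set c : Fin (n + 1) → ℝ := fun l => u l ⬝ᵥ a with hc
  let ζ : Fin (n + 1) → ℝ := fun l => if (l : ℕ) < m then lam l * c l else 0
  have hnorm : ‖kerComb H x a‖ ^ 2 = ∑ l, lam l * c l ^ 2 := by
    rw [h.kerComb_eq_sum a, h.norm_sq_sum]
  have hres : kerComb H x a - kerComb H x (pcCoef lam u ζ) =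
      ∑ l ∈ Finset.univ.filter (fun l : Fin (n + 1) => ¬ (l : ℕ) < m),
        c l • kerComb H x (u l) := by
    rw [h.kerComb_eq_sum a, kerComb_pcCoef, ← Finset.sum_sub_distrib, Finset.sum_filter]
    refine Finset.sum_congr rfl fun l _ => ?_
    simp only [ζ, hc]
    by_cases hl : lam l = 0
    · simp [h.kerComb_eq_zero hl]
    · split_ifs with h1
      · rw [mul_div_cancel_left₀ _ hl, sub_self]
      · simp
  refine ⟨ζ, ⟨fun l hl => if_neg (not_lt.2 hl), fun l hl => by simp [ζ, hl], ?_⟩, ?_, fun i => ?_⟩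
  · have h1 : ∑ l, ζ l ^ 2 / lam l ≤ ‖kerComb H x a‖ ^ 2 := by
      rw [hnorm]
      refine Finset.sum_le_sum fun l _ => ?_
      have h0 := h.lam_nonneg l
      simp only [ζ]
      split_ifs
      · by_cases hl : lam l = 0
        · simp [hl]
        · refine le_of_eq ?_
          field_simp
      · rw [zero_pow two_ne_zero, zero_div]
        positivity
    exact lt_of_le_of_lt h1 (pow_lt_pow_left₀ hB (norm_nonneg _) two_ne_zero)
  · rw [hres, h.norm_sq_sum, ← h.parseval a, Finset.mul_sum]
    refine (Finset.sum_le_sum fun l hl => ?_).trans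
      (Finset.sum_le_sum_of_subset_of_nonneg (Finset.filter_subset _ _) fun l _ _ =>
        mul_nonneg (h.omitted_nonneg m) (sq_nonneg _))
    exact mul_le_mul_of_nonneg_right (h.lam_le_omitted (Finset.mem_filter.1 hl).2) (sq_nonneg _)
  · rw [← Pi.sub_apply, ← RKHS.coe_sub, hres, rkhs_sum_apply]
    simp only [RKHS.coe_smul, Pi.smul_apply, smul_eq_mul, h.kerComb_apply_point]
    -- The residual at `x i` is the sum of `c l * lam l * u l i` over the omitted components. In
    -- Cauchy–Schwarz the factors `u l i` have square sum at most one, since the full eigenvector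
    -- matrix has orthonormal rows and columns, and one factor `lam l` is bounded by the largest
    -- omitted eigenvalue.
    refine abs_le_of_sq_le_sq ?_ (by positivity)
    rw [mul_pow, Real.sq_sqrt (h.omitted_nonneg m), hnorm]
    have hcs := Finset.sum_mul_sq_le_sq_mul_sq
      (Finset.univ.filter (fun l : Fin (n + 1) => ¬ (l : ℕ) < m)) (fun l => c l * lam l)
      (fun l => u l i)
    have h1 : ∑ l ∈ Finset.univ.filter (fun l : Fin (n + 1) => ¬ (l : ℕ) < m), u l i ^ 2 ≤ 1 := by
      have h2 := h.sum_mul_eq i i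
      rw [if_pos rfl] at h2
      rw [← h2]
      refine (Finset.sum_le_sum_of_subset_of_nonneg (Finset.filter_subset _ _) fun l _ _ =>
        sq_nonneg (u l i)).trans (le_of_eq (Finset.sum_congr rfl fun l _ => sq _))
    have h3 : ∑ l ∈ Finset.univ.filter (fun l : Fin (n + 1) => ¬ (l : ℕ) < m), (c l * lam l) ^ 2 ≤
        omittedEigenvalue lam m * ∑ l, lam l * c l ^ 2 := by
      rw [Finset.mul_sum]
      refine (Finset.sum_le_sum fun l hl => ?_).trans
        (Finset.sum_le_sum_of_subset_of_nonneg (Finset.filter_subset _ _) fun l _ _ =>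
          mul_nonneg (h.omitted_nonneg m) (mul_nonneg (h.lam_nonneg l) (sq_nonneg _)))
      have h4 := h.lam_le_omitted (Finset.mem_filter.1 hl).2
      calc (c l * lam l) ^ 2 = lam l * (lam l * c l ^ 2) := by ring
        _ ≤ _ := mul_le_mul_of_nonneg_right h4 (mul_nonneg (h.lam_nonneg l) (sq_nonneg _))
    have h5 : ∑ l ∈ Finset.univ.filter (fun l : Fin (n + 1) => ¬ (l : ℕ) < m),
        c l * (lam l * u l i) =
        ∑ l ∈ Finset.univ.filter (fun l : Fin (n + 1) => ¬ (l : ℕ) < m), c l * lam l * u l i :=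
      Finset.sum_congr rfl fun l _ => by ring
    rw [h5]
    refine hcs.trans ((mul_le_of_le_one_right (Finset.sum_nonneg fun _ _ => sq_nonneg _) h1).trans
      h3)

end IsEigensystem

/-- Representer argument: the orthogonal projection onto the span of the kernel sections does not
increase the norm and preserves the inner products with these sections, which are the values at the
points. -/
lemma exists_kerComb_interpolating {n : ℕ} (x : Fin n → E d) (f : H) :
    ∃ a : Fin n → ℝ, ‖kerComb H x a‖ ≤ ‖f‖ ∧ ∀ i, kerComb H x a (x i) = f (x i) := by
  let S : Submodule ℝ H := Submodule.span ℝ (range fun i => kerSection H (x i))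
  have : FiniteDimensional ℝ S := FiniteDimensional.span_of_finite ℝ (finite_range _)
  obtain ⟨a, ha⟩ := (Submodule.mem_span_range_iff_exists_fun ℝ).1 (S.starProjection_apply_mem f)
  have ha' : kerComb H x a = S.starProjection f := ha
  refine ⟨a, ?_, fun i => ?_⟩
  · rw [ha']; exact S.norm_starProjection_apply_le f
  · rw [ha', ← inner_kerSection, ← inner_kerSection, ← sub_eq_zero, ← inner_sub_right]
    have h1 : kerSection H (x i) ∈ S := Submodule.subset_span ⟨i, rfl⟩
    have h2 := Submodule.starProjection_inner_eq_zero f (kerSection H (x i)) h1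
    rw [real_inner_comm, ← neg_sub, inner_neg_left, h2, neg_zero]

/-- Every function in the closed span of the kernel sections at the points of `S` is approximated
by finite combinations of these sections; every function of the space agrees on `S` with one in
this span. -/
lemma exists_kerComb_approx (S : Set (E d)) (f : H) : ∃ f' : H, ‖f'‖ ≤ ‖f‖ ∧ (∀ w ∈ S, f' w = f w) ∧
    ∀ e > 0, ∃ (N : ℕ) (x : Fin N → E d) (a : Fin N → ℝ), (∀ i, x i ∈ S) ∧
      ‖kerComb H x a - f'‖ < e := by
  let T : Submodule ℝ H := (Submodule.span ℝ (kerSection H '' S)).topologicalClosure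
  have hT : IsClosed (T : Set H) := Submodule.isClosed_topologicalClosure _
  have : CompleteSpace T := hT.completeSpace_coe
  refine ⟨T.starProjection f, T.norm_starProjection_apply_le f, fun w hw => ?_, fun e he => ?_⟩
  · rw [← inner_kerSection, ← inner_kerSection, ← sub_eq_zero, ← inner_sub_right]
    have h1 : kerSection H w ∈ T :=
      Submodule.le_topologicalClosure _ (Submodule.subset_span ⟨w, hw, rfl⟩)
    have h2 := Submodule.starProjection_inner_eq_zero f (kerSection H w) h1
    rw [real_inner_comm, ← neg_sub, inner_neg_left, h2, neg_zero]
  · have hmem : T.starProjection f ∈ closure (Submodule.span ℝ (kerSection H '' S) : Set H) := by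
      rw [← Submodule.topologicalClosure_coe]
      exact T.starProjection_apply_mem f
    obtain ⟨y, hy, hd⟩ := Metric.mem_closure_iff.1 hmem e he
    obtain ⟨N, a, v, hv⟩ := Submodule.mem_span_set'.1 hy
    have hx : ∀ i, ∃ w ∈ S, kerSection H w = v i := fun i => (v i).2
    choose x hxS hx using hx
    refine ⟨N, x, a, hxS, ?_⟩
    have : kerComb H x a = y := by
      rw [← hv, kerComb]
      simp only [hx]
    rw [this, ← dist_eq_norm, dist_comm]
    exact hd

/-- For the difference `f` of two sections, `‖f‖² = f w' - f w`, and the embedding bounds the right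
side by `d |C| ‖f‖` times the distance. Cancelling `‖f‖` shows that the sections depend continuously
on their centres. -/
lemma exists_norm_kerSection_sub_lt {𝒲 O : Set (E d)} (hO : IsOpen O) (h𝒲O : 𝒲 ⊆ O) {m : ℕ}
    (hm : 1 ≤ m) (hH : SmoothlyEmbedded H 𝒲 O m) {w : E d} (hw : w ∈ 𝒲) {e : ℝ} (he : 0 < e) :
    ∃ ρ > 0, ∀ w' ∈ 𝒲, dist w' w < ρ → ‖kerSection H w' - kerSection H w‖ < e := by
  obtain ⟨C, hC⟩ := hH
  obtain ⟨ρ, hρ, hρO⟩ := Metric.isOpen_iff.1 hO w (h𝒲O hw)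
  have hK : 0 < d * |C| + 1 := by positivity
  refine ⟨min ρ (e / (d * |C| + 1)), lt_min hρ (by positivity), fun w' hw' hd => ?_⟩
  set f : H := kerSection H w' - kerSection H w
  have hf : ‖f‖ ^ 2 = f w' - f w := by
    rw [← real_inner_self_eq_norm_sq, ← inner_kerSection, ← inner_kerSection, ← inner_sub_left]
  obtain ⟨h, hfh, hh⟩ := smoothClass_mono
    (mul_le_mul_of_nonneg_right (le_abs_self C) (norm_nonneg f)) (hC f)
  have h1 := hh.abs_sub_le hm hρO (x := w') (y := w)
    (Metric.mem_ball.2 (lt_of_lt_of_le hd (min_le_left _ _))) (Metric.mem_ball_self hρ)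
  rw [← hfh hw', ← hfh hw, ← hf, abs_of_nonneg (sq_nonneg _)] at h1
  have h2 : ‖f‖ ≤ d * |C| * dist w' w := by
    rcases (norm_nonneg f).eq_or_lt with h0 | h0
    · rw [← h0]; positivity
    · nlinarith
  have h3 := lt_of_lt_of_le hd (min_le_right _ _)
  rw [lt_div_iff₀ hK] at h3
  have h4 : 0 ≤ dist w' w := dist_nonneg
  nlinarith

end RKHS

variable {Ω : Type*} [MeasurableSpace Ω] {μ : Measure Ω} [IsProbabilityMeasure μ] {d : ℕ}

/-! ### The sample visits every neighbourhood of a point of the support -/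

/-- The frequency of visits converges to the probability of the ball, which is positive at a point
of the support. The uniform law is used with a single parameter. -/
lemma BinaryChoiceModel.exists_dist_lt {Y V : ℕ → Ω → ℝ} {W : ℕ → Ω → E d} {ε : ℕ → Ω → ℝ}
    {g₀ : E d → ℝ} {F₀ : ℝ → ℝ} (hmodel : BinaryChoiceModel μ Y V W ε g₀ F₀) {w : E d}
    (hw : w ∈ (μ.map (W 0)).support) {ρ : ℝ} (hρ : 0 < ρ) :
    WithProbToOne μ (fun n ω => ∃ i : Fin n, dist (W i ω) w < ρ) := by
  have hm := hmodel.measurable_W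
  have hindep : iIndepFun W μ :=
    hmodel.independent_obs.comp (fun _ z => z.2.2) fun _ => measurable_snd.comp measurable_snd
  have hident : ∀ i, IdentDistrib (W i) (W 0) μ μ := fun i =>
    (hmodel.identical_obs i).comp (u := fun z : ℝ × ℝ × E d => z.2.2)
      (measurable_snd.comp measurable_snd)
  let φ : E d → ℝ := (Metric.ball w ρ).indicator fun _ => 1
  have hφ : Measurable φ := measurable_const.indicator Metric.isOpen_ball.measurableSet
  have hp : 0 < ∫ ω, φ (W 0 ω) ∂μ := by
    rw [← integral_map (hm 0).aemeasurable hφ.aestronglyMeasurable,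
      show φ = (Metric.ball w ρ).indicator 1 from rfl,
      integral_indicator_one Metric.isOpen_ball.measurableSet]
    have := Measure.isProbabilityMeasure_map (hm 0).aemeasurable (μ := μ)
    exact ENNReal.toReal_pos
      ((Measure.mem_support_iff_forall _).1 hw _ (Metric.ball_mem_nhds w hρ)).ne' (measure_ne_top _ _)
  have hφ1 : ∀ z, |φ z| ≤ 1 := fun z => by
    simp only [φ, indicator]
    split_ifs <;> simp
  have h := KNP.uniform_lln (μ := μ) (K := (univ : Set Unit)) finite_univ.totallyBounded hm hindep
    hident (ℓ := fun _ => φ) (fun _ _ => hφ) (A := univ) (fun _ => by simp) one_pos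
    (fun _ _ z _ => hφ1 z) (fun _ _ _ _ _ _ => by simp) (half_pos hp)
  refine h.mono fun n ω hn => ?_
  by_contra hne
  push Not at hne
  have hz : ∀ i : Fin n, φ (W i ω) = 0 := fun i =>
    indicator_of_notMem (fun hi => absurd (Metric.mem_ball.1 hi) (not_lt.2 (hne i))) _
  have h1 := hn () trivial
  simp only [hz, Finset.sum_const_zero, mul_zero, zero_sub, abs_neg, abs_of_pos hp] at h1
  linarith

/-! ### Competitors built from the leading principal components -/

section RKHS

variable {H : Type*} [NormedAddCommGroup H] [InnerProductSpace ℝ H] [CompleteSpace H]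
  [RKHS ℝ H (E d) ℝ]

lemma pcFun_apply {n : ℕ} (x : Fin (n + 1) → E d) (wstar : E d) (lam : Fin (n + 1) → ℝ)
    (u : Fin (n + 1) → Fin (n + 1) → ℝ) (ζ : Fin (n + 1) → ℝ) (w : E d) :
    pcFun H x wstar lam u ζ w =
      kerComb H x (pcCoef lam u ζ) w - kerComb H x (pcCoef lam u ζ) wstar := by
  rw [kerComb_apply, kerComb_apply, ← Finset.sum_sub_distrib]
  exact Finset.sum_congr rfl fun j _ => by ring

lemma pcQhat_eq {Ω : Type*} {Y V : ℕ → Ω → ℝ} {W : ℕ → Ω → E d} {wstar : E d} {n : ℕ} {ω : Ω}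
    {lam : Fin (n + 1) → ℝ} {u : Fin (n + 1) → Fin (n + 1) → ℝ}
    (h : IsEigensystem (gram H (points W wstar n ω)) lam u) {m : ℕ} {B : ℝ}
    {ζ : Fin (n + 1) → ℝ} (hζ : ζ ∈ pcAdmissible lam m B) (F : ℝ → ℝ) :
    pcQhat Y V n ω u ζ F =
      Qhat Y V W n ω (pcFun H (points W wstar n ω) wstar lam u ζ) F := by
  rw [pcQhat, Qhat]
  congr 1
  refine Finset.sum_congr rfl fun i _ => ?_
  rw [h.pcFitted_eq hζ, h.pcFitted_eq hζ, pcFun_apply]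
  simp only [points, Fin.cons_succ, Fin.cons_zero, add_sub_assoc]

/-- Interpolation at the sample followed by truncation: the values at the sample points move by at
most `√λ_m B`, uniformly over the ball, whatever happens elsewhere. -/
lemma IsEigensystem.exists_pcFitted_close {n : ℕ} {x : Fin (n + 1) → E d} {lam : Fin (n + 1) → ℝ}
    {u : Fin (n + 1) → Fin (n + 1) → ℝ} (h : IsEigensystem (gram H x) lam u) (m : ℕ) {B : ℝ}
    {f : H} (hf : ‖f‖ < B) : ∃ ζ ∈ pcAdmissible lam m B,
      ∀ i, |pcFitted u ζ i - f (x i)| ≤ Real.sqrt (omittedEigenvalue lam m) * B := by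
  obtain ⟨a, ha, hax⟩ := exists_kerComb_interpolating x f
  obtain ⟨ζ, hζ, -, hfit⟩ := h.exists_truncation a m (ha.trans_lt hf)
  refine ⟨ζ, hζ, fun i => ?_⟩
  rw [h.pcFitted_eq hζ, ← hax, abs_sub_comm]
  exact (hfit i).trans
    (mul_le_mul_of_nonneg_left (ha.trans_lt hf).le (Real.sqrt_nonneg _))

lemma kerComb_sum_single {n N : ℕ} (x : Fin n → E d) (α : Fin N → ℝ) (i : Fin N → Fin n) :
    kerComb H x (∑ j, Pi.single (i j) (α j)) = ∑ j, α j • kerSection H (x (i j)) := by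
  simp only [kerComb, Finset.sum_apply, Finset.sum_smul]
  rw [Finset.sum_comm]
  refine Finset.sum_congr rfl fun j _ => ?_
  rw [Finset.sum_eq_single (i j)]
  · simp
  · intro l _ hl
    rw [Pi.single_eq_of_ne hl, zero_smul]
  · simp

lemma sum_sq_sum_single_le {n N : ℕ} (α : Fin N → ℝ) (i : Fin N → Fin n) :
    ∑ l, (∑ j, (Pi.single (i j) (α j) : Fin n → ℝ)) l ^ 2 ≤ (∑ j, |α j|) ^ 2 := by
  set a : Fin n → ℝ := ∑ j, Pi.single (i j) (α j) with ha
  have h1 : ∀ l, |a l| ≤ ∑ j, (Pi.single (i j) |α j| : Fin n → ℝ) l := fun l => by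
    rw [ha, Finset.sum_apply]
    refine (Finset.abs_sum_le_sum_abs _ _).trans (Finset.sum_le_sum fun j _ => ?_)
    by_cases hl : l = i j
    · subst hl; simp
    · simp [Pi.single_eq_of_ne hl]
  have h2 : ∑ l, |a l| ≤ ∑ j, |α j| := by
    refine (Finset.sum_le_sum fun l _ => h1 l).trans ?_
    rw [Finset.sum_comm]
    exact Finset.sum_le_sum fun j _ => by simp
  have h3 : ∑ l, a l ^ 2 ≤ (∑ l, |a l|) ^ 2 := by
    simp only [← sq_abs (a _)]
    exact Finset.sum_sq_le_sq_sum_of_nonneg fun l _ => abs_nonneg _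
  exact h3.trans (pow_le_pow_left₀ (Finset.sum_nonneg fun _ _ => abs_nonneg _) h2 2)

/-- If `f_ζ` is close in norm to a function which agrees on `𝒲` with `(1 - τ) f`, where
`f - f(w_*) ∈ 𝒢`, then `f_ζ - f_ζ(w_*)` lies in `𝒢` and is close to `f - f(w_*)`. -/
lemma sub_mem_gSpace_of_norm_sub_le {H : Type*} [NormedAddCommGroup H]
    [InnerProductSpace ℝ H] [RKHS ℝ H (E d) ℝ] {S O : Set (E d)} (hO : IsOpen O) (hSO : S ⊆ O) {mw : ℕ}
    {Mg C : ℝ} {wstar : E d} (hwstar : wstar ∈ S) (hC : 0 ≤ C)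
    (hH : ∀ f : H, (f : E d → ℝ) ∈ smoothClass S O mw (C * ‖f‖)) {g : E d → ℝ} {f f' q : H}
    (hg : g ∈ gSpace S O mw Mg wstar) (hgf : ∀ w ∈ S, g w = f w - f wstar) {τ η : ℝ}
    (hτ : 0 ≤ τ) (hτ1 : τ ≤ 1) (hf' : ∀ w ∈ S, f' w = (1 - τ) * f w) (hq : ‖q - f'‖ ≤ 3 * η)
    (hη : 6 * C * η ≤ τ * Mg) :
    (fun w => q w - q wstar) ∈ gSpace S O mw Mg wstar ∧
      ∀ w ∈ S, |q w - q wstar - g w| ≤ 2 * (τ * Mg) := by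
  have hD : ((q - f' : H) : E d → ℝ) ∈ smoothClass S O mw (3 * C * η) :=
    smoothClass_mono (by nlinarith) (hH (q - f'))
  have hDs : |(q - f' : H) wstar| ≤ 3 * C * η := abs_le_of_mem_smoothClass hSO hD hwstar
  have heq : ∀ w ∈ S, q w - q wstar =
      1 * ((1 - τ) * g w + 1 * (q - f' : H) w) + 1 * (-(q - f' : H) wstar) := fun w hw => by
    simp only [RKHS.coe_sub, Pi.sub_apply, hf' w hw, hf' wstar hwstar, hgf w hw]
    ring
  refine ⟨⟨?_, by simp⟩, fun w hw => ?_⟩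
  · have h1 := linComb_mem_smoothClass hO hg.1 hD (1 - τ) 1
    have h2 := linComb_mem_smoothClass hO h1
      (⟨_, fun _ _ => rfl, boundedDerivs_const O mw (-(q - f' : H) wstar)⟩ :
        (fun _ => -(q - f' : H) wstar) ∈ smoothClass S O mw |-(q - f' : H) wstar|) 1 1
    -- The bounds add up to `(1 - τ) Mg + 3 C η + 3 C η`, with one perturbation term for `q - f'`
    -- and one for its value at `w_*`; shrinking has made exactly this room.
    refine smoothClass_mono ?_ (smoothClass_congr h2 heq)
    rw [abs_one, abs_of_nonneg (sub_nonneg.2 hτ1), abs_neg]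
    linarith
  · have h1 := abs_le_of_mem_smoothClass hSO hD hw
    have h2 := abs_le_of_mem_smoothClass hSO hg.1 hw
    have h3 : q w - q wstar - g w = (q - f' : H) w - (q - f' : H) wstar - τ * g w := by
      rw [heq w hw]; ring
    have h4 : |τ * g w| ≤ τ * Mg := by
      rw [abs_mul, abs_of_nonneg hτ]
      exact mul_le_mul_of_nonneg_left h2 hτ
    rw [h3]
    refine (abs_sub _ _).trans ((add_le_add ((abs_sub _ _).trans (add_le_add h1 hDs)) h4).trans ?_)
    linarith

/-- Shrunken sieve functions are approximated by functions built from the leading principal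
components, within the parameter space. -/
theorem exists_pcFun_mem_gSpace {Y V : ℕ → Ω → ℝ} {W : ℕ → Ω → E d} {ε : ℕ → Ω → ℝ}
    {g₀ : E d → ℝ} {F₀ : ℝ → ℝ} (hmodel : BinaryChoiceModel μ Y V W ε g₀ F₀) {S : Set (E d)}
    (hS : S = (μ.map (W 0)).support) {wstar : E d} (hwstar : wstar ∈ S) {O : Set (E d)}
    (hO : IsOpen O) (hSO : S ⊆ O) {mw : ℕ} (hmw : 1 ≤ mw) {Mg : ℝ} (hMg : 0 < Mg)
    (hH : SmoothlyEmbedded H S O mw) {B : ℕ → ℝ} (hB : Tendsto B atTop atTop)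
    {lam : (n : ℕ) → Ω → Fin (n + 1) → ℝ} {u : (n : ℕ) → Ω → Fin (n + 1) → Fin (n + 1) → ℝ}
    {m : ℕ → Ω → ℕ}
    (heig : ∀ n ω, IsEigensystem (gram H (points W wstar n ω)) (lam n ω) (u n ω))
    (hlam : TendstoInMeasure μ
      (fun n ω => Real.sqrt (omittedEigenvalue (lam n ω) (m n ω)) * B n) atTop (fun _ => 0))
    {g : E d → ℝ} (hg : g ∈ gSpace S O mw Mg wstar) {f : H}
    (hgf : ∀ w ∈ S, g w = f w - f wstar) {δ : ℝ} (hδ : 0 < δ) :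
    WithProbToOne μ (fun n ω => ∃ ζ ∈ pcAdmissible (lam n ω) (m n ω) (B n),
      pcFun H (points W wstar n ω) wstar (lam n ω) (u n ω) ζ ∈ gSpace S O mw Mg wstar ∧
      ∀ w ∈ S, |pcFun H (points W wstar n ω) wstar (lam n ω) (u n ω) ζ w - g w| ≤ δ) := by
  obtain ⟨C₀, hC₀⟩ := id hH
  obtain ⟨C, hC, hCH⟩ : ∃ C > 0, ∀ f : H, (f : E d → ℝ) ∈ smoothClass S O mw (C * ‖f‖) :=
    ⟨|C₀| + 1, by positivity, fun f => smoothClass_mono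
      (mul_le_mul_of_nonneg_right (by linarith [le_abs_self C₀]) (norm_nonneg f)) (hC₀ f)⟩
  set τ : ℝ := min 1 (δ / (2 * Mg)) with hτdef
  have hτ : 0 < τ := lt_min one_pos (by positivity)
  have hτδ : 2 * (τ * Mg) ≤ δ := by
    have : τ ≤ δ / (2 * Mg) := min_le_right _ _
    rw [le_div_iff₀ (by positivity)] at this
    linarith
  -- The error `3η` in RKHS norm is the sum of three errors `η`: approximation by finitely many
  -- kernel sections, relocation of their centres to sample points, and truncation.
  set η : ℝ := τ * Mg / (6 * C) with hηdef
  have hη : 0 < η := by positivity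
  have hηC : 6 * C * η ≤ τ * Mg := by rw [hηdef]; field_simp; exact le_rfl
  obtain ⟨f', -, hf', happ⟩ := exists_kerComb_approx S ((1 - τ) • f)
  obtain ⟨N, x, α, hx, hα⟩ := happ η hη
  set A : ℝ := ∑ j, |α j| with hA
  have hA0 : 0 ≤ A := Finset.sum_nonneg fun _ _ => abs_nonneg _
  have hρ : ∀ j, ∃ ρ > 0, ∀ w' ∈ S, dist w' (x j) < ρ →
      ‖kerSection H w' - kerSection H (x j)‖ < η / (A + 1) := fun j =>
    exists_norm_kerSection_sub_lt hO hSO hmw hH (hx j) (by positivity)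
  choose ρ hρ hρx using hρ
  have hhit : WithProbToOne μ (fun n ω => ∀ j ∈ (univ : Set (Fin N)),
      ∃ i : Fin n, dist (W i ω) (x j) < ρ j) :=
    WithProbToOne.forall_finite finite_univ fun j _ =>
      hmodel.exists_dist_lt (hS ▸ hx j) (hρ j)
  have hsmall := WithProbToOne.of_tendstoInMeasure hlam
    (show 0 < η / (A + 1) by positivity)
  have hWS : ∀ᵐ ω ∂μ, ∀ i, W i ω ∈ S := ae_all_iff.2 fun i => hmodel.ae_W_mem hS i
  refine (hhit.and hsmall).mono_ae ?_
  filter_upwards [hB.eventually_ge_atTop 1, hB.eventually_gt_atTop (‖f'‖ + 2 * η)] with n hn1 hn2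
  filter_upwards [hWS] with ω hω ⟨hi, hs⟩
  choose i hi using fun j => hi j trivial
  have hker : ‖kerComb H (points W wstar n ω) (∑ j, Pi.single (i j).succ (α j)) - f'‖ ≤ 2 * η := by
    rw [kerComb_sum_single]
    have h1 : ‖∑ j, α j • kerSection H (points W wstar n ω (i j).succ) - kerComb H x α‖ ≤ η := by
      rw [kerComb, ← Finset.sum_sub_distrib]
      have : ∀ j, ‖α j • kerSection H (points W wstar n ω (i j).succ) - α j • kerSection H (x j)‖ ≤
          |α j| * (η / (A + 1)) := fun j => by
        rw [← smul_sub, norm_smul, Real.norm_eq_abs]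
        refine mul_le_mul_of_nonneg_left ?_ (abs_nonneg _)
        simp only [points, Fin.cons_succ]
        exact (hρx j _ (hω _) (hi j)).le
      refine (norm_sum_le _ _).trans ((Finset.sum_le_sum fun j _ => this j).trans ?_)
      rw [← Finset.sum_mul, ← hA, mul_div_assoc', div_le_iff₀ (by positivity)]
      nlinarith
    have h2 := norm_sub_le_norm_sub_add_norm_sub
      (∑ j, α j • kerSection H (points W wstar n ω (i j).succ)) (kerComb H x α) f'
    linarith
  set a : Fin (n + 1) → ℝ := ∑ j, Pi.single (i j).succ (α j) with ha
  have hnorm : ‖kerComb H (points W wstar n ω) a‖ < B n := by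
    have := norm_le_norm_add_norm_sub' (kerComb H (points W wstar n ω) a) f'
    linarith
  obtain ⟨ζ, hζ, htr, -⟩ := (heig n ω).exists_truncation a (m n ω) hnorm
  have hl0 := (heig n ω).omitted_nonneg (m n ω)
  set l := omittedEigenvalue (lam n ω) (m n ω) with hl
  -- The coefficients have a fixed `ℓ¹` norm `A`, so here a small eigenvalue suffices; it follows
  -- from the hypothesis because `B n ≥ 1`.
  have hsq : Real.sqrt l ≤ η / (A + 1) := by
    rw [sub_zero] at hs
    have h1 : Real.sqrt l ≤ Real.sqrt l * B n := le_mul_of_one_le_right (Real.sqrt_nonneg _) hn1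
    exact h1.trans ((le_abs_self _).trans hs.le)
  have htr' : ‖kerComb H (points W wstar n ω) a -
      kerComb H (points W wstar n ω) (pcCoef (lam n ω) (u n ω) ζ)‖ ≤ η := by
    refine abs_le_of_sq_le_sq' ?_ hη.le |>.2
    refine htr.trans ?_
    have h1 : ∑ l, a l ^ 2 ≤ A ^ 2 := sum_sq_sum_single_le α fun j => (i j).succ
    have h2 : Real.sqrt l * A ≤ η := by
      refine (mul_le_mul_of_nonneg_right hsq hA0).trans ?_
      rw [div_mul_eq_mul_div, div_le_iff₀ (by positivity)]
      nlinarith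
    calc l * ∑ l, a l ^ 2 ≤ l * A ^ 2 := mul_le_mul_of_nonneg_left h1 hl0
      _ = (Real.sqrt l * A) ^ 2 := by rw [mul_pow, Real.sq_sqrt hl0]
      _ ≤ η ^ 2 := pow_le_pow_left₀ (by positivity) h2 2
  have hq : ‖kerComb H (points W wstar n ω) (pcCoef (lam n ω) (u n ω) ζ) - f'‖ ≤ 3 * η := by
    have h2 := norm_sub_le_norm_sub_add_norm_sub
      (kerComb H (points W wstar n ω) (pcCoef (lam n ω) (u n ω) ζ))
      (kerComb H (points W wstar n ω) a) f'
    rw [norm_sub_rev] at htr'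
    linarith
  have hfin := sub_mem_gSpace_of_norm_sub_le hO hSO hwstar hC.le hCH hg hgf hτ.le
    (min_le_left _ _) (fun w hw => by
      rw [hf' w hw, RKHS.coe_smul, Pi.smul_apply, smul_eq_mul]) hq hηC
  have hfun : pcFun H (points W wstar n ω) wstar (lam n ω) (u n ω) ζ = fun w =>
      kerComb H (points W wstar n ω) (pcCoef (lam n ω) (u n ω) ζ) w -
        kerComb H (points W wstar n ω) (pcCoef (lam n ω) (u n ω) ζ) wstar :=
    funext fun w => pcFun_apply _ _ _ _ _ _
  refine ⟨ζ, hζ, hfun ▸ hfin.1, fun w hw => ?_⟩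
  rw [hfun]
  exact (hfin.2 w hw).trans hτδ

end RKHS

/-- The criterion at fitted values close to those of `g`. -/
lemma pcQhat_le_Qhat_add {Ω : Type*} {Y V : ℕ → Ω → ℝ} {W : ℕ → Ω → E d} {n : ℕ} {ω : Ω}
    (hY : ∀ i, Y i ω ∈ Icc (0 : ℝ) 1) {F : ℝ → ℝ} (hF : ∀ v, F v ∈ Icc (0 : ℝ) 1) {L : ℝ}
    (hL : 0 ≤ L) (hFL : ∀ v v', |F v - F v'| ≤ L * |v - v'|) {g : E d → ℝ}
    {u : Fin (n + 1) → Fin (n + 1) → ℝ} {ζ : Fin (n + 1) → ℝ} {c : ℝ} (hc : 0 ≤ c)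
    (hfit : ∀ i : Fin n, |pcFitted u ζ i.succ - pcFitted u ζ 0 - g (W i ω)| ≤ c) :
    pcQhat Y V n ω u ζ F ≤ Qhat Y V W n ω g F + 2 * (L * c) := by
  have h := abs_mean_sub_mean_le (n := n)
    (a := fun i => (Y i ω - F (V i ω + pcFitted u ζ i.succ - pcFitted u ζ 0)) ^ 2)
    (b := fun i => (Y i ω - F (V i ω + g (W i ω))) ^ 2) (c := 2 * (L * c)) (by positivity)
    fun i => by
      refine (abs_sq_sub_sq_le_of_mem_Icc (hY i) (hF _) (hF _)).trans ?_
      refine mul_le_mul_of_nonneg_left ((hFL _ _).trans ?_) zero_le_two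
      refine mul_le_mul_of_nonneg_left ?_ hL
      have h1 : V i ω + pcFitted u ζ i.succ - pcFitted u ζ 0 - (V i ω + g (W i ω)) =
          pcFitted u ζ i.succ - pcFitted u ζ 0 - g (W i ω) := by ring
      rw [h1]
      exact hfit i
  have := (abs_le.1 h).2
  rw [pcQhat, Qhat]
  linarith

end KNP

/-! ### Consistency of the two estimators -/

theorem theorem3 {Ω : Type*} [MeasurableSpace Ω] (μ : Measure Ω) [IsProbabilityMeasure μ]
    {d : ℕ} (Y V : ℕ → Ω → ℝ) (W : ℕ → Ω → KNP.E d) (ε : ℕ → Ω → ℝ)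
    (g₀ : KNP.E d → ℝ) (F₀ : ℝ → ℝ)
    (hmodel : KNP.BinaryChoiceModel μ Y V W ε g₀ F₀)
    -- the supports of `W` and of `X = (V, W)`
    (𝒲 : Set (KNP.E d)) (h𝒲 : 𝒲 = (μ.map (W 0)).support)
    (𝒳 : Set (ℝ × KNP.E d)) (h𝒳 : 𝒳 = (μ.map (fun ω => (V 0 ω, W 0 ω))).support)
    -- identification
    (wstar : KNP.E d) (hwstar : wstar ∈ 𝒲)
    (hcond : ∃ ν : Measure ℝ, IsProbabilityMeasure ν ∧
      KNP.IsCondLawAt μ (V 0) (W 0) wstar ν ∧ ν.support = Set.univ)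
    (hF₀mono : StrictMono F₀)
    -- the parameter space of `g₀`
    (hcompact : IsCompact 𝒲)
    (O : Set (KNP.E d)) (hO : IsOpen O) (h𝒲O : 𝒲 ⊆ O)
    (mw : ℕ) (hmw : 1 ≤ mw) (Mg : ℝ) (hMg : 0 < Mg)
    (hg₀ : g₀ ∈ KNP.gSpace 𝒲 O mw Mg wstar)
    -- the parameter space of `F₀`
    (m₀ me : ℕ) (hm₀ : 1 ≤ m₀) (hme : 1 ≤ me) (η₀ : ℝ) (hη₀ : 1 / 2 < η₀)
    (MF : ℝ) (hMF : 0 < MF)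
    (hF₀ : F₀ ∈ KNP.distSpace (m₀ + me) η₀ MF)
    -- the reproducing kernel Hilbert space and the sieves
    (H : Type*) [NormedAddCommGroup H] [InnerProductSpace ℝ H] [CompleteSpace H]
    [RKHS ℝ H (KNP.E d) ℝ]
    (B : ℕ → ℝ) (hB : Tendsto B atTop atTop)
    (J : ℕ → ℕ) (hJ : Tendsto J atTop atTop)
    (hdense : ∃ gs : ℕ → KNP.E d → ℝ,
      (∀ᶠ n in atTop, gs n ∈ KNP.gSieve H 𝒲 O mw Mg wstar (B n)) ∧
      TendstoUniformlyOn gs g₀ atTop 𝒲) :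
    -- the least squares sieve estimator
    (∀ (r : ℕ → Ω → ℝ) (ghat : ℕ → Ω → KNP.E d → ℝ) (Fhat : ℕ → Ω → ℝ → ℝ),
      TendstoInMeasure μ r atTop (fun _ => 0) →
      (∀ᶠ n in atTop, ∀ᵐ ω ∂μ, KNP.IsNearMin (KNP.Qhat Y V W n ω)
        (KNP.gSieve H 𝒲 O mw Mg wstar (B n)) (KNP.distSieve (m₀ + me) η₀ MF (J n))
        (r n ω) (ghat n ω) (Fhat n ω)) →
      KNP.ToZeroInProb μ (fun n ω => KNP.dTheta 𝒲 (ghat n ω) g₀ (Fhat n ω) F₀) ∧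
      KNP.ToZeroInProb μ (fun n ω =>
        KNP.dPi 𝒳 (KNP.ccp (ghat n ω) (Fhat n ω)) (KNP.ccp g₀ F₀))) ∧
    -- the estimator regularised by principal components
    (∀ (lam : (n : ℕ) → Ω → Fin (n + 1) → ℝ)
      (u : (n : ℕ) → Ω → Fin (n + 1) → Fin (n + 1) → ℝ)
      (m : ℕ → Ω → ℕ) (r : ℕ → Ω → ℝ)
      (ζhat : (n : ℕ) → Ω → Fin (n + 1) → ℝ) (Fhat : ℕ → Ω → ℝ → ℝ)
      (𝒜 : Set (KNP.E d → ℝ)),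
      (∀ n ω, KNP.IsEigensystem (KNP.gram H (KNP.points W wstar n ω)) (lam n ω) (u n ω)) →
      TendstoInMeasure μ
        (fun n ω => Real.sqrt (KNP.omittedEigenvalue (lam n ω) (m n ω)) * B n) atTop
        (fun _ => 0) →
      TendstoInMeasure μ r atTop (fun _ => 0) →
      (𝒜 = Set.univ ∨
        (𝒜 = KNP.gSpace 𝒲 O mw Mg wstar ∧ KNP.SmoothlyEmbedded H 𝒲 O mw)) →
      (∀ᶠ n in atTop, ∀ᵐ ω ∂μ, KNP.IsPCNearMin (KNP.pcQhat Y V n ω (u n ω))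
        (KNP.pcFun H (KNP.points W wstar n ω) wstar (lam n ω) (u n ω))
        (KNP.pcAdmissible (lam n ω) (m n ω) (B n)) (KNP.gSpace 𝒲 O mw Mg wstar) 𝒜
        (KNP.distSieve (m₀ + me) η₀ MF (J n)) (r n ω) (ζhat n ω) (Fhat n ω)) →
      KNP.ToZeroInProb μ (fun n ω => KNP.dTheta 𝒲
        (KNP.pcFun H (KNP.points W wstar n ω) wstar (lam n ω) (u n ω) (ζhat n ω)) g₀
        (Fhat n ω) F₀) ∧
      KNP.ToZeroInProb μ (fun n ω => KNP.dPi 𝒳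
        (KNP.ccp (KNP.pcFun H (KNP.points W wstar n ω) wstar (lam n ω) (u n ω) (ζhat n ω))
          (Fhat n ω)) (KNP.ccp g₀ F₀))) := by
  classical
  have hs : 1 ≤ m₀ + me := by omega
  have hη : 0 < η₀ := by linarith
  obtain ⟨Q₀, hcons, hcomp⟩ := KNP.consistency_of_nearMin hmodel h𝒲 h𝒳 hwstar hcond hF₀mono
    hcompact hO h𝒲O hmw hg₀ hs hη hF₀
  -- One member of one sieve is picked and kept fixed; since `B n` diverges, the norm of its `f` is
  -- eventually below `B n`, so its own radius can be forgotten.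
  have hsieve : ∀ δ > 0, ∃ g ∈ KNP.gSpace 𝒲 O mw Mg wstar, ∃ f : H,
      (∀ w ∈ 𝒲, g w = f w - f wstar) ∧ ∀ w ∈ 𝒲, |g w - g₀ w| ≤ δ := by
    intro δ hδ
    obtain ⟨gs, hgs, hunif⟩ := hdense
    obtain ⟨n, ⟨hn, f, -, hf⟩, hn'⟩ :=
      (hgs.and (Metric.tendstoUniformlyOn_iff.1 hunif δ hδ)).exists
    refine ⟨gs n, hn, f, hf, fun w hw => ?_⟩
    rw [abs_sub_comm, ← Real.dist_eq]
    exact (hn' w hw).le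
  have hdist : ∀ δ > 0, ∀ᶠ n in atTop,
      ∃ F ∈ KNP.distSieve (m₀ + me) η₀ MF (J n), ∀ v, |F v - F₀ v| ≤ δ := by
    intro δ hδ
    obtain ⟨J₀, hJ₀⟩ := KNP.exists_mem_distSieve hs hη.le hF₀ hδ
    filter_upwards [hJ.eventually_ge_atTop J₀] with n hn
    exact hJ₀ _ hn
  constructor
  · intro r ghat Fhat hr hmin
    refine hcons ghat Fhat ?_ fun e he => ?_
    · filter_upwards [hmin] with n hn
      filter_upwards [hn] with ω hω
      exact ⟨hω.1.1, hω.2.1.1⟩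
    · obtain ⟨δ, hδ, hQ⟩ := hcomp (e / 2) (half_pos he)
      obtain ⟨g, hg, f, hgf, hgδ⟩ := hsieve δ hδ
      refine (hQ.and (KNP.WithProbToOne.of_tendstoInMeasure hr (half_pos he))).mono_ae ?_
      filter_upwards [hmin, hdist δ hδ, hB.eventually_gt_atTop ‖f‖] with n hn ⟨F, hF, hFδ⟩ hfB
      filter_upwards [hn] with ω hω ⟨h1, h2⟩
      have h3 := hω.2.2 g ⟨hg, f, hfB, hgf⟩ F hF
      have h4 := h1 g hg F hF.1 hgδ hFδ
      rw [sub_zero] at h2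
      linarith [(abs_lt.1 h2).2]
  · intro lam u m r ζhat Fhat 𝒜 heig hlam hr h𝒜 hmin
    refine hcons _ Fhat ?_ fun e he => ?_
    · filter_upwards [hmin] with n hn
      filter_upwards [hn] with ω hω
      exact ⟨hω.2.1, hω.2.2.1.1⟩
    -- One admissible competitor with criterion at most `Q₀ + e / 2` is enough; the tolerance takes
    -- the other half. The two variants differ only in how it is found.
    · have key : KNP.WithProbToOne μ (fun n ω =>
          ∃ ζ ∈ KNP.pcAdmissible (lam n ω) (m n ω) (B n),
            KNP.pcFun H (KNP.points W wstar n ω) wstar (lam n ω) (u n ω) ζ ∈ 𝒜 ∧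
            ∃ F ∈ KNP.distSieve (m₀ + me) η₀ MF (J n),
              KNP.pcQhat Y V n ω (u n ω) ζ F ≤ Q₀ + e / 2) := by
        rcases h𝒜 with rfl | ⟨rfl, hH⟩
        · obtain ⟨δ, hδ, hQ⟩ := hcomp (e / 4) (by positivity)
          obtain ⟨g, hg, f, hgf, hgδ⟩ := hsieve δ hδ
          set L : ℝ := ((Real.toNNReal (2 + MF ^ 2) : NNReal) : ℝ) with hL
          have hL0 : 0 ≤ L := NNReal.coe_nonneg _
          have hc : 0 < e / (16 * (L + 1)) := by positivity
          have hWS : ∀ᵐ ω ∂μ, ∀ i, W i ω ∈ 𝒲 := ae_all_iff.2 fun i => hmodel.ae_W_mem h𝒲 i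
          have hY : ∀ᵐ ω ∂μ, ∀ i, Y i ω ∈ Icc (0 : ℝ) 1 :=
            ae_all_iff.2 fun i => hmodel.ae_Y_mem_Icc i
          refine (hQ.and (KNP.WithProbToOne.of_tendstoInMeasure hlam hc)).mono_ae ?_
          filter_upwards [hdist δ hδ, hB.eventually_gt_atTop ‖f‖] with n ⟨F, hF, hFδ⟩ hfB
          filter_upwards [hWS, hY] with ω hω hYω ⟨h1, h2⟩
          obtain ⟨ζ, hζ, hfit⟩ := (heig n ω).exists_pcFitted_close (m n ω) hfB
          refine ⟨ζ, hζ, mem_univ _, F, hF, ?_⟩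
          obtain ⟨G, hG, hGF⟩ := KNP.exists_bcf_of_mem_distSpace hs hη.le hF.1
          rw [sub_zero] at h2
          have h3 : Real.sqrt (KNP.omittedEigenvalue (lam n ω) (m n ω)) * B n ≤
              e / (16 * (L + 1)) := (le_abs_self _).trans h2.le
          -- The error is doubled because the fitted value at `w_*` is subtracted. The competitor's
          -- function need not lie in `𝒢` here, so its criterion is compared through the fitted
          -- values with that of the fixed `g`.
          have h4 := KNP.pcQhat_le_Qhat_add (V := V) (W := W) (g := g) (u := u n ω) (ζ := ζ)
            (F := F) hYω (fun v => hGF v ▸ hG.1 v) hL0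
            (fun v v' => by rw [← hGF, ← hGF]; exact hG.2.1 v v')
            (c := 2 * (e / (16 * (L + 1)))) (by positivity) fun i => by
              have h5 := (hfit i.succ).trans h3
              have h6 := (hfit 0).trans h3
              simp only [KNP.points, Fin.cons_succ, Fin.cons_zero] at h5 h6
              rw [hgf _ (hω i)]
              have h7 : KNP.pcFitted (u n ω) ζ i.succ - KNP.pcFitted (u n ω) ζ 0 -
                  (f (W i ω) - f wstar) = (KNP.pcFitted (u n ω) ζ i.succ - f (W i ω)) -
                  (KNP.pcFitted (u n ω) ζ 0 - f wstar) := by ring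
              rw [h7]
              refine (abs_sub _ _).trans ?_
              linarith
          have h5 := h1 g hg F hF.1 hgδ hFδ
          have h6 : 2 * (L * (2 * (e / (16 * (L + 1))))) ≤ e / 4 := by
            have : L / (L + 1) ≤ 1 := by rw [div_le_one (by positivity)]; linarith
            have h7 : 2 * (L * (2 * (e / (16 * (L + 1))))) = e / 4 * (L / (L + 1)) := by
              field_simp; ring
            rw [h7]
            exact mul_le_of_le_one_right (by positivity) this
          linarith
        · obtain ⟨δ, hδ, hQ⟩ := hcomp (e / 2) (half_pos he)
          obtain ⟨g, hg, f, hgf, hgδ⟩ := hsieve (δ / 2) (half_pos hδ)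
          have hpc := KNP.exists_pcFun_mem_gSpace hmodel h𝒲 hwstar hO h𝒲O hmw hMg hH hB heig
            hlam hg hgf (half_pos hδ)
          refine (hQ.and hpc).mono_ae ?_
          filter_upwards [hdist δ hδ] with n ⟨F, hF, hFδ⟩
          refine Eventually.of_forall fun ω ⟨h1, ζ, hζ, hζG, hζg⟩ => ⟨ζ, hζ, hζG, F, hF, ?_⟩
          rw [KNP.pcQhat_eq (heig n ω) hζ]
          refine h1 _ hζG F hF.1 (fun w hw => ?_) hFδ
          refine (abs_sub_le _ (g w) _).trans ?_
          linarith [hζg w hw, hgδ w hw]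
      refine (key.and (KNP.WithProbToOne.of_tendstoInMeasure hr (half_pos he))).mono_ae ?_
      filter_upwards [hmin] with n hn
      filter_upwards [hn] with ω hω ⟨⟨ζ, hζ, hζ𝒜, F, hF, hQF⟩, h2⟩
      have h3 := hω.2.2.2 ζ hζ hζ𝒜 F hF
      rw [sub_zero] at h2
      -- The estimated function itself does lie in `𝒢`, so the criterion in `ζ` is turned back into
      -- `Qhat`, to which the sieve-free consistency result applies.
      rw [← KNP.pcQhat_eq (heig n ω) hω.1]
      linarith [(abs_lt.1 h2).2]
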